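/- Let $\mathbb{T}=\mathbb{R}/2\pi\mathbb{Z}$, and let $X=L^2_0(\mathbb{T}^2)$ be the space of all complex-valued $\omega\in L^2(\mathbb{T}^2)$ with $\int_0^{2\pi}\omega(x,y)\,dx=0$ for a.e. $y\in\mathbb{T}$. Let $A=\Delta$ in $X$ with domain $D(A)=W^{2,2}(\mathbb{T}^2)\cap X$, and let $$\hat\Lambda\,\omega=-i\,\partial_x\big(\sin y\,(\omega+A^{-1}\omega)\big),\qquad D(\hat\Lambda)=\{\omega\in X:\ \partial_x(\sin y\,\omega)\in X\}.$$ For $\alpha\in\mathbb{R}$ put $L_\alpha=A-i\alpha\hat\Lambda$ with $D(L_\alpha)=D(A)$. For $l\in\mathbb{Z}$ let $(\mathcal{P}_l\omega)(x,y)=\frac1{2\pi}\int_0^{2\pi}\omega(s,y)e^{-ils}\,ds\;e^{ilx}$, let $$Y=\Big\{\omega\in X:\ \int_0^{2\pi}(\mathcal{P}_l\omega)(x,y)\,dy=0\ \text{ for } |l|=1 \text{ and all } x\in\mathbb{T}\Big\},$$ and let $\mathbb{Q}$ be the orthogonal projection of $X$ onto $Y$. The operator $\mathbb{Q}L_\alpha$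 is considered in $Y$ with domain $D(A)\cap Y$. For $l\in\mathbb{Z}\setminus\{0\}$ let, in $L^2(\mathbb{T})$, $A_l=\partial_y^2-l^2$ with $D(A_l)=W^{2,2}(\mathbb{T})$, $\hat\Lambda_l f=\sin y\,(f+A_l^{-1}f)$ with $D(\hat\Lambda_l)=L^2(\mathbb{T})$, and $L_{\alpha,l}=A_l-i\alpha l\hat\Lambda_l$ with $D(L_{\alpha,l})=W^{2,2}(\mathbb{T})$. Let $Y_l=L^2(\mathbb{T})$ if $l\neq\pm1$ and $Y_l=\{f\in L^2(\mathbb{T}):\int_0^{2\pi}f\,dy=0\}$ if $l=\pm1$, and let $\mathbb{Q}_l$ be the orthogonal projection of $L^2(\mathbb{T})$ onto $Y_l$. The operator $\mathbb{Q}_lL_{\alpha,l}$ is considered in $Y_l$ with domain $W^{2,2}(\mathbb{T})\cap Y_l$. **Theorem.** For all sufficiently large $|\alpha|$ the imaginary axis is contained in the resolvent set of $\mathbb{Q}L_\alpha$ in $Y$ and in the resolvent set of $L_\alpha$ in $X$, and $$\lim_{|\alpha|\to\infty}\ \sup_{\lambda\in\mathbb{R}}\big\|(i\lambda-\mathbb{Q}L_\alpha)^{-1}\big\|_{Y\to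 Y}=\lim_{|\alpha|\to\infty}\ \sup_{\lambda\in\mathbb{R}}\big\|\mathbb{Q}(i\lambda-L_\alpha)^{-1}\big\|_{X\to X}=0.$$ Likewise, for each $l\in\mathbb{Z}\setminus\{0\}$ and all $|\alpha|$ sufficiently large (depending on $l$), the imaginary axis is contained in the resolvent set of $\mathbb{Q}_lL_{\alpha,l}$ in $Y_l$ and in the resolvent set of $L_{\alpha,l}$ in $L^2(\mathbb{T})$, and $$\lim_{|\alpha|\to\infty}\ \sup_{\lambda\in\mathbb{R}}\big\|(i\lambda-\mathbb{Q}_lL_{\alpha,l})^{-1}\big\|_{Y_l\to Y_l}=\lim_{|\alpha|\to\infty}\ \sup_{\lambda\in\mathbb{R}}\big\|\mathbb{Q}_l(i\lambda-L_{\alpha,l})^{-1}\big\|_{L^2(\mathbb{T})\to L^2(\mathbb{T})}=0.$$ -/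

import Mathlib

open MeasureTheory Filter Topology

noncomputable section

namespace Kolmogorov

/-! ### Unbounded operators: resolvent set, resolvent, compression -/

/-- `R` is a bounded two-sided inverse of `z - T : D(T) → E`. -/
structure IsResolvent {E : Type*} [NormedAddCommGroup E] [NormedSpace ℂ E]
    (T : E →ₗ.[ℂ] E) (z : ℂ) (R : E →L[ℂ] E) : Prop where
  right_inv : ∀ f : E, ∃ h : R f ∈ T.domain, z • R f - T ⟨R f, h⟩ = f
  left_inv : ∀ u : T.domain, R (z • (u : E) - T u) = u

/-- The resolvent set of an unbounded operator. -/
def opResolventSet {E : Type*} [NormedAddCommGroup E] [NormedSpace ℂ E]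
    (T : E →ₗ.[ℂ] E) : Set ℂ :=
  {z | ∃ R : E →L[ℂ] E, IsResolvent T z R}

open Classical in
/-- The resolvent `(z - T)⁻¹` for `z` in the resolvent set (and `0` elsewhere). -/
def opResolvent {E : Type*} [NormedAddCommGroup E] [NormedSpace ℂ E]
    (T : E →ₗ.[ℂ] E) (z : ℂ) : E →L[ℂ] E :=
  if h : ∃ R : E →L[ℂ] E, IsResolvent T z R then h.choose else 0

/-- The operator `Q T` in the subspace `Y`, with domain `D(T) ∩ Y`, where `Q` is the orthogonal
projection onto `Y`. -/
def compression {H : Type*} [NormedAddCommGroup H] [InnerProductSpace ℂ H]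
    (Y : Submodule ℂ H) [Y.HasOrthogonalProjection] (T : H →ₗ.[ℂ] H) : Y →ₗ.[ℂ] Y where
  domain := T.domain.comap Y.subtype
  toFun :=
    { toFun := fun u => Y.orthogonalProjectionOnto (T ⟨(u : Y), u.2⟩)
      map_add' := fun u v => by
        rw [← map_add, ← LinearPMap.map_add]; rfl
      map_smul' := fun c u => by
        rw [RingHom.id_apply, ← map_smul, ← LinearPMap.map_smul]; rfl }

/-! ### The tori and the `L²` spaces -/

instance instFactTwoPiPos : Fact (0 < 2 * Real.pi) := ⟨Real.two_pi_pos⟩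

/-- The circle `ℝ / 2πℤ`, with Lebesgue measure of total mass `2π`. -/
abbrev Circ : Type := AddCircle (2 * Real.pi)

/-- The torus `(ℝ / 2πℤ)²`; points are `(x, y)`. -/
abbrev Torus : Type := Circ × Circ

abbrev L2Circ : Type := Lp ℂ 2 (volume : Measure Circ)

abbrev L2Torus : Type := Lp ℂ 2 (volume : Measure Torus)

/-- The sine function on the circle. -/
def sinC : Circ → ℝ := Real.sin_periodic.lift

/-! ### Weak derivatives -/

open scoped ContDiff in
/-- Smooth test functions on the circle. -/
def TestCirc (φ : C(Circ, ℂ)) : Prop :=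
  ContDiff ℝ ∞ (fun y : ℝ => φ (y : Circ))

open scoped ContDiff in
/-- Smooth test functions on the torus. -/
def TestTorus (φ : C(Torus, ℂ)) : Prop :=
  ContDiff ℝ ∞ (fun p : ℝ × ℝ => φ ((p.1 : Circ), (p.2 : Circ)))

/-- Classical derivative on the circle. -/
def dCirc (φ : Circ → ℂ) (y : Circ) : ℂ := deriv (fun t : ℝ => φ (y + (t : Circ))) 0

/-- Classical partial derivative in `x`. -/
def dX (φ : Torus → ℂ) (p : Torus) : ℂ := deriv (fun t : ℝ => φ (p.1 + (t : Circ), p.2)) 0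

/-- Classical partial derivative in `y`. -/
def dY (φ : Torus → ℂ) (p : Torus) : ℂ := deriv (fun t : ℝ => φ (p.1, p.2 + (t : Circ))) 0

/-- `g` is the weak derivative of `f` on the circle. -/
def HasWeakD (f g : Circ → ℂ) : Prop :=
  ∀ φ : C(Circ, ℂ), TestCirc φ → ∫ y, f y * dCirc φ y = -∫ y, g y * φ y

/-- `g` is the weak derivative `∂ₓ f` on the torus. -/
def HasWeakDX (f g : Torus → ℂ) : Prop :=
  ∀ φ : C(Torus, ℂ), TestTorus φ → ∫ p, f p * dX φ p = -∫ p, g p * φ p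

/-- `g` is the weak derivative `∂_y f` on the torus. -/
def HasWeakDY (f g : Torus → ℂ) : Prop :=
  ∀ φ : C(Torus, ℂ), TestTorus φ → ∫ p, f p * dY φ p = -∫ p, g p * φ p

theorem continuous_sinC : Continuous sinC :=
  Real.continuous_sin.quotient_lift _

theorem continuous_dCirc {φ : C(Circ, ℂ)} (hφ : TestCirc φ) : Continuous (dCirc φ) := by
  have hq : IsOpenQuotientMap (fun y : ℝ => (y : Circ)) := QuotientAddGroup.isOpenQuotientMap_mk
  rw [hq.isQuotientMap.continuous_iff]
  have h : (dCirc φ) ∘ (fun y : ℝ => (y : Circ)) = deriv (fun y : ℝ => φ (y : Circ)) := by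
    funext y
    have := deriv_comp_const_add (f := fun y : ℝ => φ (y : Circ)) y 0
    simpa [dCirc] using this
  rw [h]
  exact hφ.continuous_deriv (by simp)

theorem isOpenQuotientMap_torus :
    IsOpenQuotientMap (fun p : ℝ × ℝ => (((p.1 : Circ), (p.2 : Circ)) : Torus)) :=
  IsOpenQuotientMap.prodMap QuotientAddGroup.isOpenQuotientMap_mk
    QuotientAddGroup.isOpenQuotientMap_mk

theorem continuous_dX {φ : C(Torus, ℂ)} (hφ : TestTorus φ) : Continuous (dX φ) := by
  rw [isOpenQuotientMap_torus.isQuotientMap.continuous_iff]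
  have h : (dX φ) ∘ (fun p : ℝ × ℝ => (((p.1 : Circ), (p.2 : Circ)) : Torus)) =
      fun p => fderiv ℝ (fun p : ℝ × ℝ => φ ((p.1 : Circ), (p.2 : Circ))) p (1, 0) := by
    funext p
    have h1 := ((hφ.differentiable (by simp)) p).lineDeriv_eq_fderiv (v := ((1, 0) : ℝ × ℝ))
    rw [← h1]
    simp [dX, lineDeriv]
  rw [h]
  exact (hφ.continuous_fderiv (by simp)).clm_apply continuous_const

theorem continuous_dY {φ : C(Torus, ℂ)} (hφ : TestTorus φ) : Continuous (dY φ) := by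
  rw [isOpenQuotientMap_torus.isQuotientMap.continuous_iff]
  have h : (dY φ) ∘ (fun p : ℝ × ℝ => (((p.1 : Circ), (p.2 : Circ)) : Torus)) =
      fun p => fderiv ℝ (fun p : ℝ × ℝ => φ ((p.1 : Circ), (p.2 : Circ))) p (0, 1) := by
    funext p
    have h1 := ((hφ.differentiable (by simp)) p).lineDeriv_eq_fderiv (v := ((0, 1) : ℝ × ℝ))
    rw [← h1]
    simp [dY, lineDeriv]
  rw [h]
  exact (hφ.continuous_fderiv (by simp)).clm_apply continuous_const

theorem integrable_mul_continuous {S : Type*} [TopologicalSpace S] [CompactSpace S]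
    [MeasurableSpace S] [BorelSpace S] {μ : Measure S}
    {f c : S → ℂ} (hf : Integrable f μ) (hc : Continuous c) :
    Integrable (fun s => f s * c s) μ := by
  obtain ⟨C, hC⟩ := isCompact_univ.exists_bound_of_continuousOn hc.continuousOn
  exact hf.mul_bdd (c := C) hc.aestronglyMeasurable (ae_of_all _ fun s => hC s (Set.mem_univ s))

theorem integrable_L2 {S : Type*} [MeasurableSpace S] {μ : Measure S} [IsFiniteMeasure μ]
    (f : Lp ℂ 2 μ) : Integrable f μ :=
  (Lp.memLp f).integrable one_le_two

theorem weak_add {S : Type*} [TopologicalSpace S] [CompactSpace S]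
    [MeasurableSpace S] [BorelSpace S] {μ : Measure S} {f f₁ f₂ g g₁ g₂ d c : S → ℂ}
    (hf : f =ᵐ[μ] fun s => f₁ s + f₂ s) (hg : g =ᵐ[μ] fun s => g₁ s + g₂ s)
    (hf₁ : Integrable f₁ μ) (hf₂ : Integrable f₂ μ) (hg₁ : Integrable g₁ μ)
    (hg₂ : Integrable g₂ μ) (hd : Continuous d) (hc : Continuous c)
    (h₁ : ∫ s, f₁ s * d s ∂μ = -∫ s, g₁ s * c s ∂μ)
    (h₂ : ∫ s, f₂ s * d s ∂μ = -∫ s, g₂ s * c s ∂μ) :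
    ∫ s, f s * d s ∂μ = -∫ s, g s * c s ∂μ := by
  have e₁ : ∫ s, f s * d s ∂μ = ∫ s, (f₁ s * d s + f₂ s * d s) ∂μ :=
    integral_congr_ae (hf.mono fun s hs => by simp only [hs, add_mul])
  have e₂ : ∫ s, g s * c s ∂μ = ∫ s, (g₁ s * c s + g₂ s * c s) ∂μ :=
    integral_congr_ae (hg.mono fun s hs => by simp only [hs, add_mul])
  rw [e₁, e₂, integral_add (integrable_mul_continuous hf₁ hd) (integrable_mul_continuous hf₂ hd),
    integral_add (integrable_mul_continuous hg₁ hc) (integrable_mul_continuous hg₂ hc), h₁, h₂]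
  ring

theorem weak_smul {S : Type*} [MeasurableSpace S] {μ : Measure S} {f f₁ g g₁ d c : S → ℂ}
    (a : ℂ) (hf : f =ᵐ[μ] fun s => a * f₁ s) (hg : g =ᵐ[μ] fun s => a * g₁ s)
    (h₁ : ∫ s, f₁ s * d s ∂μ = -∫ s, g₁ s * c s ∂μ) :
    ∫ s, f s * d s ∂μ = -∫ s, g s * c s ∂μ := by
  have e₁ : ∫ s, f s * d s ∂μ = ∫ s, a * (f₁ s * d s) ∂μ :=
    integral_congr_ae (hf.mono fun s hs => by simp only [hs, mul_assoc])
  have e₂ : ∫ s, g s * c s ∂μ = ∫ s, a * (g₁ s * c s) ∂μ :=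
    integral_congr_ae (hg.mono fun s hs => by simp only [hs, mul_assoc])
  rw [e₁, e₂, integral_const_mul, integral_const_mul, h₁]
  ring

theorem coeFn_add_ae {S : Type*} [MeasurableSpace S] {μ : Measure S} (f g : Lp ℂ 2 μ) :
    (f + g : Lp ℂ 2 μ) =ᵐ[μ] fun s => f s + g s :=
  Lp.coeFn_add f g

theorem coeFn_smul_ae {S : Type*} [MeasurableSpace S] {μ : Measure S} (a : ℂ) (f : Lp ℂ 2 μ) :
    (a • f : Lp ℂ 2 μ) =ᵐ[μ] fun s => a * f s :=
  Lp.coeFn_smul a f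

theorem coeFn_zero_ae {S : Type*} [MeasurableSpace S] {μ : Measure S} :
    (0 : Lp ℂ 2 μ) =ᵐ[μ] fun s => (0 : ℂ) * (0 : S → ℂ) s := by
  filter_upwards [Lp.coeFn_zero ℂ 2 μ] with s hs
  simpa using hs

theorem HasWeakD.add {f₁ f₂ g₁ g₂ : L2Circ} (h₁ : HasWeakD f₁ g₁) (h₂ : HasWeakD f₂ g₂) :
    HasWeakD (f₁ + f₂ : L2Circ) (g₁ + g₂ : L2Circ) := fun φ hφ =>
  weak_add (coeFn_add_ae _ _) (coeFn_add_ae _ _) (integrable_L2 _) (integrable_L2 _)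
    (integrable_L2 _) (integrable_L2 _) (continuous_dCirc hφ) φ.continuous (h₁ φ hφ) (h₂ φ hφ)

theorem HasWeakD.smul {f g : L2Circ} (a : ℂ) (h : HasWeakD f g) :
    HasWeakD (a • f : L2Circ) (a • g : L2Circ) := fun φ hφ =>
  weak_smul a (coeFn_smul_ae _ _) (coeFn_smul_ae _ _) (h φ hφ)

theorem HasWeakD.zero : HasWeakD (0 : L2Circ) (0 : L2Circ) := fun φ _ =>
  weak_smul (f₁ := 0) (g₁ := 0) 0 coeFn_zero_ae coeFn_zero_ae (by simp)

theorem HasWeakDX.add {f₁ f₂ g₁ g₂ : L2Torus} (h₁ : HasWeakDX f₁ g₁) (h₂ : HasWeakDX f₂ g₂) :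
    HasWeakDX (f₁ + f₂ : L2Torus) (g₁ + g₂ : L2Torus) := fun φ hφ =>
  weak_add (coeFn_add_ae _ _) (coeFn_add_ae _ _) (integrable_L2 _) (integrable_L2 _)
    (integrable_L2 _) (integrable_L2 _) (continuous_dX hφ) φ.continuous (h₁ φ hφ) (h₂ φ hφ)

theorem HasWeakDX.smul {f g : L2Torus} (a : ℂ) (h : HasWeakDX f g) :
    HasWeakDX (a • f : L2Torus) (a • g : L2Torus) := fun φ hφ =>
  weak_smul a (coeFn_smul_ae _ _) (coeFn_smul_ae _ _) (h φ hφ)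

theorem HasWeakDX.zero : HasWeakDX (0 : L2Torus) (0 : L2Torus) := fun φ _ =>
  weak_smul (f₁ := 0) (g₁ := 0) 0 coeFn_zero_ae coeFn_zero_ae (by simp)

theorem HasWeakDY.add {f₁ f₂ g₁ g₂ : L2Torus} (h₁ : HasWeakDY f₁ g₁) (h₂ : HasWeakDY f₂ g₂) :
    HasWeakDY (f₁ + f₂ : L2Torus) (g₁ + g₂ : L2Torus) := fun φ hφ =>
  weak_add (coeFn_add_ae _ _) (coeFn_add_ae _ _) (integrable_L2 _) (integrable_L2 _)
    (integrable_L2 _) (integrable_L2 _) (continuous_dY hφ) φ.continuous (h₁ φ hφ) (h₂ φ hφ)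

theorem HasWeakDY.smul {f g : L2Torus} (a : ℂ) (h : HasWeakDY f g) :
    HasWeakDY (a • f : L2Torus) (a • g : L2Torus) := fun φ hφ =>
  weak_smul a (coeFn_smul_ae _ _) (coeFn_smul_ae _ _) (h φ hφ)

theorem HasWeakDY.zero : HasWeakDY (0 : L2Torus) (0 : L2Torus) := fun φ _ =>
  weak_smul (f₁ := 0) (g₁ := 0) 0 coeFn_zero_ae coeFn_zero_ae (by simp)

/-! ### The operators on the torus -/

theorem ae_slice {f g : Torus → ℂ} (h : f =ᵐ[volume] g) :
    ∀ᵐ y : Circ, (fun x : Circ => f (x, y)) =ᵐ[volume] fun x => g (x, y) :=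
  Measure.ae_ae_of_ae_prod (p := fun q : Circ × Circ => f q.swap = g q.swap)
    (Measure.measurePreserving_swap.quasiMeasurePreserving.ae h)

/-- `X = L²₀(𝕋²)`: the functions with zero mean in `x` for a.e. `y`. -/
def L2Zero : Submodule ℂ L2Torus where
  carrier := {ω | ∀ᵐ y : Circ, ∫ x : Circ, ω (x, y) = 0}
  zero_mem' := by
    have h := ae_slice (Lp.coeFn_zero ℂ 2 (volume : Measure Torus))
    filter_upwards [h] with y hy
    rw [integral_congr_ae hy]
    simp
  add_mem' := by
    intro f g hf hg
    have h := ae_slice (coeFn_add_ae f g)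
    filter_upwards [h, hf, hg, (integrable_L2 f).prod_left_ae, (integrable_L2 g).prod_left_ae]
      with y hy hfy hgy if_ ig
    rw [integral_congr_ae hy]
    rw [integral_add if_ ig, hfy, hgy, add_zero]
  smul_mem' := by
    intro c f hf
    have h := ae_slice (coeFn_smul_ae c f)
    change ∀ᵐ y : Circ, ∫ x : Circ, (c • f : L2Torus) (x, y) = 0
    change ∀ᵐ y : Circ, ∫ x : Circ, f (x, y) = 0 at hf
    filter_upwards [h, hf] with y hy hfy
    rw [integral_congr_ae hy]
    rw [integral_const_mul, hfy, mul_zero]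

theorem isClosed_L2Zero : IsClosed (L2Zero : Set L2Torus) := by
  have h : (L2Zero : Set L2Torus) = ⋂ (s : Set Circ) (_ : MeasurableSet s),
      {f : L2Torus | ∫ p in Set.univ ×ˢ s, f p = 0} := by
    ext f
    have hfub : ∀ s : Set Circ, ∫ p in Set.univ ×ˢ s, f p = ∫ y in s, ∫ x : Circ, f (x, y) := by
      intro s
      have h1 : (volume : Measure Torus).restrict (Set.univ ×ˢ s) =
          (volume : Measure Circ).prod ((volume : Measure Circ).restrict s) := by
        rw [Measure.volume_eq_prod, ← Measure.prod_restrict, Measure.restrict_univ]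
      rw [h1]
      refine integral_prod_symm _ ?_
      rw [← h1]
      exact (integrable_L2 f).integrableOn
    simp only [Set.mem_iInter, Set.mem_ofPred_eq, hfub]
    constructor
    · intro hf s _
      rw [integral_congr_ae (ae_restrict_of_ae hf)]
      simp
    · intro hf
      exact (integrable_L2 f).integral_prod_right.ae_eq_zero_of_forall_setIntegral_eq_zero
        fun s hs _ => hf s hs
  rw [h]
  refine isClosed_iInter fun s => isClosed_iInter fun hs => ?_
  have hm : MeasurableSet ((Set.univ : Set Circ) ×ˢ s) := MeasurableSet.univ.prod hs
  have : {f : L2Torus | ∫ p in Set.univ ×ˢ s, f p = 0} =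
      {f : L2Torus | inner ℂ (indicatorConstLp 2 hm (measure_ne_top volume _) (1 : ℂ)) f = 0} := by
    ext f
    rw [Set.mem_ofPred_eq, Set.mem_ofPred_eq, L2.inner_indicatorConstLp_one]
  rw [this]
  exact isClosed_eq (continuous_const.inner continuous_id) continuous_const

/-- `L²₀(𝕋²)` as a Hilbert space, with the inner product of `L²(𝕋²)`. -/
def SpaceX : Type := L2Zero

instance : NormedAddCommGroup SpaceX := inferInstanceAs (NormedAddCommGroup L2Zero)

instance : InnerProductSpace ℂ SpaceX := inferInstanceAs (InnerProductSpace ℂ L2Zero)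

instance : CompleteSpace SpaceX := isClosed_L2Zero.completeSpace_coe

/-- The inclusion of `L²₀(𝕋²)` into `L²(𝕋²)`. -/
def SpaceX.incl : SpaceX →ₗᵢ[ℂ] L2Torus := L2Zero.subtypeₗᵢ

instance : CoeOut SpaceX L2Torus := ⟨fun f => SpaceX.incl f⟩

/-- The graph of `A`, the realization of `Δ` in `L²₀(𝕋²)` with domain `W^{2,2}(𝕋²) ∩ L²₀(𝕋²)`. -/
def graphA : Submodule ℂ (SpaceX × SpaceX) where
  carrier := {p | ∃ fx fy fxx fxy fyy : L2Torus,
    HasWeakDX (p.1 : L2Torus) fx ∧ HasWeakDY (p.1 : L2Torus) fy ∧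
    HasWeakDX fx fxx ∧ HasWeakDY fx fxy ∧ HasWeakDY fy fyy ∧ (p.2 : L2Torus) = fxx + fyy}
  zero_mem' := ⟨0, 0, 0, 0, 0, .zero, .zero, .zero, .zero, .zero, by simp⟩
  add_mem' := by
    rintro p q ⟨a, b, c, d, e, h1, h2, h3, h4, h5, h6⟩ ⟨a', b', c', d', e', k1, k2, k3, k4, k5, k6⟩
    refine ⟨a + a', b + b', c + c', d + d', e + e', h1.add k1, h2.add k2, h3.add k3, h4.add k4,
      h5.add k5, ?_⟩
    rw [Prod.snd_add, map_add, h6, k6]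
    abel
  smul_mem' := by
    rintro r p ⟨a, b, c, d, e, h1, h2, h3, h4, h5, h6⟩
    refine ⟨r • a, r • b, r • c, r • d, r • e, h1.smul r, h2.smul r, h3.smul r, h4.smul r,
      h5.smul r, ?_⟩
    rw [Prod.smul_snd, map_smul, h6, smul_add]

/-- `A = Δ` in `L²₀(𝕋²)`. -/
def opA : SpaceX →ₗ.[ℂ] SpaceX := graphA.toLinearPMap

/-- `sin y · f`. -/
def sinMul (f : Torus → ℂ) (p : Torus) : ℂ := (sinC p.2 : ℂ) * f p

theorem integrable_sinMul (f : L2Torus) : Integrable (sinMul f) := by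
  have h : Continuous fun p : Torus => (sinC p.2 : ℂ) :=
    Complex.continuous_ofReal.comp (continuous_sinC.comp continuous_snd)
  refine (integrable_mul_continuous (integrable_L2 f) h).congr (ae_of_all _ fun p => ?_)
  simp only [sinMul, mul_comm]

theorem HasWeakDX.sin_add {f₁ f₂ g₁ g₂ : L2Torus} (h₁ : HasWeakDX (sinMul f₁) g₁)
    (h₂ : HasWeakDX (sinMul f₂) g₂) :
    HasWeakDX (sinMul (f₁ + f₂ : L2Torus)) (g₁ + g₂ : L2Torus) := fun φ hφ =>
  weak_add ((coeFn_add_ae f₁ f₂).mono fun p hp => by simp only [sinMul, hp, mul_add])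
    (coeFn_add_ae _ _) (integrable_sinMul f₁) (integrable_sinMul f₂)
    (integrable_L2 _) (integrable_L2 _) (continuous_dX hφ) φ.continuous (h₁ φ hφ) (h₂ φ hφ)

theorem HasWeakDX.sin_smul {f g : L2Torus} (a : ℂ) (h : HasWeakDX (sinMul f) g) :
    HasWeakDX (sinMul (a • f : L2Torus)) (a • g : L2Torus) := fun φ hφ =>
  weak_smul a ((coeFn_smul_ae a f).mono fun p hp => by simp only [sinMul, hp, mul_left_comm])
    (coeFn_smul_ae _ _) (h φ hφ)

theorem HasWeakDX.sin_zero : HasWeakDX (sinMul (0 : L2Torus)) (0 : L2Torus) := fun φ _ =>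
  weak_smul (f₁ := 0) (g₁ := 0) 0
    (coeFn_zero_ae.mono fun p hp => by simp only [sinMul, hp, zero_mul, mul_zero])
    coeFn_zero_ae (by simp)

/-- The graph of `Λ̂ ω = -i ∂ₓ (sin y (ω + A⁻¹ ω))` in `L²₀(𝕋²)`, where `ψ = A⁻¹ ω`; the domain
consists of the `ω` with `∂ₓ (sin y ω) ∈ L²₀(𝕋²)`. -/
def graphΛ : Submodule ℂ (SpaceX × SpaceX) where
  carrier := {p | (∃ k : SpaceX, HasWeakDX (sinMul (p.1 : L2Torus)) (k : L2Torus)) ∧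
    ∃ ψ g : SpaceX, (ψ, p.1) ∈ opA.graph ∧
      HasWeakDX (sinMul (p.1 + ψ : SpaceX)) (g : L2Torus) ∧ p.2 = (-Complex.I) • g}
  zero_mem' := by
    refine ⟨⟨0, .sin_zero⟩, 0, 0, opA.graph.zero_mem, ?_, by simp⟩
    have h : ((0 : SpaceX × SpaceX).1 + 0 : SpaceX) = 0 := by simp
    rw [h]
    exact .sin_zero
  add_mem' := by
    rintro p q ⟨⟨k, hk⟩, ψ, g, h1, h2, h3⟩ ⟨⟨k', hk'⟩, ψ', g', h1', h2', h3'⟩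
    refine ⟨⟨k + k', hk.sin_add hk'⟩, ψ + ψ', g + g', opA.graph.add_mem h1 h1', ?_, ?_⟩
    · have h : ((p + q).1 + (ψ + ψ') : SpaceX) = (p.1 + ψ) + (q.1 + ψ') := by
        rw [Prod.fst_add]; abel
      rw [h]
      exact h2.sin_add h2'
    · rw [Prod.snd_add, h3, h3', smul_add]
  smul_mem' := by
    rintro a p ⟨⟨k, hk⟩, ψ, g, h1, h2, h3⟩
    refine ⟨⟨a • k, hk.sin_smul a⟩, a • ψ, a • g, opA.graph.smul_mem a h1, ?_, ?_⟩
    · have h : ((a • p).1 + a • ψ : SpaceX) = a • (p.1 + ψ) := by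
        rw [Prod.smul_fst, smul_add]
      rw [h]
      exact h2.sin_smul a
    · rw [Prod.smul_snd, h3, smul_comm]

/-- `Λ̂ = -i ∂ₓ sin y (I + A⁻¹)` in `L²₀(𝕋²)`. -/
def opΛ : SpaceX →ₗ.[ℂ] SpaceX := graphΛ.toLinearPMap

/-- `L_α = A - i α Λ̂` in `L²₀(𝕋²)`. The domain is `D(A) ∩ D(Λ̂) = D(A)`. -/
def opL (α : ℝ) : SpaceX →ₗ.[ℂ] SpaceX := opA - (Complex.I * (α : ℂ)) • opΛ

/-- The projection `𝒫_l` onto the `l`-th Fourier mode in `x`; `fourier l x = e^{ilx}`. -/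
def modeProj (l : ℤ) (f : Torus → ℂ) (p : Torus) : ℂ :=
  (1 / (2 * Real.pi) : ℂ) * (∫ s : Circ, f (s, p.2) * fourier (-l) s) * fourier l p.1

theorem integral_modeProj (l : ℤ) (f : L2Torus) (x : Circ) :
    ∫ y : Circ, modeProj l f (x, y) =
      (1 / (2 * Real.pi) : ℂ) * (∫ p : Torus, f p * fourier (-l) p.1) * fourier l x := by
  have hc : Continuous fun p : Torus => (fourier (-l) p.1 : ℂ) :=
    (fourier (-l)).continuous.comp continuous_fst
  have h : ∫ p : Torus, f p * fourier (-l) p.1 =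
      ∫ y : Circ, ∫ s : Circ, f (s, y) * fourier (-l) s :=
    integral_prod_symm _ (integrable_mul_continuous (integrable_L2 f) hc)
  simp only [modeProj]
  rw [integral_mul_const, integral_const_mul, h]

theorem integral_modeProj_eq_zero_iff (l : ℤ) (f : L2Torus) :
    (∀ x : Circ, ∫ y : Circ, modeProj l f (x, y) = 0) ↔
      ∫ p : Torus, f p * fourier (-l) p.1 = 0 := by
  simp only [integral_modeProj]
  constructor
  · intro h
    have h0 := h 0
    simpa [Real.pi_ne_zero] using h0
  · intro h x
    rw [h, mul_zero, zero_mul]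

theorem exists_pairing {S : Type*} [TopologicalSpace S] [CompactSpace S]
    [MeasurableSpace S] [BorelSpace S] {μ : Measure S} [IsFiniteMeasure μ]
    (c : C(S, ℂ)) : ∃ T : Lp ℂ 2 μ →L[ℂ] ℂ, ∀ f : Lp ℂ 2 μ, T f = ∫ s, f s * c s ∂μ := by
  refine ⟨innerSL ℂ (ContinuousMap.toLp 2 μ ℂ (star c)), fun f => ?_⟩
  rw [innerSL_apply_apply, L2.inner_def]
  refine integral_congr_ae ?_
  filter_upwards [ContinuousMap.coeFn_toLp (p := 2) (𝕜 := ℂ) μ (star c)] with s hs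
  rw [hs]
  simp

/-- The subspace `Y` of `L²₀(𝕋²)`. -/
def spaceY : Submodule ℂ SpaceX where
  carrier := {ω | ∀ l : ℤ, |l| = 1 → ∀ x : Circ, ∫ y : Circ, modeProj l (ω : L2Torus) (x, y) = 0}
  zero_mem' := by
    intro l _
    rw [integral_modeProj_eq_zero_iff]
    obtain ⟨T, hT⟩ := exists_pairing (μ := (volume : Measure Torus))
      ((fourier (-l)).comp ⟨Prod.fst, continuous_fst⟩)
    exact (hT _).symm.trans (map_zero T)
  add_mem' := by
    intro f g hf hg l hl
    have hf := (integral_modeProj_eq_zero_iff l f).1 (hf l hl)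
    have hg := (integral_modeProj_eq_zero_iff l g).1 (hg l hl)
    rw [integral_modeProj_eq_zero_iff]
    obtain ⟨T, hT⟩ := exists_pairing (μ := (volume : Measure Torus))
      ((fourier (-l)).comp ⟨Prod.fst, continuous_fst⟩)
    have := map_add T (f : L2Torus) g
    rw [hT, hT, hT] at this
    refine this.trans ?_
    exact (congrArg₂ (· + ·) hf hg).trans (add_zero _)
  smul_mem' := by
    intro c f hf l hl
    have hf := (integral_modeProj_eq_zero_iff l f).1 (hf l hl)
    rw [integral_modeProj_eq_zero_iff]
    obtain ⟨T, hT⟩ := exists_pairing (μ := (volume : Measure Torus))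
      ((fourier (-l)).comp ⟨Prod.fst, continuous_fst⟩)
    have := map_smul T c (f : L2Torus)
    rw [hT, hT] at this
    exact this.trans ((congrArg (c • ·) hf).trans (smul_zero _))

theorem isClosed_spaceY : IsClosed (spaceY : Set SpaceX) := by
  have h : (spaceY : Set SpaceX) = ⋂ (l : ℤ) (_ : |l| = 1),
      {f : SpaceX | ∫ p : Torus, (f : L2Torus) p * fourier (-l) p.1 = 0} := by
    ext f
    simp only [Set.mem_iInter, Set.mem_ofPred_eq, ← integral_modeProj_eq_zero_iff]
    rfl
  rw [h]
  refine isClosed_iInter fun l => isClosed_iInter fun _ => ?_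
  obtain ⟨T, hT⟩ := exists_pairing (μ := (volume : Measure Torus))
    ((fourier (-l)).comp ⟨Prod.fst, continuous_fst⟩)
  have : {f : SpaceX | ∫ p : Torus, (f : L2Torus) p * fourier (-l) p.1 = 0} =
      {f : SpaceX | T (f : L2Torus) = 0} := by
    ext f
    rw [Set.mem_ofPred_eq, Set.mem_ofPred_eq, hT]
    rfl
  rw [this]
  exact isClosed_eq (T.continuous.comp continuous_subtype_val) continuous_const

instance instCompleteSpaceY : CompleteSpace spaceY :=
  isClosed_spaceY.completeSpace_coe

/-! ### The operators for a single Fourier mode -/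

/-- The graph of `A_l = ∂_y² - l²` in `L²(𝕋)` with domain `W^{2,2}(𝕋)`. -/
def graphAMode (l : ℤ) : Submodule ℂ (L2Circ × L2Circ) where
  carrier := {p | ∃ f₁ f₂ : L2Circ, HasWeakD p.1 f₁ ∧ HasWeakD f₁ f₂ ∧
    p.2 = f₂ - ((l : ℂ) ^ 2) • p.1}
  zero_mem' := ⟨0, 0, .zero, .zero, by simp⟩
  add_mem' := by
    rintro p q ⟨a, b, h1, h2, h3⟩ ⟨a', b', k1, k2, k3⟩
    refine ⟨a + a', b + b', h1.add k1, h2.add k2, ?_⟩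
    rw [Prod.snd_add, Prod.fst_add, h3, k3, smul_add]
    abel
  smul_mem' := by
    rintro r p ⟨a, b, h1, h2, h3⟩
    refine ⟨r • a, r • b, h1.smul r, h2.smul r, ?_⟩
    rw [Prod.smul_snd, Prod.smul_fst, h3, smul_sub, smul_comm r]

/-- `A_l = ∂_y² - l²` in `L²(𝕋)`. -/
def opAMode (l : ℤ) : L2Circ →ₗ.[ℂ] L2Circ := (graphAMode l).toLinearPMap

/-- The graph of `Λ̂_l f = sin y (f + A_l⁻¹ f)` in `L²(𝕋)`, where `ψ = A_l⁻¹ f`. -/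
def graphΛMode (l : ℤ) : Submodule ℂ (L2Circ × L2Circ) where
  carrier := {p | ∃ ψ : L2Circ, (ψ, p.1) ∈ (opAMode l).graph ∧
    p.2 =ᵐ[volume] fun y => (sinC y : ℂ) * (p.1 + ψ : L2Circ) y}
  zero_mem' := by
    refine ⟨0, (opAMode l).graph.zero_mem, ?_⟩
    have h : ((0 : L2Circ × L2Circ).1 + 0 : L2Circ) = 0 := by simp
    rw [h]
    filter_upwards [Lp.coeFn_zero ℂ 2 (volume : Measure Circ)] with y hy
    rw [Prod.snd_zero, hy]
    simp
  add_mem' := by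
    rintro p q ⟨ψ, h1, h2⟩ ⟨ψ', k1, k2⟩
    refine ⟨ψ + ψ', (opAMode l).graph.add_mem h1 k1, ?_⟩
    have h : ((p + q).1 + (ψ + ψ') : L2Circ) = (p.1 + ψ) + (q.1 + ψ') := by
      rw [Prod.fst_add]; abel
    rw [h, Prod.snd_add]
    filter_upwards [coeFn_add_ae p.2 q.2, coeFn_add_ae (p.1 + ψ) (q.1 + ψ'), h2, k2]
      with y e1 e2 e3 e4
    rw [e1, e2, e3, e4, mul_add]
  smul_mem' := by
    rintro a p ⟨ψ, h1, h2⟩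
    refine ⟨a • ψ, (opAMode l).graph.smul_mem a h1, ?_⟩
    have h : ((a • p).1 + a • ψ : L2Circ) = a • (p.1 + ψ) := by
      rw [Prod.smul_fst, smul_add]
    rw [h, Prod.smul_snd]
    filter_upwards [coeFn_smul_ae a p.2, coeFn_smul_ae a (p.1 + ψ), h2] with y e1 e2 e3
    rw [e1, e2, e3, mul_left_comm]

/-- `Λ̂_l = sin y (I + A_l⁻¹)` in `L²(𝕋)`. -/
def opΛMode (l : ℤ) : L2Circ →ₗ.[ℂ] L2Circ := (graphΛMode l).toLinearPMap

/-- `L_{α,l} = A_l - i α l Λ̂_l` in `L²(𝕋)`. The domain is `D(A_l) = W^{2,2}(𝕋)`. -/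
def opLMode (α : ℝ) (l : ℤ) : L2Circ →ₗ.[ℂ] L2Circ :=
  opAMode l - (Complex.I * (α : ℂ) * (l : ℂ)) • opΛMode l

/-- `Y_l`: the mean-zero functions if `l = ±1`, and all of `L²(𝕋)` otherwise. -/
def spaceYMode (l : ℤ) : Submodule ℂ L2Circ where
  carrier := {f | |l| = 1 → ∫ y : Circ, f y = 0}
  zero_mem' := fun _ => by
    rw [integral_congr_ae (Lp.coeFn_zero ℂ 2 (volume : Measure Circ))]
    simp
  add_mem' := fun {f g} hf hg hl => by
    rw [integral_congr_ae (coeFn_add_ae f g), integral_add (integrable_L2 f) (integrable_L2 g),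
      hf hl, hg hl, add_zero]
  smul_mem' := fun c f hf hl => by
    rw [integral_congr_ae (coeFn_smul_ae c f), integral_const_mul, hf hl, mul_zero]

theorem isClosed_spaceYMode (l : ℤ) : IsClosed (spaceYMode l : Set L2Circ) := by
  have h : (spaceYMode l : Set L2Circ) = ⋂ (_ : |l| = 1), {f : L2Circ | ∫ y : Circ, f y = 0} := by
    ext f
    simp only [Set.mem_iInter, Set.mem_ofPred_eq]
    rfl
  rw [h]
  refine isClosed_iInter fun _ => ?_
  obtain ⟨T, hT⟩ := exists_pairing (μ := (volume : Measure Circ)) (1 : C(Circ, ℂ))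
  have : {f : L2Circ | ∫ y : Circ, f y = 0} = {f : L2Circ | T f = 0} := by
    ext f
    simp [hT]
  rw [this]
  exact isClosed_eq T.continuous continuous_const

instance instCompleteSpaceYMode (l : ℤ) : CompleteSpace (spaceYMode l) :=
  (isClosed_spaceYMode l).completeSpace_coe

/-! ### Uniqueness of weak derivatives: `graphA` and `graphAMode` are graphs of operators -/

theorem eq_zero_of_test {S : Type*} [TopologicalSpace S] [CompactSpace S] [T2Space S]
    [NormalSpace S] [R1Space S] [SecondCountableTopologyEither S ℂ]
    [MeasurableSpace S] [BorelSpace S] {μ : Measure S} [IsFiniteMeasure μ] [μ.WeaklyRegular]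
    (B : StarSubalgebra ℂ C(S, ℂ)) (hB : B.SeparatesPoints) (g : Lp ℂ 2 μ)
    (h : ∀ c ∈ B, ∫ s, g s * c s ∂μ = 0) : g = 0 := by
  have hd := ContinuousMap.starSubalgebra_topologicalClosure_eq_top_of_separatesPoints B hB
  have h1 : ∀ c : C(S, ℂ), inner ℂ (ContinuousMap.toLp 2 μ ℂ c) g = 0 := by
    intro c
    have hc : c ∈ closure (B : Set C(S, ℂ)) := by
      have : c ∈ B.topologicalClosure := hd ▸ StarSubalgebra.mem_top
      exact this
    have hcl : IsClosed {c : C(S, ℂ) | inner ℂ (ContinuousMap.toLp 2 μ ℂ c) g = 0} :=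
      isClosed_eq (((ContinuousMap.toLp 2 μ ℂ).continuous).inner continuous_const) continuous_const
    refine closure_minimal (fun b hb => ?_) hcl hc
    rw [Set.mem_ofPred_eq, L2.inner_def, ← h (star b) (star_mem hb)]
    refine integral_congr_ae ?_
    filter_upwards [ContinuousMap.coeFn_toLp (p := 2) (𝕜 := ℂ) μ b] with s hs
    rw [hs]
    simp
  have hdr := ContinuousMap.toLp_denseRange ℂ μ ℂ (p := 2) (by simp)
  refine hdr.eq_zero_of_inner_right ℂ ?_
  intro c
  exact h1 c

/-- The smooth functions on the circle, as a star subalgebra. -/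
def testCircAlg : StarSubalgebra ℂ C(Circ, ℂ) where
  carrier := {φ | TestCirc φ}
  mul_mem' := fun {a b} ha hb => by
    change TestCirc a at ha
    change TestCirc b at hb
    change TestCirc (a * b)
    exact ContDiff.mul ha hb
  add_mem' := fun {a b} ha hb => by
    change TestCirc a at ha
    change TestCirc b at hb
    change TestCirc (a + b)
    exact ContDiff.add ha hb
  algebraMap_mem' := fun r => by
    change TestCirc (algebraMap ℂ _ r)
    exact contDiff_const
  star_mem' := fun {a} ha => by
    change TestCirc a at ha
    change TestCirc (star a)
    exact Complex.conjCLE.contDiff.comp ha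

/-- The smooth functions on the torus, as a star subalgebra. -/
def testTorusAlg : StarSubalgebra ℂ C(Torus, ℂ) where
  carrier := {φ | TestTorus φ}
  mul_mem' := fun {a b} ha hb => by
    change TestTorus a at ha
    change TestTorus b at hb
    change TestTorus (a * b)
    exact ContDiff.mul ha hb
  add_mem' := fun {a b} ha hb => by
    change TestTorus a at ha
    change TestTorus b at hb
    change TestTorus (a + b)
    exact ContDiff.add ha hb
  algebraMap_mem' := fun r => by
    change TestTorus (algebraMap ℂ _ r)
    exact contDiff_const
  star_mem' := fun {a} ha => by
    change TestTorus a at ha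
    change TestTorus (star a)
    exact Complex.conjCLE.contDiff.comp ha

theorem testCirc_fourier (n : ℤ) : TestCirc (fourier n) := by
  unfold TestCirc
  simp only [fourier_coe_apply]
  refine Complex.contDiff_exp.comp ?_
  exact (contDiff_const.mul Complex.ofRealCLM.contDiff).div_const _

theorem fourier_one_injective : Function.Injective (fourier 1 : Circ → ℂ) := by
  intro x y h
  rw [fourier_one, fourier_one] at h
  exact AddCircle.injective_toCircle Real.two_pi_pos.ne' (Subtype.ext h)

theorem testCircAlg_separatesPoints : testCircAlg.SeparatesPoints := fun _ _ hxy =>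
  ⟨_, ⟨fourier 1, testCirc_fourier 1, rfl⟩, fun h => hxy (fourier_one_injective h)⟩

theorem testTorusAlg_separatesPoints : testTorusAlg.SeparatesPoints := by
  intro p q hpq
  by_cases h : p.1 = q.1
  · refine ⟨_, ⟨(fourier 1).comp ⟨Prod.snd, continuous_snd⟩, ?_, rfl⟩, fun h' => hpq ?_⟩
    · exact ContDiff.comp (testCirc_fourier 1) contDiff_snd
    · exact Prod.ext h (fourier_one_injective h')
  · refine ⟨_, ⟨(fourier 1).comp ⟨Prod.fst, continuous_fst⟩, ?_, rfl⟩, fun h' => h ?_⟩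
    · exact ContDiff.comp (testCirc_fourier 1) contDiff_fst
    · exact fourier_one_injective h'

theorem HasWeakD.eq_zero {g : L2Circ} (h : HasWeakD (0 : L2Circ) g) : g = 0 :=
  eq_zero_of_test testCircAlg testCircAlg_separatesPoints g fun φ hφ => by
    have h0 := HasWeakD.zero φ hφ
    have e : ∫ y, (0 : L2Circ) y * φ y = 0 := by
      rw [integral_congr_ae (g := fun _ => 0)
        ((Lp.coeFn_zero ℂ 2 (volume : Measure Circ)).mono fun y _ => by simp)]
      simp
    rw [e] at h0
    have := h φ hφ
    rw [h0] at this
    simpa using this.symm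

theorem HasWeakDX.eq_zero {g : L2Torus} (h : HasWeakDX (0 : L2Torus) g) : g = 0 :=
  eq_zero_of_test testTorusAlg testTorusAlg_separatesPoints g fun φ hφ => by
    have h0 := HasWeakDX.zero φ hφ
    have e : ∫ y, (0 : L2Torus) y * φ y = 0 := by
      rw [integral_congr_ae (g := fun _ => 0)
        ((Lp.coeFn_zero ℂ 2 (volume : Measure Torus)).mono fun y _ => by simp)]
      simp
    rw [e] at h0
    have := h φ hφ
    rw [h0] at this
    simpa using this.symm

theorem HasWeakDY.eq_zero {g : L2Torus} (h : HasWeakDY (0 : L2Torus) g) : g = 0 :=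
  eq_zero_of_test testTorusAlg testTorusAlg_separatesPoints g fun φ hφ => by
    have h0 := HasWeakDY.zero φ hφ
    have e : ∫ y, (0 : L2Torus) y * φ y = 0 := by
      rw [integral_congr_ae (g := fun _ => 0)
        ((Lp.coeFn_zero ℂ 2 (volume : Measure Torus)).mono fun y _ => by simp)]
      simp
    rw [e] at h0
    have := h φ hφ
    rw [h0] at this
    simpa using this.symm

theorem graph_opA : opA.graph = graphA := by
  refine Submodule.toLinearPMap_graph_eq _ ?_
  rintro ⟨f, h⟩ ⟨a, b, c, d, e, h1, h2, h3, h4, h5, h6⟩ hf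
  simp only at hf h1 h2 h6
  subst hf
  obtain rfl := HasWeakDX.eq_zero h1
  obtain rfl := HasWeakDY.eq_zero h2
  obtain rfl := HasWeakDX.eq_zero h3
  obtain rfl := HasWeakDY.eq_zero h5
  exact SpaceX.incl.injective (h6.trans ((add_zero _).trans (map_zero SpaceX.incl).symm))

theorem graph_opAMode (l : ℤ) : (opAMode l).graph = graphAMode l := by
  refine Submodule.toLinearPMap_graph_eq _ ?_
  rintro ⟨f, h⟩ ⟨a, b, h1, h2, h3⟩ hf
  simp only at hf h1 h3
  subst hf
  obtain rfl := HasWeakD.eq_zero h1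
  obtain rfl := HasWeakD.eq_zero h2
  simpa using h3

end Kolmogorov

end

/-!
In Fourier coefficients every operator of the theorem acts on families indexed by modes
`e^{i(l x + k y)}` with `l ≠ 0`, so the circle and the torus are instances of one discrete problem.

Multiplying `(iλ - L_α) f = h` by the bounded operator `1 + Δ⁻¹ ≥ 0` symmetrizes the transport
term, which then drops out of the real part. Off the modes `(±1, 0)`, which span the kernel of
`1 + Δ⁻¹`, this leaves a coercive form, and Lax-Milgram solves the equation for every `α` and `λ`.
The kernel modes do not act on the others and are solved for last.

If the solutions did not become small as `|α| → ∞`, normalized solutions would converge to an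
`H¹` eigenfunction of `sin y (1 + A_l⁻¹)` with a real eigenvalue. For a nonzero eigenvalue it is
excluded by a Rayleigh-type energy identity; for eigenvalue zero its coefficients would be periodic
with step two, hence zero.
-/

noncomputable section

namespace Kolmogorov

/-! ### Square-summable sequences -/

section SquareSummable

variable {ι : Type*}

/-- The Hilbert space of square-summable families of complex numbers; Fourier coefficients of
square-integrable functions live here. -/
abbrev SqSum (ι : Type*) : Type _ := lp (fun _ : ι => ℂ) 2

theorem memℓp_two_iff_summable {f : ι → ℂ} : Memℓp f 2 ↔ Summable fun i => ‖f i‖ ^ 2 := by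
  rw [memℓp_gen_iff (by simp)]
  simp

theorem summable_sq_norm_of_le {f g : ι → ℂ} (hg : Summable fun i => ‖g i‖ ^ 2)
    (h : ∀ i, ‖f i‖ ≤ ‖g i‖) : Summable fun i => ‖f i‖ ^ 2 :=
  hg.of_nonneg_of_le (fun _ => by positivity) fun i => by gcongr; exact h i

namespace SqSum

theorem summable_sq_norm (x : SqSum ι) : Summable fun i => ‖x i‖ ^ 2 :=
  memℓp_two_iff_summable.1 (lp.memℓp x)

theorem norm_sq_eq_tsum (x : SqSum ι) : ‖x‖ ^ 2 = ∑' i, ‖x i‖ ^ 2 := by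
  simpa using lp.norm_rpow_eq_tsum (p := 2) (by simp) x

theorem ext {x y : SqSum ι} (h : ∀ i, x i = y i) : x = y :=
  lp.ext (funext h)

theorem tendsto_cofinite_zero (x : SqSum ι) : Tendsto x cofinite (𝓝 0) := by
  rw [tendsto_zero_iff_norm_tendsto_zero]
  simpa using x.summable_sq_norm.tendsto_cofinite_zero.sqrt

/-- The square-summable family with entries `f i`. -/
def mk (f : ι → ℂ) (hf : Summable fun i => ‖f i‖ ^ 2) : SqSum ι :=
  ⟨f, memℓp_two_iff_summable.2 hf⟩

@[simp]
theorem mk_apply (f : ι → ℂ) (hf : Summable fun i => ‖f i‖ ^ 2) (i : ι) : mk f hf i = f i :=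
  rfl

end SqSum

section WeightedShift

variable {m : ι → ℂ} {C : ℝ} (hm : ∀ i, ‖m i‖ ≤ C) (σ : ι ≃ ι)

include hm in
theorem sq_norm_mul_le (z : ℂ) (i : ι) : ‖m i * z‖ ^ 2 ≤ C ^ 2 * ‖z‖ ^ 2 := by
  rw [norm_mul, mul_pow]
  gcongr
  exact hm i

include hm in
theorem summable_sq_norm_weightedShift (x : SqSum ι) :
    Summable fun i => ‖m i * x (σ i)‖ ^ 2 :=
  ((σ.summable_iff.2 x.summable_sq_norm).mul_left (C ^ 2)).of_nonneg_of_le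
    (fun _ => by positivity) fun i => sq_norm_mul_le hm (x (σ i)) i

include hm in
theorem tsum_sq_norm_weightedShift_le (x : SqSum ι) :
    ∑' i, ‖m i * x (σ i)‖ ^ 2 ≤ C ^ 2 * ‖x‖ ^ 2 := by
  rw [SqSum.norm_sq_eq_tsum, ← tsum_mul_left, ← σ.tsum_eq fun i => C ^ 2 * ‖x i‖ ^ 2]
  exact (summable_sq_norm_weightedShift hm σ x).tsum_le_tsum
    (fun i => sq_norm_mul_le hm (x (σ i)) i) (σ.summable_iff.2 (x.summable_sq_norm.mul_left _))

/-- The bounded operator `x ↦ (m i * x (σ i))ᵢ` on square-summable families, for a bounded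
weight `m` and a permutation `σ` of the indices. -/
def weightedShift : SqSum ι →L[ℂ] SqSum ι :=
  LinearMap.mkContinuous
    { toFun := fun x => SqSum.mk _ (summable_sq_norm_weightedShift hm σ x)
      map_add' := fun x y => SqSum.ext fun i => mul_add (m i) (x (σ i)) (y (σ i))
      map_smul' := fun c x => SqSum.ext fun i => mul_left_comm (m i) c (x (σ i)) }
    |C| fun x => le_of_sq_le_sq (by
      rw [mul_pow, sq_abs, SqSum.norm_sq_eq_tsum]
      exact tsum_sq_norm_weightedShift_le hm σ x) (by positivity)

@[simp]
theorem weightedShift_apply (x : SqSum ι) (i : ι) : weightedShift hm σ x i = m i * x (σ i) :=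
  rfl

theorem norm_weightedShift_le (hC : 0 ≤ C) : ‖weightedShift hm σ‖ ≤ C :=
  (LinearMap.mkContinuous_norm_le _ (abs_nonneg C) _).trans_eq (abs_of_nonneg hC)

theorem inner_weightedShift_left (x y : SqSum ι) :
    inner ℂ (weightedShift hm σ x) y =
      inner ℂ x (weightedShift (m := fun i => star (m (σ.symm i))) (C := C)
        (fun i => by simpa using hm (σ.symm i)) σ.symm y) := by
  rw [lp.inner_eq_tsum, lp.inner_eq_tsum, ← σ.symm.tsum_eq]
  refine tsum_congr fun i => ?_
  simp only [weightedShift_apply, σ.apply_symm_apply, RCLike.inner_apply, map_mul,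
    RCLike.star_def]
  ring

/-- The bounded operator multiplying the entries of a square-summable family by a bounded
weight. -/
abbrev diagonal : SqSum ι →L[ℂ] SqSum ι :=
  weightedShift hm (Equiv.refl ι)

theorem diagonal_apply (x : SqSum ι) (i : ι) : diagonal hm x i = m i * x i :=
  rfl

open Classical in
theorem diagonal_eq_sum_single {s : Finset ι} (hs : ∀ i ∉ s, m i = 0) :
    diagonal hm = ∑ i ∈ s, m i • (lp.singleContinuousLinearMap ℂ (fun _ : ι => ℂ) 2 i ∘L
      lp.evalCLM ℂ (fun _ : ι => ℂ) 2 i) := by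
  refine ContinuousLinearMap.ext fun x => SqSum.ext fun j => ?_
  have hentry (i : ι) : (m i • (lp.singleContinuousLinearMap ℂ (fun _ : ι => ℂ) 2 i ∘L
      lp.evalCLM ℂ (fun _ : ι => ℂ) 2 i)) x j = if i = j then m j * x j else 0 := by
    change m i * lp.single (E := fun _ : ι => ℂ) 2 i (x i) j = _
    split_ifs with hij
    · subst hij
      rw [lp.single_apply_self]
    · rw [lp.single_apply_ne _ _ _ (Ne.symm hij), mul_zero]
  rw [_root_.sum_apply, lp.coeFn_sum, Finset.sum_apply, Finset.sum_congr rfl fun i _ => hentry i,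
    Finset.sum_ite_eq']
  split_ifs with hj
  · rfl
  · exact (congrArg (· * x j) (hs j hj)).trans (zero_mul _)

theorem isCompactOperator_diagonal_of_support {s : Finset ι} (hs : ∀ i ∉ s, m i = 0) :
    IsCompactOperator (diagonal hm) := by
  classical
  rw [diagonal_eq_sum_single hm hs]
  refine Submodule.sum_mem (compactOperator (RingHom.id ℂ) (SqSum ι) (SqSum ι)) fun i _ =>
    Submodule.smul_mem _ _ ?_
  exact (isCompactOperator_of_locallyCompactSpace_rng
    (lp.singleContinuousLinearMap ℂ (fun _ : ι => ℂ) 2 i)).comp_clm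
    (lp.evalCLM ℂ (fun _ : ι => ℂ) 2 i)

theorem isCompactOperator_diagonal (hlim : Tendsto m cofinite (𝓝 0)) :
    IsCompactOperator (diagonal hm) := by
  classical
  have hcut (s : Finset ι) (i : ι) : ‖if i ∈ s then m i else 0‖ ≤ C := by
    split_ifs
    · exact hm i
    · simpa using (norm_nonneg _).trans (hm i)
  refine isCompactOperator_of_tendsto (l := atTop) (F := fun s => diagonal (hcut s)) ?_ <|
    .of_forall fun s => isCompactOperator_diagonal_of_support (s := s) _ fun i hi => if_neg hi
  rw [Metric.tendsto_atTop]
  intro ε hε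
  have hfin : {i | ¬ ‖m i‖ < ε / 2}.Finite :=
    (tendsto_zero_iff_norm_tendsto_zero.1 hlim).eventually (gt_mem_nhds (half_pos hε))
  refine ⟨hfin.toFinset, fun s hs => ?_⟩
  have htail (i : ι) : ‖(if i ∈ s then m i else 0) - m i‖ ≤ ε / 2 := by
    split_ifs with hi
    · simpa using (half_pos hε).le
    · have hsmall : ‖m i‖ < ε / 2 := by
        by_contra h
        exact hi (hs (hfin.mem_toFinset.2 h))
      simpa using hsmall.le
  have hsub : diagonal (hcut s) - diagonal hm = diagonal htail :=
    ContinuousLinearMap.ext fun x => SqSum.ext fun i => (sub_mul _ (m i) (x i)).symm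
  rw [dist_eq_norm, hsub]
  exact (norm_weightedShift_le htail _ (half_pos hε).le).trans_lt (half_lt_self hε)

end WeightedShift

end SquareSummable

/-! ### Neutral modes on a single Fourier fibre -/

/-- Multiplication by `sin y`, acting on Fourier coefficients. -/
def sinShift : SqSum ℤ →L[ℂ] SqSum ℤ :=
  weightedShift (fun _ => le_refl ‖(2 * Complex.I)⁻¹‖) (Equiv.subRight 1) -
    weightedShift (fun _ => le_refl ‖(2 * Complex.I)⁻¹‖) (Equiv.addRight 1)

/-- Multiplication by `cos y`, acting on Fourier coefficients. -/
def cosShift : SqSum ℤ →L[ℂ] SqSum ℤ :=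
  weightedShift (fun _ => le_refl ‖(2 : ℂ)⁻¹‖) (Equiv.subRight 1) +
    weightedShift (fun _ => le_refl ‖(2 : ℂ)⁻¹‖) (Equiv.addRight 1)

theorem sinShift_apply (x : SqSum ℤ) (k : ℤ) :
    sinShift x k = (2 * Complex.I)⁻¹ * (x (k - 1) - x (k + 1)) :=
  (mul_sub _ _ _).symm

theorem cosShift_apply (x : SqSum ℤ) (k : ℤ) :
    cosShift x k = 2⁻¹ * (x (k - 1) + x (k + 1)) :=
  (mul_add _ _ _).symm

theorem inner_sinShift_left (x y : SqSum ℤ) :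
    inner ℂ (sinShift x) y = inner ℂ x (sinShift y) := by
  rw [sinShift, _root_.sub_apply, inner_sub_left, inner_weightedShift_left,
    inner_weightedShift_left, ← inner_sub_right]
  congr 1
  refine SqSum.ext fun k => ?_
  change star _ * y (k + 1) - star _ * y (k - 1) = sinShift y k
  rw [sinShift_apply, star_inv₀, star_mul', RCLike.star_def, Complex.conj_I, map_ofNat]
  ring

theorem inner_cosShift_left (x y : SqSum ℤ) :
    inner ℂ (cosShift x) y = inner ℂ x (cosShift y) := by
  rw [cosShift, _root_.add_apply, inner_add_left, inner_weightedShift_left,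
    inner_weightedShift_left, ← inner_add_right]
  congr 1
  refine SqSum.ext fun k => ?_
  change star _ * y (k + 1) + star _ * y (k - 1) = cosShift y k
  rw [cosShift_apply, star_inv₀, RCLike.star_def, map_ofNat]
  ring

theorem sinShift_cosShift (x : SqSum ℤ) : sinShift (cosShift x) = cosShift (sinShift x) := by
  refine SqSum.ext fun k => ?_
  simp only [sinShift_apply, cosShift_apply]
  ring_nf

/-- `x'` consists of the Fourier coefficients of the derivative of the function with Fourier
coefficients `x`. -/
def IsDerivCoeff (x x' : SqSum ℤ) : Prop := ∀ k : ℤ, x' k = Complex.I * k * x k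

namespace IsDerivCoeff

variable {x x' y y' : SqSum ℤ}

theorem inner_left (hx : IsDerivCoeff x x') (hy : IsDerivCoeff y y') :
    inner ℂ x' y = -inner ℂ x y' := by
  rw [lp.inner_eq_tsum, lp.inner_eq_tsum, ← tsum_neg]
  refine tsum_congr fun k => ?_
  simp only [hx k, hy k, RCLike.inner_apply, map_mul, Complex.conj_I, map_intCast]
  ring

theorem add (hx : IsDerivCoeff x x') (hy : IsDerivCoeff y y') :
    IsDerivCoeff (x + y) (x' + y') := fun k => by
  rw [lp.coeFn_add, lp.coeFn_add, Pi.add_apply, Pi.add_apply, hx, hy, mul_add]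

theorem smul (c : ℂ) (hx : IsDerivCoeff x x') : IsDerivCoeff (c • x) (c • x') := fun k => by
  rw [lp.coeFn_smul, lp.coeFn_smul, Pi.smul_apply, Pi.smul_apply, hx, smul_eq_mul, smul_eq_mul,
    mul_left_comm]

theorem unique {x'' : SqSum ℤ} (hx : IsDerivCoeff x x') (hx' : IsDerivCoeff x x'') : x' = x'' :=
  SqSum.ext fun k => (hx k).trans (hx' k).symm

theorem sinShift (hx : IsDerivCoeff x x') :
    IsDerivCoeff (sinShift x) (Kolmogorov.sinShift x' + cosShift x) := fun k => by
  rw [lp.coeFn_add, Pi.add_apply, sinShift_apply, sinShift_apply, cosShift_apply, hx, hx]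
  push_cast
  field_simp
  ring

theorem cosShift (hx : IsDerivCoeff x x') :
    IsDerivCoeff (cosShift x) (Kolmogorov.cosShift x' - Kolmogorov.sinShift x) := fun k => by
  rw [lp.coeFn_sub, Pi.sub_apply, cosShift_apply, sinShift_apply, cosShift_apply, hx, hx,
    mul_inv, Complex.inv_I]
  push_cast
  ring

end IsDerivCoeff

/-- Multiplication by `sin y - μ`, acting on Fourier coefficients. -/
def sinSubShift (μ : ℝ) : SqSum ℤ →L[ℂ] SqSum ℤ :=
  sinShift - (μ : ℂ) • ContinuousLinearMap.id ℂ (SqSum ℤ)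

section NeutralMode

variable {μ : ℝ}

theorem sinSubShift_apply (x : SqSum ℤ) : sinSubShift μ x = sinShift x - (μ : ℂ) • x :=
  rfl

theorem inner_sinSubShift_left (x y : SqSum ℤ) :
    inner ℂ (sinSubShift μ x) y = inner ℂ x (sinSubShift μ y) := by
  simp only [sinSubShift_apply, inner_sub_left, inner_sub_right, inner_sinShift_left,
    inner_smul_left, inner_smul_right, Complex.conj_ofReal]

theorem sinSubShift_cosShift (x : SqSum ℤ) :
    sinSubShift μ (cosShift x) = cosShift (sinSubShift μ x) := by
  simp only [sinSubShift_apply, map_sub, map_smul, sinShift_cosShift]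

theorem IsDerivCoeff.sinSubShift {x x' : SqSum ℤ} (hx : IsDerivCoeff x x') :
    IsDerivCoeff (sinSubShift μ x) (Kolmogorov.sinSubShift μ x' + Kolmogorov.cosShift x) := by
  have h := hx.sinShift.add (hx.smul (-(μ : ℂ)))
  rwa [neg_smul, neg_smul, ← sub_eq_add_neg, ← sub_eq_add_neg, add_sub_right_comm] at h

variable {g g' ψ ψ₁ ψ₂ : SqSum ℤ}

theorem inner_deriv_sinSubShift (hg : IsDerivCoeff g g') :
    inner ℂ (sinSubShift μ g' + cosShift g) (sinSubShift μ g' + cosShift g) =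
      inner ℂ (sinSubShift μ g') (sinSubShift μ g') +
        inner ℂ (sinShift (sinSubShift μ g)) g := by
  have hparts := (hg.sinSubShift (μ := μ)).cosShift.inner_left hg
  have hcomm : inner ℂ (cosShift (sinSubShift μ g)) g' =
      inner ℂ (cosShift g) (sinSubShift μ g') := by
    rw [← sinSubShift_cosShift, inner_sinSubShift_left]
  rw [hcomm, map_add, inner_sub_left, inner_add_left, inner_cosShift_left,
    inner_cosShift_left] at hparts
  rw [inner_add_left, inner_add_right, inner_add_right]
  linear_combination hparts

theorem inner_sinShift_eq_of_neutral {l : ℝ} (hψ : IsDerivCoeff ψ ψ₁) (hψ₁ : IsDerivCoeff ψ₁ ψ₂)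
    (hg : g = ψ₂ - ((l : ℂ) ^ 2) • ψ + ψ) (h : sinSubShift μ g = -((μ : ℂ) • ψ)) :
    inner ℂ (sinShift ψ) g = -(μ : ℂ) * inner ℂ ψ₁ ψ₁ - (l : ℂ) ^ 2 * μ * inner ℂ ψ ψ := by
  have hsin : sinShift ψ = -sinSubShift μ (ψ₂ - ((l : ℂ) ^ 2) • ψ) := by
    rw [← sub_eq_of_eq_add hg, map_sub, h, sinSubShift_apply]
    abel
  have hvisc : inner ℂ (sinSubShift μ ψ₂) g = (μ : ℂ) * inner ℂ ψ₁ ψ₁ := by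
    rw [inner_sinSubShift_left, h, inner_neg_right, inner_smul_right, hψ₁.inner_left hψ]
    ring
  have hmass : inner ℂ (sinSubShift μ ψ) g = -(μ : ℂ) * inner ℂ ψ ψ := by
    rw [inner_sinSubShift_left, h, inner_neg_right, inner_smul_right, neg_mul]
  rw [hsin, map_sub, map_smul, inner_neg_left, inner_sub_left, inner_smul_left, hvisc, hmass,
    map_pow, Complex.conj_ofReal]
  ring

/-- The Rayleigh-type identity excluding neutral modes: with `w = sin - μ`, the equation
`w g = -μ ψ` and its derivative turn `‖(w g)'‖²` into `μ² ‖ψ₁‖²`. -/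
theorem energy_identity_of_neutral {l : ℝ} (hψ : IsDerivCoeff ψ ψ₁) (hψ₁ : IsDerivCoeff ψ₁ ψ₂)
    (hg : g = ψ₂ - ((l : ℂ) ^ 2) • ψ + ψ) (h : sinSubShift μ g = -((μ : ℂ) • ψ))
    (hgd : IsDerivCoeff g g') :
    ‖sinSubShift μ g'‖ ^ 2 + l ^ 2 * μ ^ 2 * ‖ψ‖ ^ 2 = 0 := by
  have hderiv : sinSubShift μ g' + cosShift g = (-(μ : ℂ)) • ψ₁ :=
    hgd.sinSubShift.unique (by rw [h, ← neg_smul]; exact hψ.smul _)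
  have henergy := inner_deriv_sinSubShift (μ := μ) hgd
  rw [hderiv, h, map_neg, map_smul, inner_neg_left, inner_smul_left, inner_smul_left,
    inner_smul_right, inner_sinShift_eq_of_neutral hψ hψ₁ hg h, map_neg, Complex.conj_ofReal,
    inner_self_eq_norm_sq_to_K, inner_self_eq_norm_sq_to_K, inner_self_eq_norm_sq_to_K] at henergy
  apply Complex.ofReal_injective
  push_cast
  simp only [Complex.coe_algebraMap] at henergy
  linear_combination -henergy

theorem norm_div_sq_add_sq_le_one (l : ℤ) {z : ℂ} {k : ℤ} (hz : ‖z‖ ≤ (k : ℝ) ^ 2 + (l : ℝ) ^ 2) :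
    ‖z / ((k : ℂ) ^ 2 + (l : ℂ) ^ 2)‖ ≤ 1 := by
  have hsymbol : (k : ℂ) ^ 2 + (l : ℂ) ^ 2 = ((k ^ 2 + l ^ 2 : ℝ) : ℂ) := by push_cast; rfl
  rw [hsymbol, norm_div, Complex.norm_real, Real.norm_of_nonneg (by positivity)]
  exact div_le_one_of_le₀ hz (by positivity)

theorem one_le_sq_of_ne_zero {l : ℤ} (hl : l ≠ 0) : (1 : ℝ) ≤ (l : ℝ) ^ 2 := by
  have : 1 ≤ l ^ 2 := Int.add_one_le_of_lt (by positivity : 0 < l ^ 2)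
  exact_mod_cast this

theorem exists_isDerivCoeff_sub_smul_eq {l : ℤ} (hl : l ≠ 0) (f : SqSum ℤ) :
    ∃ ψ ψ₁ ψ₂ : SqSum ℤ, IsDerivCoeff ψ ψ₁ ∧ IsDerivCoeff ψ₁ ψ₂ ∧
      ψ₂ - (((l : ℝ) : ℂ) ^ 2) • ψ = f ∧ ∀ k, ψ k = -1 / ((k : ℂ) ^ 2 + (l : ℂ) ^ 2) * f k := by
  have hl1 := one_le_sq_of_ne_zero hl
  have hne (k : ℤ) : (k : ℂ) ^ 2 + (l : ℂ) ^ 2 ≠ 0 := by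
    have : (k : ℝ) ^ 2 + (l : ℝ) ^ 2 ≠ 0 := by positivity
    exact_mod_cast this
  have hk (k : ℤ) : |(k : ℝ)| ≤ (k : ℝ) ^ 2 := by
    exact_mod_cast (Int.le_self_sq |k|).trans_eq (sq_abs k)
  refine ⟨diagonal (m := fun k : ℤ => -1 / ((k : ℂ) ^ 2 + (l : ℂ) ^ 2)) (C := 1) (fun k =>
      norm_div_sq_add_sq_le_one l (by simpa using by nlinarith [sq_nonneg (k : ℝ)])) f,
    diagonal (m := fun k : ℤ => -(Complex.I * k) / ((k : ℂ) ^ 2 + (l : ℂ) ^ 2)) (C := 1) (fun k =>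
      norm_div_sq_add_sq_le_one l (by simpa using by nlinarith [hk k])) f,
    diagonal (m := fun k : ℤ => (k : ℂ) ^ 2 / ((k : ℂ) ^ 2 + (l : ℂ) ^ 2)) (C := 1) (fun k =>
      norm_div_sq_add_sq_le_one l (by simpa using sq_nonneg (l : ℝ))) f,
    fun k => ?_, fun k => ?_, SqSum.ext fun k => ?_, fun _ => rfl⟩
  · simp only [diagonal_apply]
    ring
  · simp only [diagonal_apply]
    linear_combination ((k : ℂ) ^ 2 / ((k : ℂ) ^ 2 + (l : ℂ) ^ 2) * f k) * Complex.I_sq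
  · change (k : ℂ) ^ 2 / ((k : ℂ) ^ 2 + (l : ℂ) ^ 2) * f k -
      (l : ℂ) ^ 2 * (-1 / ((k : ℂ) ^ 2 + (l : ℂ) ^ 2) * f k) = f k
    field_simp [hne k]
    ring

theorem eq_zero_of_sinShift_eq_smul {l : ℤ} (hl : l ≠ 0) (hμ : μ ≠ 0) {f f' : SqSum ℤ}
    (hf : IsDerivCoeff f f')
    (hg : ∀ k, g k = (1 - ((k : ℂ) ^ 2 + (l : ℂ) ^ 2)⁻¹) * f k)
    (h : sinShift g = (μ : ℂ) • f) : f = 0 := by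
  obtain ⟨ψ, ψ₁, ψ₂, hψ, hψ₁, rfl, hψf⟩ := exists_isDerivCoeff_sub_smul_eq hl f
  have hgψ : g = ψ₂ - (((l : ℝ) : ℂ) ^ 2) • ψ + ψ := SqSum.ext fun k => by
    rw [hg, lp.coeFn_add, Pi.add_apply, hψf]
    ring
  have hneutral : sinSubShift μ g = -((μ : ℂ) • ψ) := by
    rw [sinSubShift_apply, h, hgψ, smul_add]
    abel
  have henergy := energy_identity_of_neutral hψ hψ₁ hgψ hneutral (hgψ ▸ hf.add hψ)
  have hψ0 : ψ = 0 := by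
    by_contra hψ0
    have : (l : ℝ) ≠ 0 := by exact_mod_cast hl
    have : 0 < ‖ψ‖ := norm_pos_iff.2 hψ0
    have : 0 < (l : ℝ) ^ 2 * μ ^ 2 * ‖ψ‖ ^ 2 := by positivity
    linarith [sq_nonneg ‖sinSubShift μ (f' + ψ₁)‖]
  obtain rfl : ψ₁ = 0 := hψ.unique (by simp [hψ0, IsDerivCoeff])
  obtain rfl : ψ₂ = 0 := hψ₁.unique (by simp [IsDerivCoeff])
  rw [hψ0, smul_zero, sub_zero]

end NeutralMode

theorem eq_zero_of_forall_add_two {x : ℕ → ℂ} (h : ∀ n, x (n + 2) = x n)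
    (hx : Tendsto x atTop (𝓝 0)) (n : ℕ) : x n = 0 := by
  have hperiod (m : ℕ) : x (n + m * 2) = x n :=
    (Function.Periodic.nat_mul (show Function.Periodic x 2 from h) m) n
  have hsub : Tendsto (fun m : ℕ => n + m * 2) atTop atTop :=
    tendsto_atTop_mono (fun m => show m ≤ n + m * 2 by omega) tendsto_id
  exact tendsto_nhds_unique tendsto_const_nhds ((hx.comp hsub).congr hperiod)

theorem eq_zero_of_forall_sub_one_eq_add_one {g : SqSum ℤ}
    (h : ∀ k : ℤ, k ≠ 0 → g (k - 1) = g (k + 1)) (k : ℤ) : g k = 0 := by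
  have htendsto {f : ℕ → ℤ} (hf : f.Injective) : Tendsto (fun n => g (f n)) atTop (𝓝 0) := by
    rw [← Nat.cofinite_eq_atTop]
    exact g.tendsto_cofinite_zero.comp hf.tendsto_cofinite
  obtain ⟨n, rfl | rfl⟩ := k.eq_nat_or_neg
  · refine eq_zero_of_forall_add_two (x := fun n : ℕ => g n) (fun n => ?_)
      (htendsto Nat.cast_injective) n
    convert (h (n + 1) (by omega)).symm using 2 <;> push_cast <;> ring
  · refine eq_zero_of_forall_add_two (x := fun n : ℕ => g (-n)) (fun n => ?_)
      (htendsto (neg_injective.comp Nat.cast_injective)) n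
    convert h (-(n + 1)) (by omega) using 2 <;> push_cast <;> ring

/-! ### Fourier modes -/

section Modes

/-- The Fourier modes `e^{i(l x + k y)}` with `l` in a set `L` of nonzero wave numbers and `k`
arbitrary, encoded as pairs `(l, k)`: one value of `l` gives a circle, all of them the torus. -/
abbrev Modes (L : Set {l : ℤ // l ≠ 0}) : Type := L × ℤ

variable {L : Set {l : ℤ // l ≠ 0}}

/-- The wave number of a mode in the direction of the shear flow. -/
def Modes.xFreq (i : Modes L) : ℤ := i.1.1.1

theorem xFreq_ne_zero (i : Modes L) : i.xFreq ≠ 0 := i.1.1.2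

/-- The symbol `k² + l²` of `-Δ`. -/
def lap (i : Modes L) : ℝ := (i.2 : ℝ) ^ 2 + (i.xFreq : ℝ) ^ 2

/-- The symbol of `1 + Δ⁻¹`. -/
def oneAddInvLap (i : Modes L) : ℝ := 1 - (lap i)⁻¹

/-- The modes `(±1, 0)`, which span the kernel of `1 + Δ⁻¹`. -/
def IsDegenerate (i : Modes L) : Prop := |i.xFreq| = 1 ∧ i.2 = 0

/-- The Fourier coefficients of `∂ₓ (sin y · (1 + Δ⁻¹) f)` in terms of those of `f`. -/
def transport (x : Modes L → ℂ) (i : Modes L) : ℂ :=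
  (i.xFreq : ℂ) / 2 * (oneAddInvLap (i.1, i.2 - 1) * x (i.1, i.2 - 1) -
    oneAddInvLap (i.1, i.2 + 1) * x (i.1, i.2 + 1))

theorem ofReal_lap (i : Modes L) : (lap i : ℂ) = (i.2 : ℂ) ^ 2 + (i.xFreq : ℂ) ^ 2 := by
  rw [lap]
  push_cast
  rfl

theorem one_le_lap (i : Modes L) : 1 ≤ lap i := by
  have := one_le_sq_of_ne_zero (xFreq_ne_zero i)
  rw [lap]
  nlinarith [sq_nonneg (i.2 : ℝ)]

theorem lap_pos (i : Modes L) : 0 < lap i := one_pos.trans_le (one_le_lap i)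

theorem oneAddInvLap_nonneg (i : Modes L) : 0 ≤ oneAddInvLap i :=
  sub_nonneg.2 (inv_le_one_of_one_le₀ (one_le_lap i))

theorem oneAddInvLap_le_one (i : Modes L) : oneAddInvLap i ≤ 1 :=
  sub_le_self _ (inv_nonneg.2 (lap_pos i).le)

theorem norm_oneAddInvLap_le_one (i : Modes L) : ‖(oneAddInvLap i : ℂ)‖ ≤ 1 := by
  rw [Complex.norm_real, Real.norm_of_nonneg (oneAddInvLap_nonneg i)]
  exact oneAddInvLap_le_one i

theorem IsDegenerate.lap_eq_one {i : Modes L} (h : IsDegenerate i) : lap i = 1 := by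
  have hl : i.xFreq ^ 2 = 1 := by rw [← sq_abs, h.1, one_pow]
  have hl' : (i.xFreq : ℝ) ^ 2 = 1 := by exact_mod_cast hl
  rw [lap, hl', h.2, Int.cast_zero, zero_pow two_ne_zero, zero_add]

theorem IsDegenerate.oneAddInvLap_eq_zero {i : Modes L} (h : IsDegenerate i) :
    oneAddInvLap i = 0 := by
  rw [oneAddInvLap, h.lap_eq_one, inv_one, sub_self]

theorem two_le_lap_of_not_isDegenerate {i : Modes L} (h : ¬ IsDegenerate i) : 2 ≤ lap i := by
  have hl : 1 ≤ |i.xFreq| := Int.one_le_abs (xFreq_ne_zero i)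
  have hint : 2 ≤ |i.2| ^ 2 + |i.xFreq| ^ 2 := by
    by_cases hk : i.2 = 0
    · have hl2 : 2 ≤ |i.xFreq| := lt_of_le_of_ne hl fun hl1 => h ⟨hl1.symm, hk⟩
      nlinarith [sq_nonneg |i.2|]
    · have hk1 : 1 ≤ |i.2| := Int.one_le_abs hk
      nlinarith
  rw [sq_abs, sq_abs] at hint
  rw [lap]
  exact_mod_cast hint

theorem half_le_oneAddInvLap_of_not_isDegenerate {i : Modes L} (h : ¬ IsDegenerate i) :
    1 / 2 ≤ oneAddInvLap i := by
  have hinv : (lap i)⁻¹ ≤ 2⁻¹ := inv_anti₀ two_pos (two_le_lap_of_not_isDegenerate h)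
  rw [oneAddInvLap]
  linarith

theorem tendsto_lap_cofinite : Tendsto (lap (L := L)) cofinite atTop := by
  refine tendsto_atTop.2 fun C => ?_
  obtain ⟨n, hn⟩ := exists_nat_gt C
  have hinj : Function.Injective fun i : Modes L => (i.xFreq, i.2) := fun i j h =>
    Prod.ext (Subtype.ext (Subtype.ext (Prod.ext_iff.1 h).1)) (Prod.ext_iff.1 h).2
  have hbox := ((Set.finite_Icc (-(n : ℤ)) n).prod (Set.finite_Icc (-(n : ℤ)) n)).preimage
    hinj.injOn
  refine hbox.subset fun i (hi : ¬ C ≤ lap i) => ?_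
  have hlap : i.2 ^ 2 + i.xFreq ^ 2 < n := by
    have : lap i < n := (not_le.1 hi).trans hn
    rw [lap] at this
    exact_mod_cast this
  have abs_le_of_sq_lt {z : ℤ} (hz : z ^ 2 < n) : |z| ≤ n := by
    nlinarith [sq_abs z, Int.le_self_sq |z|]
  exact ⟨abs_le.1 (abs_le_of_sq_lt (by nlinarith [sq_nonneg i.2])),
    abs_le.1 (abs_le_of_sq_lt (by nlinarith [sq_nonneg i.xFreq]))⟩

theorem transport_const_mul (c : ℂ) (x : Modes L → ℂ) (i : Modes L) :
    transport (fun j => c * x j) i = c * transport x i := by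
  simp only [transport]
  ring

/-- The Fourier coefficients in `y` of the part of `f` with a given wave number in `x`. -/
def fibre (f : SqSum (Modes L)) (l : L) : SqSum ℤ :=
  SqSum.mk (fun k => f (l, k)) (f.summable_sq_norm.comp_injective (Prod.mk_right_injective l))

/-- The Fourier coefficients in `y` of the part of `(1 + Δ⁻¹) f` with a given wave number
in `x`. -/
def oneAddInvLapFibre (f : SqSum (Modes L)) (l : L) : SqSum ℤ :=
  diagonal (fun k => norm_oneAddInvLap_le_one (l, k)) (fibre f l)

theorem transport_eq_sinShift (f : SqSum (Modes L)) (l : L) (k : ℤ) :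
    transport f (l, k) = l.1 * Complex.I * sinShift (oneAddInvLapFibre f l) k := by
  rw [transport, sinShift_apply, mul_inv, Complex.inv_I]
  simp only [Modes.xFreq, oneAddInvLapFibre, diagonal_apply, fibre, SqSum.mk_apply]
  linear_combination ((l.1 : ℂ) / 2 * (oneAddInvLap (l, k - 1) * f (l, k - 1) -
    oneAddInvLap (l, k + 1) * f (l, k + 1))) * Complex.I_sq

section Eigenfunction

variable {f : SqSum (Modes L)} {ν : ℝ}

theorem eq_zero_of_transport_eq_zero (h : ∀ i, ¬ IsDegenerate i → transport f i = 0)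
    {i : Modes L} (hi : ¬ IsDegenerate i) : f i = 0 := by
  obtain ⟨l, k⟩ := i
  have hl : (l.1 : ℂ) ≠ 0 := by exact_mod_cast l.1.2
  have hzero := eq_zero_of_forall_sub_one_eq_add_one (g := oneAddInvLapFibre f l) (fun n hn => by
    have := h (l, n) fun hdeg => hn hdeg.2
    rw [transport_eq_sinShift, sinShift_apply] at this
    simpa [hl, sub_eq_zero] using this) k
  have hpos := half_le_oneAddInvLap_of_not_isDegenerate hi
  exact (mul_eq_zero.1 hzero).resolve_left (Complex.ofReal_ne_zero.2 (by linarith))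

theorem summable_deriv_fibre (hf : Summable fun i => lap i * ‖f i‖ ^ 2) (l : L) :
    Summable fun k : ℤ => ‖Complex.I * k * f (l, k)‖ ^ 2 := by
  refine (hf.comp_injective (Prod.mk_right_injective l)).of_nonneg_of_le
    (fun _ => by positivity) fun k => ?_
  rw [norm_mul, norm_mul, Complex.norm_I, one_mul, Complex.norm_intCast, mul_pow, sq_abs]
  exact mul_le_mul_of_nonneg_right (le_add_of_nonneg_right (sq_nonneg _)) (by positivity)

theorem eq_zero_of_transport_eigen (hf : Summable fun i => lap i * ‖f i‖ ^ 2) (hν : ν ≠ 0)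
    (h : ∀ i, ¬ IsDegenerate i → Complex.I * ν * f i + transport f i = 0)
    {i : Modes L} (hi : ¬ IsDegenerate i) : f i = 0 := by
  obtain ⟨l, k⟩ := i
  have hl : (l.1 : ℂ) ≠ 0 := by exact_mod_cast l.1.2
  have hνC : (ν : ℂ) ≠ 0 := by exact_mod_cast hν
  obtain ⟨μ, hμ⟩ : ∃ μ : ℝ, (μ : ℂ) = -ν / l.1 := ⟨-ν / l.1, by push_cast; rfl⟩
  have hμ0 : (μ : ℂ) ≠ 0 := hμ ▸ div_ne_zero (neg_ne_zero.2 hνC) hl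
  let g := oneAddInvLapFibre f l
  let E : SqSum ℤ := (μ : ℂ)⁻¹ • sinShift g
  have hE (n : ℤ) (hn : ¬ IsDegenerate (l, n)) : E n = f (l, n) := by
    have hn' := h _ hn
    rw [transport_eq_sinShift] at hn'
    change (μ : ℂ)⁻¹ * sinShift g n = _
    rw [inv_mul_eq_iff_eq_mul₀ hμ0, hμ, div_mul_eq_mul_div, eq_div_iff hl]
    exact mul_left_cancel₀ Complex.I_ne_zero (by linear_combination hn')
  have hE' : Summable fun n : ℤ => ‖Complex.I * n * E n‖ ^ 2 := by
    refine (summable_deriv_fibre hf l).congr fun n => ?_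
    by_cases hn : n = 0
    · simp only [hn, Int.cast_zero, mul_zero, zero_mul]
    · rw [hE n fun hdeg => hn hdeg.2]
  have hgE (n : ℤ) : g n = (1 - ((n : ℂ) ^ 2 + ((l.1 : ℤ) : ℂ) ^ 2)⁻¹) * E n := by
    have hb : (1 - ((n : ℂ) ^ 2 + ((l.1 : ℤ) : ℂ) ^ 2)⁻¹) = oneAddInvLap (l, n) := by
      rw [oneAddInvLap, Complex.ofReal_sub, Complex.ofReal_inv, ofReal_lap, Complex.ofReal_one,
        Modes.xFreq]
    rw [hb]
    change oneAddInvLap (l, n) * f (l, n) = _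
    by_cases hn : IsDegenerate (l, n)
    · rw [hn.oneAddInvLap_eq_zero, Complex.ofReal_zero, zero_mul, zero_mul]
    · rw [hE n hn]
  have hE0 : E = 0 := eq_zero_of_sinShift_eq_smul l.1.2 (Complex.ofReal_ne_zero.1 hμ0)
    (f' := SqSum.mk _ hE') (fun _ => rfl) hgE (smul_inv_smul₀ hμ0 _).symm
  rw [← hE k hi, hE0]
  rfl

theorem eq_zero_of_eigen_of_degenerate (hf : Summable fun i => lap i * ‖f i‖ ^ 2)
    (hdeg : ∀ i, IsDegenerate i → f i = 0)
    (h : ∀ i, ¬ IsDegenerate i → Complex.I * ν * f i + transport f i = 0) : f = 0 := by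
  refine SqSum.ext fun i => ?_
  by_cases hi : IsDegenerate i
  · exact hdeg i hi
  rcases eq_or_ne ν 0 with rfl | hν
  · exact eq_zero_of_transport_eq_zero (fun j hj => by simpa using h j hj) hi
  · exact eq_zero_of_transport_eigen hf hν h hi

end Eigenfunction

/-! ### The energy form -/

section RealDiagonal

variable {ι : Type*} {m : ι → ℝ} {C : ℝ} (hm : ∀ i, ‖(m i : ℂ)‖ ≤ C)

theorem inner_diagonal_left (x y : SqSum ι) :
    inner ℂ (diagonal hm x) y = inner ℂ x (diagonal hm y) := by
  rw [inner_weightedShift_left]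
  congr 1
  refine SqSum.ext fun i => ?_
  change star (m i : ℂ) * y i = m i * y i
  rw [Complex.star_def, Complex.conj_ofReal]

theorem inner_ofReal_mul_self (r : ℝ) (z : ℂ) : inner ℂ z (r * z) = (r * ‖z‖ ^ 2 : ℝ) := by
  rw [← smul_eq_mul, inner_smul_right, inner_self_eq_norm_sq_to_K]
  push_cast
  rfl

theorem hasSum_inner_diagonal_self (x : SqSum ι) :
    HasSum (fun i => ((m i * ‖x i‖ ^ 2 : ℝ) : ℂ)) (inner ℂ x (diagonal hm x)) := by
  exact (lp.hasSum_inner (𝕜 := ℂ) x (diagonal hm x)).congr_fun fun i =>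
    (inner_ofReal_mul_self (m i) (x i)).symm

theorem im_inner_diagonal_self (x : SqSum ι) : (inner ℂ x (diagonal hm x)).im = 0 := by
  refine (Complex.hasSum_im (hasSum_inner_diagonal_self hm x)).unique ?_
  simpa only [Complex.ofReal_im] using hasSum_zero

theorem le_re_inner_diagonal_self {c : ℝ} (hc : ∀ i, c ≤ m i) (x : SqSum ι) :
    c * ‖x‖ ^ 2 ≤ (inner ℂ x (diagonal hm x)).re := by
  rw [SqSum.norm_sq_eq_tsum]
  exact hasSum_le (fun i => mul_le_mul_of_nonneg_right (hc i) (sq_nonneg ‖x i‖))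
    (x.summable_sq_norm.hasSum.mul_left c) (Complex.hasSum_re (hasSum_inner_diagonal_self hm x))

end RealDiagonal

/-- The symbol of `(-Δ)^(-1/2)`. -/
def invSqrt (i : Modes L) : ℝ := (√(lap i))⁻¹

theorem invSqrt_pos (i : Modes L) : 0 < invSqrt i := inv_pos.2 (Real.sqrt_pos.2 (lap_pos i))

theorem invSqrt_ne_zero (i : Modes L) : (invSqrt i : ℂ) ≠ 0 :=
  Complex.ofReal_ne_zero.2 (invSqrt_pos i).ne'

theorem invSqrt_le_one (i : Modes L) : invSqrt i ≤ 1 :=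
  inv_le_one_of_one_le₀ (Real.one_le_sqrt.2 (one_le_lap i))

theorem norm_invSqrt_le_one (i : Modes L) : ‖(invSqrt i : ℂ)‖ ≤ 1 := by
  rw [Complex.norm_real, Real.norm_of_nonneg (invSqrt_pos i).le]
  exact invSqrt_le_one i

theorem lap_mul_invSqrt_sq (i : Modes L) : lap i * invSqrt i ^ 2 = 1 := by
  rw [invSqrt, inv_pow, Real.sq_sqrt (lap_pos i).le, mul_inv_cancel₀ (lap_pos i).ne']

theorem abs_xFreq_mul_invSqrt_le_one (i : Modes L) : |(i.xFreq : ℝ)| * invSqrt i ≤ 1 := by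
  rw [invSqrt, ← div_eq_mul_inv, div_le_one (Real.sqrt_pos.2 (lap_pos i))]
  exact Real.abs_le_sqrt (le_add_of_nonneg_left (sq_nonneg _))

/-- The operator `(-Δ)^(-1/2)` on Fourier coefficients. -/
def invSqrtLap : SqSum (Modes L) →L[ℂ] SqSum (Modes L) := diagonal norm_invSqrt_le_one

theorem invSqrtLap_apply (v : SqSum (Modes L)) (i : Modes L) :
    invSqrtLap v i = invSqrt i * v i :=
  rfl

theorem isCompactOperator_invSqrtLap : IsCompactOperator (invSqrtLap (L := L)) := by
  refine isCompactOperator_diagonal norm_invSqrt_le_one ?_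
  have h : Tendsto (invSqrt (L := L)) cofinite (𝓝 0) :=
    tendsto_inv_atTop_zero.comp (Real.tendsto_sqrt_atTop.comp tendsto_lap_cofinite)
  exact_mod_cast (Complex.continuous_ofReal.tendsto 0).comp h

theorem lap_mul_sq_norm_invSqrtLap (v : SqSum (Modes L)) (i : Modes L) :
    lap i * ‖invSqrtLap v i‖ ^ 2 = ‖v i‖ ^ 2 := by
  rw [invSqrtLap_apply, norm_mul, mul_pow, Complex.norm_real, Real.norm_eq_abs, sq_abs,
    ← mul_assoc, lap_mul_invSqrt_sq, one_mul]

theorem exists_invSqrtLap_eq {f : SqSum (Modes L)}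
    (hf : Summable fun i => ‖(lap i : ℂ) * f i‖ ^ 2) : ∃ v, invSqrtLap v = f := by
  have hv : Summable fun i => ‖(invSqrt i : ℂ)⁻¹ * f i‖ ^ 2 := by
    refine summable_sq_norm_of_le hf fun i => ?_
    rw [norm_mul, norm_mul]
    refine mul_le_mul_of_nonneg_right ?_ (norm_nonneg _)
    rw [norm_inv, Complex.norm_real, Complex.norm_real, Real.norm_of_nonneg (invSqrt_pos i).le,
      Real.norm_of_nonneg (lap_pos i).le, invSqrt, inv_inv]
    exact Real.sqrt_le_self_iff.2 (Or.inr (one_le_lap i))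
  exact ⟨SqSum.mk _ hv, SqSum.ext fun i => mul_inv_cancel_left₀ (invSqrt_ne_zero i) (f i)⟩

/-- The operator `1 + Δ⁻¹` on Fourier coefficients. -/
def oneAddInvLapOp : SqSum (Modes L) →L[ℂ] SqSum (Modes L) := diagonal norm_oneAddInvLap_le_one

theorem oneAddInvLapOp_apply (f : SqSum (Modes L)) (i : Modes L) :
    oneAddInvLapOp f i = oneAddInvLap i * f i :=
  rfl

theorem norm_oneAddInvLapOp_le_one : ‖oneAddInvLapOp (L := L)‖ ≤ 1 :=
  norm_weightedShift_le norm_oneAddInvLap_le_one _ zero_le_one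

/-- The operator `(-Δ)^(-1/2) (1 + Δ⁻¹)` on Fourier coefficients. -/
def formWeight : SqSum (Modes L) →L[ℂ] SqSum (Modes L) := invSqrtLap ∘L oneAddInvLapOp

theorem formWeight_apply (f : SqSum (Modes L)) (i : Modes L) :
    formWeight f i = invSqrt i * (oneAddInvLap i * f i) :=
  rfl

theorem inner_formWeight_right (v f : SqSum (Modes L)) :
    inner ℂ v (formWeight f) = inner ℂ (invSqrtLap v) (oneAddInvLapOp f) :=
  (inner_diagonal_left norm_invSqrt_le_one v (oneAddInvLapOp f)).symm

/-- Lowering the wave number in the direction across the shear flow. -/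
abbrev yDown : Modes L ≃ Modes L := (Equiv.refl L).prodCongr (Equiv.subRight 1)

/-- Raising the wave number in the direction across the shear flow. -/
abbrev yUp : Modes L ≃ Modes L := (Equiv.refl L).prodCongr (Equiv.addRight 1)

theorem norm_xFreq_mul_le_one (i : Modes L) :
    ‖(i.xFreq : ℂ) / 2 * (oneAddInvLap i * invSqrt i)‖ ≤ 1 := by
  have hl := abs_xFreq_mul_invSqrt_le_one i
  calc ‖(i.xFreq : ℂ) / 2 * (oneAddInvLap i * invSqrt i)‖
      = |(i.xFreq : ℝ)| * invSqrt i / 2 * ‖(oneAddInvLap i : ℂ)‖ := by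
        rw [norm_mul, norm_mul, norm_div, Complex.norm_intCast, Complex.norm_ofNat,
          Complex.norm_real (invSqrt i), Real.norm_of_nonneg (invSqrt_pos i).le]
        ring
    _ ≤ 1 := mul_le_one₀ (by linarith) (norm_nonneg _) (norm_oneAddInvLap_le_one i)

/-- The part of `transportInvSqrtLap` coming from `e^{iy}` in `sin y`. -/
def transportDown : SqSum (Modes L) →L[ℂ] SqSum (Modes L) :=
  weightedShift (fun i => norm_xFreq_mul_le_one (yDown i)) yDown

/-- The part of `transportInvSqrtLap` coming from `e^{-iy}` in `sin y`. -/
def transportUp : SqSum (Modes L) →L[ℂ] SqSum (Modes L) :=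
  weightedShift (fun i => norm_xFreq_mul_le_one (yUp i)) yUp

/-- The operator `∂ₓ sin y (1 + Δ⁻¹) (-Δ)^(-1/2)` on Fourier coefficients; the last factor makes
it bounded. -/
def transportInvSqrtLap : SqSum (Modes L) →L[ℂ] SqSum (Modes L) := transportDown - transportUp

theorem transportInvSqrtLap_apply (v : SqSum (Modes L)) (i : Modes L) :
    transportInvSqrtLap v i = transport (invSqrtLap v) i := by
  change (i.xFreq : ℂ) / 2 * _ * v (yDown i) - (i.xFreq : ℂ) / 2 * _ * v (yUp i) = _
  simp only [transport, invSqrtLap_apply, yDown, yUp, Equiv.prodCongr_apply, Prod.map,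
    Equiv.refl_apply, Equiv.subRight_apply, Equiv.coe_addRight]
  ring

theorem inner_transportUp (v : SqSum (Modes L)) :
    inner ℂ (oneAddInvLapOp (invSqrtLap v)) (transportUp v) =
      star (inner ℂ (oneAddInvLapOp (invSqrtLap v)) (transportDown v)) := by
  rw [Complex.star_def, inner_conj_symm, lp.inner_eq_tsum, lp.inner_eq_tsum, ← yDown.tsum_eq]
  refine tsum_congr fun i => ?_
  have hup : yUp (yDown i) = i := yDown.symm_apply_apply i
  have hfreq : (yDown i).xFreq = i.xFreq := rfl
  simp only [transportUp, transportDown, weightedShift_apply, oneAddInvLapOp_apply,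
    invSqrtLap_apply, RCLike.inner_apply, map_mul, Complex.conj_ofReal, map_div₀,
    map_intCast, map_ofNat, hup, hfreq]
  ring

theorem re_inner_formWeight_transport (v : SqSum (Modes L)) :
    (inner ℂ v (formWeight (transportInvSqrtLap v))).re = 0 := by
  rw [inner_formWeight_right, oneAddInvLapOp, ← inner_diagonal_left, ← oneAddInvLapOp,
    transportInvSqrtLap, _root_.sub_apply, inner_sub_right, inner_transportUp, Complex.sub_re,
    Complex.star_def, Complex.conj_re, sub_self]

open Classical in
/-- The symbol of `1 + Δ⁻¹`, replaced by `1` on its kernel. -/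
def coerciveSymbol (i : Modes L) : ℝ := if IsDegenerate i then 1 else oneAddInvLap i

theorem half_le_coerciveSymbol (i : Modes L) : 1 / 2 ≤ coerciveSymbol i := by
  rw [coerciveSymbol]
  split_ifs with hi
  · norm_num
  · exact half_le_oneAddInvLap_of_not_isDegenerate hi

theorem norm_coerciveSymbol_le_one (i : Modes L) : ‖(coerciveSymbol i : ℂ)‖ ≤ 1 := by
  rw [coerciveSymbol]
  split_ifs
  · simp
  · exact norm_oneAddInvLap_le_one i

/-- The operator `(-Δ)^(-1/2) (1 + Δ⁻¹) (iλ - L_α) (-Δ)^(-1/2)` on Fourier coefficients,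
completed by the identity on the degenerate modes. The factor `1 + Δ⁻¹` symmetrizes the
transport term. -/
def energyForm (α lam : ℝ) : SqSum (Modes L) →L[ℂ] SqSum (Modes L) :=
  diagonal norm_coerciveSymbol_le_one +
    ((Complex.I * lam) • formWeight ∘L invSqrtLap +
      (α : ℂ) • formWeight ∘L transportInvSqrtLap)

section

variable {α lam : ℝ}

theorem half_mul_sq_norm_le_re_inner_energyForm (v : SqSum (Modes L)) :
    1 / 2 * ‖v‖ ^ 2 ≤ (inner ℂ v (energyForm α lam v)).re := by
  have hmain := le_re_inner_diagonal_self norm_coerciveSymbol_le_one half_le_coerciveSymbol v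
  have himag : (Complex.I * lam * inner ℂ v (formWeight (invSqrtLap v))).re = 0 := by
    rw [inner_formWeight_right, mul_assoc, Complex.I_mul_re, Complex.im_ofReal_mul,
      oneAddInvLapOp, im_inner_diagonal_self, mul_zero, neg_zero]
  have hexpand : inner ℂ v (energyForm α lam v) =
      inner ℂ v (diagonal norm_coerciveSymbol_le_one v) +
        (Complex.I * lam * inner ℂ v (formWeight (invSqrtLap v)) +
          α * inner ℂ v (formWeight (transportInvSqrtLap v))) := by
    rw [← inner_smul_right, ← inner_smul_right, ← inner_add_right, ← inner_add_right]
    rfl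
  rwa [hexpand, Complex.add_re, Complex.add_re, himag, Complex.re_ofReal_mul,
    re_inner_formWeight_transport, mul_zero, add_zero, add_zero]

theorem isUnit_energyForm : IsUnit (energyForm (L := L) α lam) := by
  refine ContinuousLinearMap.isUnit_of_forall_le_norm_inner_map _ (c := 1 / 2) (by norm_num)
    fun v => ?_
  rw [norm_inner_symm, mul_comm]
  exact (half_mul_sq_norm_le_re_inner_energyForm v).trans (Complex.re_le_norm _)

/-- The Fourier coefficients of `(iλ - L_α) f` in terms of those of `f`. -/
def resolventEq (α lam : ℝ) (f : Modes L → ℂ) (i : Modes L) : ℂ :=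
  Complex.I * lam * f i + lap i * f i + α * transport f i

theorem energyForm_apply (v : SqSum (Modes L)) (i : Modes L) :
    energyForm α lam v i = coerciveSymbol i * v i +
      (Complex.I * lam * (invSqrt i * (oneAddInvLap i * (invSqrt i * v i))) +
        α * (invSqrt i * (oneAddInvLap i * transport (invSqrtLap v) i))) := by
  rw [← transportInvSqrtLap_apply]
  rfl

theorem energyForm_apply_of_isDegenerate (v : SqSum (Modes L)) {i : Modes L}
    (hi : IsDegenerate i) : energyForm α lam v i = v i := by
  rw [energyForm_apply, hi.oneAddInvLap_eq_zero, coerciveSymbol, if_pos hi]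
  push_cast
  ring

theorem energyForm_apply_of_not_isDegenerate (v : SqSum (Modes L)) {i : Modes L}
    (hi : ¬ IsDegenerate i) : energyForm α lam v i =
      invSqrt i * (oneAddInvLap i * resolventEq α lam (invSqrtLap v) i) := by
  have hlap : (lap i : ℂ) * invSqrt i ^ 2 = 1 := by exact_mod_cast lap_mul_invSqrt_sq i
  rw [energyForm_apply, coerciveSymbol, if_neg hi, resolventEq, invSqrtLap_apply]
  linear_combination (-(oneAddInvLap i : ℂ) * v i) * hlap

/-- `f` has no degenerate modes and solves `(iλ - L_α) f = h` up to the degenerate modes. -/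
def IsReducedSolution (α lam : ℝ) (f h : Modes L → ℂ) : Prop :=
  (∀ i, IsDegenerate i → f i = 0) ∧ ∀ i, ¬ IsDegenerate i → resolventEq α lam f i = h i

theorem energyForm_eq_formWeight_iff {v h : SqSum (Modes L)} :
    energyForm α lam v = formWeight h ↔ IsReducedSolution α lam (invSqrtLap v) h := by
  have hdeg (i : Modes L) (hi : IsDegenerate i) :
      energyForm α lam v i = formWeight h i ↔ invSqrtLap v i = 0 := by
    rw [energyForm_apply_of_isDegenerate v hi, formWeight_apply, hi.oneAddInvLap_eq_zero,
      invSqrtLap_apply, Complex.ofReal_zero, zero_mul, mul_zero, mul_eq_zero,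
      or_iff_right (invSqrt_ne_zero i)]
  have hnondeg (i : Modes L) (hi : ¬ IsDegenerate i) :
      energyForm α lam v i = formWeight h i ↔
        resolventEq α lam (invSqrtLap v) i = h i := by
    have hb : (oneAddInvLap i : ℂ) ≠ 0 := Complex.ofReal_ne_zero.2
      (by linarith [half_le_oneAddInvLap_of_not_isDegenerate hi])
    rw [energyForm_apply_of_not_isDegenerate v hi, formWeight_apply,
      mul_right_inj' (invSqrt_ne_zero i), mul_right_inj' hb]
  refine ⟨fun heq => ⟨fun i hi => (hdeg i hi).1 (by rw [heq]),
    fun i hi => (hnondeg i hi).1 (by rw [heq])⟩, fun hsol => SqSum.ext fun i => ?_⟩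
  by_cases hi : IsDegenerate i
  · exact (hdeg i hi).2 (hsol.1 i hi)
  · exact (hnondeg i hi).2 (hsol.2 i hi)

theorem IsReducedSolution.sq_norm_le {v h : SqSum (Modes L)}
    (hsol : IsReducedSolution α lam (invSqrtLap v) h) :
    ‖v‖ ^ 2 ≤ 2 * (‖invSqrtLap v‖ * ‖h‖) := by
  have hcoercive := half_mul_sq_norm_le_re_inner_energyForm (α := α) (lam := lam) v
  rw [energyForm_eq_formWeight_iff.2 hsol, inner_formWeight_right] at hcoercive
  have hbound : (inner ℂ (invSqrtLap v) (oneAddInvLapOp h)).re ≤ ‖invSqrtLap v‖ * ‖h‖ :=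
    calc (inner ℂ (invSqrtLap v) (oneAddInvLapOp h)).re
        ≤ ‖invSqrtLap v‖ * ‖oneAddInvLapOp h‖ :=
          (Complex.re_le_norm _).trans (norm_inner_le_norm _ _)
      _ ≤ ‖invSqrtLap v‖ * ‖h‖ := by
          gcongr
          simpa using oneAddInvLapOp.le_of_opNorm_le norm_oneAddInvLapOp_le_one h
  linarith

end

/-! ### Reduced solutions are small for strong transport -/

theorem tendsto_apply {ι : Type*} {f : ℕ → SqSum ι} {F : SqSum ι} (hf : Tendsto f atTop (𝓝 F))
    (i : ι) : Tendsto (fun n => (f n i : ℂ)) atTop (𝓝 (F i : ℂ)) :=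
  ((lp.evalCLM ℂ (fun _ : ι => ℂ) 2 i).continuous.tendsto F).comp hf

theorem exists_subseq_tendsto_invSqrtLap {v : ℕ → SqSum (Modes L)} {C : ℝ}
    (hv : ∀ n, ‖v n‖ ≤ C) : ∃ (V : SqSum (Modes L)) (φ : ℕ → ℕ), StrictMono φ ∧
      Tendsto (fun n => invSqrtLap (v (φ n))) atTop (𝓝 (invSqrtLap V)) := by
  obtain ⟨K, hK, hsub⟩ := isCompactOperator_invSqrtLap.image_closedBall_subset_compact
    (f := (invSqrtLap (L := L) : SqSum (Modes L) →ₗ[ℂ] SqSum (Modes L))) C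
  obtain ⟨F, -, φ, hφ, hlim⟩ := hK.tendsto_subseq fun n =>
    hsub ⟨v n, mem_closedBall_zero_iff.2 (hv n), rfl⟩
  have hentry (i : Modes L) :
      Tendsto (fun n => v (φ n) i) atTop (𝓝 ((invSqrt i : ℂ)⁻¹ * F i)) :=
    ((tendsto_apply hlim i).const_mul _).congr fun n =>
      inv_mul_cancel_left₀ (invSqrt_ne_zero i) (v (φ n) i)
  have hbdd : Bornology.IsBounded (Set.range fun n => v (φ n)) :=
    (Metric.isBounded_closedBall (x := 0) (r := C)).subset
      (Set.range_subset_iff.2 fun n => mem_closedBall_zero_iff.2 (hv (φ n)))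
  let V : SqSum (Modes L) := ⟨_, lp.memℓp_of_tendsto hbdd (tendsto_pi_nhds.2 hentry)⟩
  have hV : invSqrtLap V = F :=
    SqSum.ext fun i => mul_inv_cancel_left₀ (invSqrt_ne_zero i) (F i)
  exact ⟨V, φ, hφ, by rwa [hV]⟩

section Limit

variable {α lam : ℕ → ℝ} {f h : ℕ → SqSum (Modes L)} {F : SqSum (Modes L)} {C : ℝ}

theorem tendsto_ratio_mul_of_resolventEq (hα : Tendsto (fun n => |α n|) atTop atTop)
    (hf : Tendsto f atTop (𝓝 F)) (hh : ∀ n, ‖h n‖ ≤ C) {i : Modes L}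
    (hsol : ∀ n, resolventEq (α n) (lam n) (f n) i = h n i) :
    Tendsto (fun n => Complex.I * (lam n / α n : ℝ) * f n i) atTop (𝓝 (-transport F i)) := by
  have hαinv : Tendsto (fun n => (α n : ℂ)⁻¹) atTop (𝓝 0) := by
    rw [tendsto_zero_iff_norm_tendsto_zero]
    simp only [norm_inv, Complex.norm_real, Real.norm_eq_abs]
    exact tendsto_inv_atTop_zero.comp hα
  have hdata : Tendsto (fun n => (α n : ℂ)⁻¹ * h n i) atTop (𝓝 0) :=
    hαinv.zero_mul_isBoundedUnder_le ⟨C, eventually_map.2 <| .of_forall fun n =>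
      (lp.norm_apply_le_norm two_ne_zero (h n) i).trans (hh n)⟩
  have hlap : Tendsto (fun n => (α n : ℂ)⁻¹ * (lap i * f n i)) atTop (𝓝 0) := by
    simpa only [zero_mul] using hαinv.mul ((tendsto_apply hf i).const_mul (lap i : ℂ))
  have htransport : Tendsto (fun n => transport (f n) i) atTop (𝓝 (transport F i)) :=
    .const_mul _ (.sub (G := ℂ) (.const_mul _ (tendsto_apply hf _))
      (.const_mul _ (tendsto_apply hf _)))
  have hlim := (hdata.sub hlap).sub htransport
  rw [sub_zero, zero_sub] at hlim
  refine hlim.congr' ?_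
  filter_upwards [hα.eventually_gt_atTop 0] with n hn
  have hn' : (α n : ℂ) ≠ 0 := Complex.ofReal_ne_zero.2 (abs_pos.1 hn)
  rw [← hsol n, resolventEq]
  push_cast
  field_simp
  ring

theorem exists_tendsto_of_tendsto_I_mul_mul {r : ℕ → ℝ} {z : ℕ → ℂ} {Z w : ℂ} (hZ : Z ≠ 0)
    (hz : Tendsto z atTop (𝓝 Z)) (hr : Tendsto (fun n => Complex.I * r n * z n) atTop (𝓝 w)) :
    ∃ ν : ℝ, Tendsto r atTop (𝓝 ν) := by
  refine ⟨(w / (Complex.I * Z)).re, ?_⟩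
  have hlim := hr.div (hz.const_mul Complex.I) (mul_ne_zero Complex.I_ne_zero hZ)
  refine ((Complex.continuous_re.tendsto _).comp hlim).congr' ?_
  filter_upwards [hz.eventually_ne hZ] with n hn
  have hI := Complex.I_ne_zero
  have hquot : Complex.I * r n * z n / (Complex.I * z n) = r n := by field_simp
  exact congrArg Complex.re hquot

theorem limit_eq_zero_of_isReducedSolution (hα : Tendsto (fun n => |α n|) atTop atTop)
    (hF : Summable fun i => lap i * ‖F i‖ ^ 2) (hf : Tendsto f atTop (𝓝 F))
    (hh : ∀ n, ‖h n‖ ≤ C) (hsol : ∀ n, IsReducedSolution (α n) (lam n) (f n) (h n)) : F = 0 := by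
  have hratio (i : Modes L) (hi : ¬ IsDegenerate i) :=
    tendsto_ratio_mul_of_resolventEq hα hf hh fun n => (hsol n).2 i hi
  have hdeg (i : Modes L) (hi : IsDegenerate i) : F i = 0 :=
    tendsto_nhds_unique (tendsto_apply hf i) <|
      tendsto_const_nhds.congr fun n => ((hsol n).1 i hi).symm
  by_contra hne
  obtain ⟨i₀, hi₀⟩ : ∃ i, F i ≠ 0 := by
    by_contra! hzero
    exact hne (SqSum.ext hzero)
  obtain ⟨ν, hν⟩ := exists_tendsto_of_tendsto_I_mul_mul hi₀ (tendsto_apply hf i₀)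
    (hratio i₀ fun hi => hi₀ (hdeg i₀ hi))
  refine hne (eq_zero_of_eigen_of_degenerate (ν := ν) hF hdeg fun i hi => ?_)
  have hlim : Tendsto (fun n => Complex.I * (lam n / α n : ℝ) * f n i) atTop
      (𝓝 (Complex.I * ν * F i)) :=
    (((Complex.continuous_ofReal.tendsto ν).comp hν).const_mul _).mul (tendsto_apply hf i)
  rw [tendsto_nhds_unique hlim (hratio i hi), neg_add_cancel]

end Limit

theorem IsReducedSolution.const_mul {α lam : ℝ} {f h : Modes L → ℂ}
    (hsol : IsReducedSolution α lam f h) (c : ℂ) :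
    IsReducedSolution α lam (fun i => c * f i) (fun i => c * h i) := by
  refine ⟨fun i hi => mul_eq_zero_of_right c (hsol.1 i hi), fun i hi => ?_⟩
  simp only [← hsol.2 i hi, resolventEq, transport_const_mul]
  ring

theorem not_forall_isReducedSolution_of_norm_eq_one {α lam : ℕ → ℝ} {v h : ℕ → SqSum (Modes L)}
    {C : ℝ} (hα : Tendsto (fun n => |α n|) atTop atTop) (hv : ∀ n, ‖invSqrtLap (v n)‖ = 1)
    (hh : ∀ n, ‖h n‖ ≤ C) :
    ¬ ∀ n, IsReducedSolution (α n) (lam n) (invSqrtLap (v n)) (h n) := by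
  intro hsol
  have hbound (n : ℕ) : ‖v n‖ ≤ √(2 * C) := Real.le_sqrt_of_sq_le <| by
    have := (hsol n).sq_norm_le
    rw [hv n, one_mul] at this
    linarith [hh n]
  obtain ⟨V, φ, hφ, hlim⟩ := exists_subseq_tendsto_invSqrtLap hbound
  have hV : Summable fun i => lap i * ‖invSqrtLap V i‖ ^ 2 := by
    simpa only [lap_mul_sq_norm_invSqrtLap] using V.summable_sq_norm
  have hzero := limit_eq_zero_of_isReducedSolution (hα.comp hφ.tendsto_atTop) hV hlim
    (fun n => hh (φ n)) fun n => hsol (φ n)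
  have hone : ‖invSqrtLap V‖ = 1 := tendsto_nhds_unique hlim.norm <|
    tendsto_const_nhds.congr fun n => (hv (φ n)).symm
  rw [hzero, norm_zero] at hone
  exact zero_ne_one hone

theorem exists_norm_le_of_isReducedSolution (L : Set {l : ℤ // l ≠ 0}) {ε : ℝ} (hε : 0 < ε) :
    ∃ A : ℝ, ∀ α : ℝ, A ≤ |α| → ∀ (lam : ℝ) (v h : SqSum (Modes L)),
      IsReducedSolution α lam (invSqrtLap v) h → ‖invSqrtLap v‖ ≤ ε * ‖h‖ := by
  by_contra! hcon
  choose α hα lam v h hsol hlt using fun n : ℕ => hcon n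
  let c (n : ℕ) : ℂ := (‖invSqrtLap (v n)‖ : ℂ)⁻¹
  have hpos (n : ℕ) : 0 < ‖invSqrtLap (v n)‖ :=
    (mul_nonneg hε.le (norm_nonneg _)).trans_lt (hlt n)
  have hc (n : ℕ) : ‖c n‖ = ‖invSqrtLap (v n)‖⁻¹ := by
    rw [norm_inv, Complex.norm_real, norm_norm]
  refine not_forall_isReducedSolution_of_norm_eq_one (lam := lam)
    (v := fun n => c n • v n) (h := fun n => c n • h n) (C := ε⁻¹)
    (tendsto_atTop_mono hα tendsto_natCast_atTop_atTop) (fun n => ?_) (fun n => ?_) fun n => ?_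
  · rw [map_smul, norm_smul, hc, inv_mul_cancel₀ (hpos n).ne']
  · rw [norm_smul, hc, inv_mul_le_iff₀ (hpos n), ← div_eq_mul_inv, le_div_iff₀ hε, mul_comm]
    exact (hlt n).le
  · rw [map_smul]
    exact (hsol n).const_mul (c n)

/-! ### Resolvents on Fourier coefficients -/

section Coefficients

variable {α lam : ℝ}

/-- The domain of the Laplacian in terms of Fourier coefficients. -/
def InLapDomain (f : Modes L → ℂ) : Prop := Summable fun i => ‖(lap i : ℂ) * f i‖ ^ 2

/-- The weak solution operator `h ↦ v`, where `(-Δ)^(-1/2) v` is the reduced solution with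
data `h`. -/
def weakSolution (α lam : ℝ) : SqSum (Modes L) →L[ℂ] SqSum (Modes L) :=
  Ring.inverse (energyForm α lam) ∘L formWeight

/-- The resolvent at `iλ` of the compression of `L_α` to the nondegenerate modes, extended by
zero, on Fourier coefficients. -/
def reducedResolvent (α lam : ℝ) : SqSum (Modes L) →L[ℂ] SqSum (Modes L) :=
  invSqrtLap ∘L weakSolution α lam

theorem isReducedSolution_reducedResolvent (α lam : ℝ) (h : SqSum (Modes L)) :
    IsReducedSolution α lam (reducedResolvent α lam h) h :=
  energyForm_eq_formWeight_iff.1 <|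
    DFunLike.congr_fun (Ring.mul_inverse_cancel _ isUnit_energyForm) (formWeight h)

theorem transport_reducedResolvent (h : SqSum (Modes L)) (i : Modes L) :
    transport (reducedResolvent α lam h) i = transportInvSqrtLap (weakSolution α lam h) i :=
  (transportInvSqrtLap_apply _ i).symm

theorem inLapDomain_reducedResolvent (h : SqSum (Modes L)) :
    InLapDomain (reducedResolvent α lam h) := by
  let g : SqSum (Modes L) := h - (Complex.I * lam : ℂ) • reducedResolvent α lam h -
    (α : ℂ) • transportInvSqrtLap (weakSolution α lam h)
  refine summable_sq_norm_of_le g.summable_sq_norm fun i => ?_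
  by_cases hi : IsDegenerate i
  · rw [(isReducedSolution_reducedResolvent α lam h).1 i hi, mul_zero, norm_zero]
    exact norm_nonneg _
  · have hg : g i = h i - Complex.I * lam * reducedResolvent α lam h i -
        α * transport (reducedResolvent α lam h) i := by
      rw [transport_reducedResolvent]
      rfl
    rw [hg, ← (isReducedSolution_reducedResolvent α lam h).2 i hi, resolventEq]
    refine le_of_eq (congrArg norm ?_)
    ring

theorem IsReducedSolution.reducedResolvent_eq {f h : SqSum (Modes L)}
    (hsol : IsReducedSolution α lam f h) (hf : InLapDomain f) : reducedResolvent α lam h = f := by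
  obtain ⟨v, rfl⟩ := exists_invSqrtLap_eq hf
  refine congrArg invSqrtLap ?_
  change Ring.inverse (energyForm α lam) (formWeight h) = v
  rw [← energyForm_eq_formWeight_iff.2 hsol]
  exact DFunLike.congr_fun (Ring.inverse_mul_cancel _ isUnit_energyForm) v

theorem exists_norm_reducedResolvent_le (L : Set {l : ℤ // l ≠ 0}) {ε : ℝ} (hε : 0 < ε) :
    ∃ A : ℝ, ∀ α : ℝ, A ≤ |α| → ∀ lam : ℝ, ‖reducedResolvent (L := L) α lam‖ ≤ ε := by
  obtain ⟨A, hA⟩ := exists_norm_le_of_isReducedSolution L hε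
  exact ⟨A, fun α hα lam => ContinuousLinearMap.opNorm_le_bound _ hε.le fun h =>
    hA α hα lam _ h (isReducedSolution_reducedResolvent α lam h)⟩

theorem transport_congr {f g : Modes L → ℂ} (h : ∀ i, ¬ IsDegenerate i → f i = g i)
    (i : Modes L) : transport f i = transport g i := by
  have hmul (j : Modes L) : (oneAddInvLap j : ℂ) * f j = oneAddInvLap j * g j := by
    by_cases hj : IsDegenerate j
    · rw [hj.oneAddInvLap_eq_zero, Complex.ofReal_zero, zero_mul, zero_mul]
    · rw [h j hj]
  rw [transport, transport, hmul, hmul]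

open Classical in
/-- The orthogonal projection onto the degenerate modes. -/
def degenerateProj : SqSum (Modes L) →L[ℂ] SqSum (Modes L) :=
  diagonal (m := fun i => if IsDegenerate i then 1 else 0) (C := 1) fun i => by split_ifs <;> simp

theorem degenerateProj_apply_of_isDegenerate (f : SqSum (Modes L)) {i : Modes L}
    (hi : IsDegenerate i) : degenerateProj f i = f i := by
  rw [degenerateProj, diagonal_apply, if_pos hi, one_mul]

theorem degenerateProj_apply_of_not_isDegenerate (f : SqSum (Modes L)) {i : Modes L}
    (hi : ¬ IsDegenerate i) : degenerateProj f i = 0 := by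
  rw [degenerateProj, diagonal_apply, if_neg hi, zero_mul]

/-- The resolvent of `L_α` at `iλ` on Fourier coefficients. The degenerate modes do not act on
the others, so their coefficients can be solved for last. -/
def fullResolvent (α lam : ℝ) : SqSum (Modes L) →L[ℂ] SqSum (Modes L) :=
  reducedResolvent α lam + (Complex.I * lam + 1)⁻¹ •
    (degenerateProj ∘L (.id ℂ _ - (α : ℂ) • transportInvSqrtLap ∘L weakSolution α lam))

theorem fullResolvent_apply (h : SqSum (Modes L)) (i : Modes L) :
    fullResolvent α lam h i = reducedResolvent α lam h i + (Complex.I * lam + 1)⁻¹ *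
      degenerateProj (h - (α : ℂ) • transportInvSqrtLap (weakSolution α lam h)) i :=
  rfl

theorem fullResolvent_apply_of_isDegenerate (h : SqSum (Modes L)) {i : Modes L}
    (hi : IsDegenerate i) : fullResolvent α lam h i =
      (Complex.I * lam + 1)⁻¹ * (h i - α * transport (reducedResolvent α lam h) i) := by
  rw [fullResolvent_apply, (isReducedSolution_reducedResolvent α lam h).1 i hi, zero_add,
    degenerateProj_apply_of_isDegenerate _ hi, transport_reducedResolvent]
  rfl

theorem fullResolvent_apply_of_not_isDegenerate (h : SqSum (Modes L)) {i : Modes L}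
    (hi : ¬ IsDegenerate i) : fullResolvent α lam h i = reducedResolvent α lam h i := by
  rw [fullResolvent_apply, degenerateProj_apply_of_not_isDegenerate _ hi, mul_zero, add_zero]

theorem I_mul_add_one_ne_zero (r : ℝ) : Complex.I * r + 1 ≠ 0 := fun h => by
  simpa using congrArg Complex.re h

theorem resolventEq_fullResolvent (h : SqSum (Modes L)) (i : Modes L) :
    resolventEq α lam (fullResolvent α lam h) i = h i := by
  rw [resolventEq, transport_congr fun _ => fullResolvent_apply_of_not_isDegenerate h]
  by_cases hi : IsDegenerate i
  · rw [fullResolvent_apply_of_isDegenerate h hi, hi.lap_eq_one]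
    have := I_mul_add_one_ne_zero lam
    push_cast
    field_simp
    ring
  · rw [fullResolvent_apply_of_not_isDegenerate h hi]
    exact (isReducedSolution_reducedResolvent α lam h).2 i hi

theorem inLapDomain_fullResolvent (h : SqSum (Modes L)) :
    InLapDomain (fullResolvent α lam h) := by
  let g : SqSum (Modes L) :=
    SqSum.mk _ (inLapDomain_reducedResolvent (α := α) (lam := lam) h) +
      degenerateProj (fullResolvent α lam h)
  refine g.summable_sq_norm.congr fun i => ?_
  have hg : g i = lap i * reducedResolvent α lam h i +
      degenerateProj (fullResolvent α lam h) i := rfl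
  rw [hg]
  by_cases hi : IsDegenerate i
  · rw [(isReducedSolution_reducedResolvent α lam h).1 i hi, mul_zero, zero_add,
      degenerateProj_apply_of_isDegenerate _ hi, hi.lap_eq_one, Complex.ofReal_one, one_mul]
  · rw [degenerateProj_apply_of_not_isDegenerate _ hi, add_zero,
      fullResolvent_apply_of_not_isDegenerate h hi]

theorem fullResolvent_eq_of_resolventEq {f h : SqSum (Modes L)} (hf : InLapDomain f)
    (hsol : ∀ i, resolventEq α lam f i = h i) : fullResolvent α lam h = f := by
  let f₀ : SqSum (Modes L) := f - degenerateProj f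
  have hf₀ (i : Modes L) : f₀ i = f i - degenerateProj f i := rfl
  have hdeg (i : Modes L) (hi : IsDegenerate i) : f₀ i = 0 := by
    rw [hf₀, degenerateProj_apply_of_isDegenerate f hi, sub_self]
  have hnondeg (i : Modes L) (hi : ¬ IsDegenerate i) : f₀ i = f i := by
    rw [hf₀, degenerateProj_apply_of_not_isDegenerate f hi, sub_zero]
  have hreduced : IsReducedSolution α lam f₀ h := ⟨hdeg, fun i hi => by
    rw [resolventEq, hnondeg i hi, transport_congr hnondeg]
    exact hsol i⟩
  have hf₀dom : InLapDomain f₀ := summable_sq_norm_of_le hf fun i => by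
    by_cases hi : IsDegenerate i
    · rw [hdeg i hi, mul_zero, norm_zero]
      exact norm_nonneg _
    · rw [hnondeg i hi]
  have hR := hreduced.reducedResolvent_eq hf₀dom
  refine SqSum.ext fun i => ?_
  by_cases hi : IsDegenerate i
  · rw [fullResolvent_apply_of_isDegenerate h hi, hR, transport_congr hnondeg,
      inv_mul_eq_iff_eq_mul₀ (I_mul_add_one_ne_zero lam), ← hsol i, resolventEq, hi.lap_eq_one]
    push_cast
    ring
  · rw [fullResolvent_apply_of_not_isDegenerate h hi, hR, hnondeg i hi]

end Coefficients

end Modes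

/-! ### Operators in a Hilbert space with a basis of Fourier modes -/

section FourierBasis

theorem IsResolvent.opResolvent_eq {E : Type*} [NormedAddCommGroup E] [NormedSpace ℂ E]
    {T : E →ₗ.[ℂ] E} {z : ℂ} {R : E →L[ℂ] E} (h : IsResolvent T z R) : opResolvent T z = R := by
  have hex : ∃ R : E →L[ℂ] E, IsResolvent T z R := ⟨R, h⟩
  rw [opResolvent, dif_pos hex]
  ext f
  obtain ⟨hmem, heq⟩ := h.right_inv f
  conv_lhs => rw [← heq]
  exact hex.choose_spec.left_inv ⟨R f, hmem⟩

section HilbertBasis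

variable {ι H : Type*} [NormedAddCommGroup H] [InnerProductSpace ℂ H] (B : HilbertBasis ι ℂ H)

theorem repr_ext {f g : H} (h : ∀ i, B.repr f i = B.repr g i) : f = g :=
  B.repr.injective (SqSum.ext h)

theorem repr_add_apply (f g : H) (i : ι) : B.repr (f + g) i = B.repr f i + B.repr g i := by
  rw [map_add]; rfl

theorem repr_sub_apply (f g : H) (i : ι) : B.repr (f - g) i = B.repr f i - B.repr g i := by
  rw [map_sub]; rfl

theorem repr_smul_apply (c : ℂ) (f : H) (i : ι) : B.repr (c • f) i = c * B.repr f i := by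
  rw [map_smul]; rfl

/-- The operator on `H` whose action on coefficients in the basis `B` is `K`. -/
def ofCoeffs (K : SqSum ι →L[ℂ] SqSum ι) : H →L[ℂ] H :=
  (B.repr.symm.toContinuousLinearEquiv : SqSum ι →L[ℂ] H) ∘L K ∘L
    (B.repr.toContinuousLinearEquiv : H →L[ℂ] SqSum ι)

theorem repr_ofCoeffs (K : SqSum ι →L[ℂ] SqSum ι) (f : H) :
    B.repr (ofCoeffs B K f) = K (B.repr f) :=
  B.repr.apply_symm_apply _

theorem norm_ofCoeffs_le (K : SqSum ι →L[ℂ] SqSum ι) : ‖ofCoeffs B K‖ ≤ ‖K‖ := by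
  refine ContinuousLinearMap.opNorm_le_bound _ (norm_nonneg K) fun f => ?_
  rw [← B.repr.norm_map, repr_ofCoeffs, ← B.repr.norm_map f]
  exact K.le_opNorm _

end HilbertBasis

variable {L : Set {l : ℤ // l ≠ 0}}
variable {H : Type*} [NormedAddCommGroup H] [InnerProductSpace ℂ H]
variable {B : HilbertBasis (Modes L) ℂ H} {α : ℝ} {T : H →ₗ.[ℂ] H}

/-- The operator `T` acts on the coefficients in the basis `B` as `L_α`, on its natural domain. -/
def Represents (B : HilbertBasis (Modes L) ℂ H) (α : ℝ) (T : H →ₗ.[ℂ] H) : Prop :=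
  ∀ f g : H, (f, g) ∈ T.graph ↔ InLapDomain (B.repr f) ∧
    ∀ i, B.repr g i = -(lap i * B.repr f i) - α * transport (B.repr f) i

theorem Represents.inLapDomain (hT : Represents B α T) (u : T.domain) :
    InLapDomain (B.repr (u : H)) :=
  ((hT u (T u)).1 (T.mem_graph u)).1

theorem Represents.resolventEq_repr (hT : Represents B α T) (lam : ℝ) (u : T.domain)
    (i : Modes L) : resolventEq α lam (B.repr (u : H)) i =
      B.repr ((Complex.I * lam : ℂ) • (u : H) - T u) i := by
  rw [repr_sub_apply, repr_smul_apply, ((hT u (T u)).1 (T.mem_graph u)).2 i, resolventEq]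
  ring

theorem Represents.mem_domain (hT : Represents B α T) {f : H} (hf : InLapDomain (B.repr f)) :
    f ∈ T.domain := by
  obtain ⟨v, hv⟩ := exists_invSqrtLap_eq hf
  let g : SqSum (Modes L) := -SqSum.mk _ hf - (α : ℂ) • transportInvSqrtLap v
  refine LinearPMap.mem_domain_iff.2 ⟨B.repr.symm g, (hT _ _).2 ⟨hf, fun i => ?_⟩⟩
  have hg : g i = -(lap i * B.repr f i) - α * transportInvSqrtLap v i := rfl
  rw [LinearIsometryEquiv.apply_symm_apply, hg, transportInvSqrtLap_apply, hv]

theorem Represents.isResolvent (hT : Represents B α T) (lam : ℝ) :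
    IsResolvent T (Complex.I * lam) (ofCoeffs B (fullResolvent α lam)) where
  right_inv f := by
    have hmem : ofCoeffs B (fullResolvent α lam) f ∈ T.domain :=
      hT.mem_domain (by rw [repr_ofCoeffs]; exact inLapDomain_fullResolvent _)
    refine ⟨hmem, repr_ext B fun i => ?_⟩
    rw [← hT.resolventEq_repr lam ⟨_, hmem⟩, repr_ofCoeffs, resolventEq_fullResolvent]
  left_inv u := B.repr.injective <| by
    rw [repr_ofCoeffs]
    exact fullResolvent_eq_of_resolventEq (hT.inLapDomain u) (hT.resolventEq_repr lam u)

/-- `Y` is the closed span of the nondegenerate modes. -/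
def IsNondegenerateSpace (B : HilbertBasis (Modes L) ℂ H) (Y : Submodule ℂ H) : Prop :=
  ∀ f : H, f ∈ Y ↔ ∀ i, IsDegenerate i → B.repr f i = 0

variable {Y : Submodule ℂ H}

/-- The operator on `Y` acting on coefficients as `reducedResolvent α lam`. -/
def IsNondegenerateSpace.resolvent (hY : IsNondegenerateSpace B Y) (α lam : ℝ) : Y →L[ℂ] Y :=
  (ofCoeffs B (reducedResolvent α lam) ∘L Y.subtypeL).codRestrict Y fun f => (hY _).2 fun i hi => by
    rw [ContinuousLinearMap.comp_apply, repr_ofCoeffs]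
    exact (isReducedSolution_reducedResolvent α lam _).1 i hi

theorem IsNondegenerateSpace.repr_resolvent (hY : IsNondegenerateSpace B Y) (α lam : ℝ) (f : Y) :
    B.repr (hY.resolvent α lam f : H) = reducedResolvent α lam (B.repr (f : H)) :=
  repr_ofCoeffs B _ _

theorem IsNondegenerateSpace.norm_resolvent_le (hY : IsNondegenerateSpace B Y) (α lam : ℝ) :
    ‖hY.resolvent α lam‖ ≤ ‖reducedResolvent (L := L) α lam‖ :=
  ContinuousLinearMap.opNorm_le_bound _ (norm_nonneg _) fun f =>
    ((ofCoeffs B (reducedResolvent α lam)).le_opNorm f).trans <| by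
      gcongr
      exacts [norm_ofCoeffs_le B _, le_rfl]

variable [Y.HasOrthogonalProjection]

theorem IsNondegenerateSpace.repr_starProjection_of_isDegenerate (hY : IsNondegenerateSpace B Y)
    (f : H) {i : Modes L} (hi : IsDegenerate i) : B.repr (Y.starProjection f) i = 0 :=
  (hY _).1 (Y.starProjection_apply_mem f) i hi

theorem IsNondegenerateSpace.repr_starProjection_of_not_isDegenerate
    (hY : IsNondegenerateSpace B Y) (f : H) {i : Modes L} (hi : ¬ IsDegenerate i) :
    B.repr (Y.starProjection f) i = B.repr f i := by
  classical
  have hmem : B i ∈ Y := (hY _).2 fun j hj => by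
    rw [B.repr_self, lp.single_apply_ne]
    rintro rfl
    exact hi hj
  have horth := Y.sub_starProjection_mem_orthogonal f (B i) hmem
  rw [inner_sub_right, ← B.repr_apply_apply, ← B.repr_apply_apply] at horth
  exact (sub_eq_zero.1 horth).symm

theorem IsNondegenerateSpace.starProjection_comp_ofCoeffs_fullResolvent
    (hY : IsNondegenerateSpace B Y) (α lam : ℝ) :
    Y.starProjection ∘L ofCoeffs B (fullResolvent α lam) =
      ofCoeffs B (reducedResolvent α lam) := by
  refine ContinuousLinearMap.ext fun f => repr_ext B fun i => ?_
  rw [ContinuousLinearMap.comp_apply, repr_ofCoeffs]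
  by_cases hi : IsDegenerate i
  · rw [hY.repr_starProjection_of_isDegenerate _ hi,
      (isReducedSolution_reducedResolvent α lam _).1 i hi]
  · rw [hY.repr_starProjection_of_not_isDegenerate _ hi, repr_ofCoeffs,
      fullResolvent_apply_of_not_isDegenerate _ hi]

theorem Represents.resolventEq_repr_compression (hT : Represents B α T)
    (hY : IsNondegenerateSpace B Y) (lam : ℝ) (u : (compression Y T).domain) {i : Modes L}
    (hi : ¬ IsDegenerate i) : resolventEq α lam (B.repr ((u : Y) : H)) i =
      B.repr (((Complex.I * lam : ℂ) • (u : Y) - compression Y T u : Y) : H) i := by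
  have hcomp : ((compression Y T u : Y) : H) = Y.starProjection (T ⟨(u : Y), u.2⟩) := rfl
  rw [Submodule.coe_sub, Submodule.coe_smul, hcomp, repr_sub_apply,
    hY.repr_starProjection_of_not_isDegenerate _ hi, ← repr_sub_apply]
  exact hT.resolventEq_repr lam ⟨(u : Y), u.2⟩ i

theorem Represents.isResolvent_compression (hT : Represents B α T) (hY : IsNondegenerateSpace B Y)
    (lam : ℝ) : IsResolvent (compression Y T) (Complex.I * lam) (hY.resolvent α lam) where
  right_inv f := by
    have hdom : InLapDomain (B.repr (hY.resolvent α lam f : H)) := by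
      rw [hY.repr_resolvent]
      exact inLapDomain_reducedResolvent _
    have hmem : hY.resolvent α lam f ∈ (compression Y T).domain := hT.mem_domain hdom
    refine ⟨hmem, Subtype.ext (repr_ext B fun i => ?_)⟩
    by_cases hi : IsDegenerate i
    · rw [(hY _).1 (Subtype.prop _) i hi, (hY _).1 f.2 i hi]
    · rw [← hT.resolventEq_repr_compression hY lam ⟨_, hmem⟩ hi, hY.repr_resolvent,
        (isReducedSolution_reducedResolvent α lam _).2 i hi]
  left_inv u := Subtype.ext <| B.repr.injective <| by
    rw [hY.repr_resolvent]
    exact IsReducedSolution.reducedResolvent_eq ⟨(hY _).1 (u : Y).2, fun i hi =>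
      hT.resolventEq_repr_compression hY lam u hi⟩ (hT.inLapDomain ⟨(u : Y), u.2⟩)

theorem tendsto_iSup_enorm_zero {E : Type*} [SeminormedAddCommGroup E] {R : ℝ → ℝ → E}
    (h : ∀ ε > 0, ∃ A : ℝ, ∀ α : ℝ, A ≤ |α| → ∀ lam, ‖R α lam‖ ≤ ε) :
    Tendsto (fun α : ℝ => ⨆ lam : ℝ, ‖R α lam‖ₑ) (comap (fun α : ℝ => |α|) atTop) (𝓝 0) := by
  rw [ENNReal.tendsto_nhds_zero]
  intro ε hε
  have hfin : min ε 1 ≠ ⊤ := ne_top_of_le_ne_top ENNReal.one_ne_top (min_le_right _ _)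
  obtain ⟨A, hA⟩ := h _ (ENNReal.toReal_pos (lt_min hε one_pos).ne' hfin)
  filter_upwards [tendsto_comap.eventually (eventually_ge_atTop A)] with α hα
  refine iSup_le fun lam => le_trans ?_ (min_le_left ε 1)
  rw [← ofReal_norm]
  exact ENNReal.ofReal_le_of_le_toReal (hA α hα lam)

variable {T : ℝ → H →ₗ.[ℂ] H}

theorem tendsto_iSup_opResolvent_compression (hT : ∀ α, Represents B α (T α))
    (hY : IsNondegenerateSpace B Y) :
    Tendsto (fun α : ℝ => ⨆ lam : ℝ,
        ‖opResolvent (compression Y (T α)) (Complex.I * (lam : ℂ))‖ₑ)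
      (comap (fun α : ℝ => |α|) atTop) (𝓝 0) :=
  tendsto_iSup_enorm_zero fun ε hε => by
    obtain ⟨A, hA⟩ := exists_norm_reducedResolvent_le L hε
    refine ⟨A, fun α hα lam => ?_⟩
    rw [((hT α).isResolvent_compression hY lam).opResolvent_eq]
    exact (hY.norm_resolvent_le α lam).trans (hA α hα lam)

theorem tendsto_iSup_starProjection_comp_opResolvent (hT : ∀ α, Represents B α (T α))
    (hY : IsNondegenerateSpace B Y) :
    Tendsto (fun α : ℝ => ⨆ lam : ℝ,
        ‖Y.starProjection ∘L opResolvent (T α) (Complex.I * (lam : ℂ))‖ₑ)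
      (comap (fun α : ℝ => |α|) atTop) (𝓝 0) :=
  tendsto_iSup_enorm_zero fun ε hε => by
    obtain ⟨A, hA⟩ := exists_norm_reducedResolvent_le L hε
    refine ⟨A, fun α hα lam => ?_⟩
    rw [((hT α).isResolvent lam).opResolvent_eq, hY.starProjection_comp_ofCoeffs_fullResolvent]
    exact (norm_ofCoeffs_le B _).trans (hA α hα lam)

end FourierBasis

section Realization

section HilbertBasis

variable {ι κ H K : Type*} [NormedAddCommGroup H] [InnerProductSpace ℂ H]
  [NormedAddCommGroup K] [InnerProductSpace ℂ K]

theorem exists_repr_eq (B : HilbertBasis ι ℂ H) {x : ι → ℂ} {g : H}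
    (h : ∀ i, ‖x i‖ ≤ ‖B.repr g i‖) : ∃ u, ∀ i, B.repr u i = x i :=
  ⟨B.repr.symm (SqSum.mk x (summable_sq_norm_of_le (SqSum.summable_sq_norm _) h)), fun i => by
    rw [LinearIsometryEquiv.apply_symm_apply, SqSum.mk_apply]⟩

section Pullback

variable (B : HilbertBasis κ ℂ H) (J : K →ₗᵢ[ℂ] H) {σ : ι → κ} {v : ι → K}

theorem inner_pullback (hv : ∀ i, J (v i) = B (σ i)) (f : K) (i : ι) :
    inner ℂ (v i) f = B.repr (J f) (σ i) := by
  rw [B.repr_apply_apply, ← hv, J.inner_map_map]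

theorem orthonormal_pullback (hv : ∀ i, J (v i) = B (σ i)) (hσ : σ.Injective) :
    Orthonormal ℂ v := by
  rw [← J.orthonormal_comp_iff, show J ∘ v = B ∘ σ from funext hv]
  exact B.orthonormal.comp σ hσ

variable (hv : ∀ i, J (v i) = B (σ i)) (hσ : σ.Injective)
  (hJ : ∀ f, ∀ k ∉ Set.range σ, B.repr (J f) k = 0)

variable [CompleteSpace K]

/-- The basis `v` of the space `K`, embedded by `J` as the closed span of a part of the
basis `B`. -/
def pullbackBasis : HilbertBasis ι ℂ K :=
  HilbertBasis.mkOfOrthogonalEqBot (orthonormal_pullback B J hv hσ) <|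
    (Submodule.eq_bot_iff _).2 fun f hf => J.injective <| repr_ext B fun k => by
      rw [J.map_zero, B.repr.map_zero]
      by_cases hk : k ∈ Set.range σ
      · obtain ⟨i, rfl⟩ := hk
        exact (inner_pullback B J hv f i).symm.trans (hf _ (Submodule.subset_span ⟨i, rfl⟩))
      · exact hJ f k hk

theorem repr_pullbackBasis (f : K) (i : ι) :
    (pullbackBasis B J hv hσ hJ).repr f i = B.repr (J f) (σ i) := by
  rw [HilbertBasis.repr_apply_apply, pullbackBasis, HilbertBasis.coe_mkOfOrthogonalEqBot,
    inner_pullback B J hv]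

end Pullback

end HilbertBasis

theorem mem_graph_sub_smul_iff {E : Type*} [AddCommGroup E] [Module ℂ E] {T₁ T₂ : E →ₗ.[ℂ] E}
    {c : ℂ} {f g : E} : (f, g) ∈ (T₁ - c • T₂).graph ↔
      ∃ g₁ g₂, (f, g₁) ∈ T₁.graph ∧ (f, g₂) ∈ T₂.graph ∧ g = g₁ - c • g₂ := by
  constructor
  · intro h
    obtain ⟨u, rfl, hg⟩ := (LinearPMap.mem_graph_iff _).1 h
    exact ⟨_, _, T₁.mem_graph ⟨u, u.2.1⟩, T₂.mem_graph ⟨u, u.2.2⟩, hg.symm⟩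
  · rintro ⟨g₁, g₂, h₁, h₂, rfl⟩
    obtain ⟨u₁, rfl, rfl⟩ := (LinearPMap.mem_graph_iff _).1 h₁
    obtain ⟨u₂, hu, rfl⟩ := (LinearPMap.mem_graph_iff _).1 h₂
    have hmem : (u₁ : E) ∈ T₂.domain := by
      rw [← show (u₂ : E) = u₁ from hu]
      exact u₂.2
    obtain rfl : u₂ = ⟨u₁, hmem⟩ := Subtype.ext hu
    exact (T₁ - c • T₂).mem_graph ⟨u₁, u₁.2, hmem⟩

variable {L : Set {l : ℤ // l ≠ 0}}
variable {H : Type*} [NormedAddCommGroup H] [InnerProductSpace ℂ H]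
variable {B : HilbertBasis (Modes L) ℂ H} {A Λ : H →ₗ.[ℂ] H}

theorem exists_repr_eq_yDown_sub_yUp (B : HilbertBasis (Modes L) ℂ H) (u : H) :
    ∃ w, ∀ i, B.repr w i = B.repr u (yDown i) - B.repr u (yUp i) := by
  have hone (i : Modes L) : ‖(fun _ => 1 : Modes L → ℂ) i‖ ≤ 1 := norm_one.le
  let w : SqSum (Modes L) :=
    weightedShift hone yDown (B.repr u) - weightedShift hone yUp (B.repr u)
  refine ⟨B.repr.symm w, fun i => ?_⟩
  have hw : w i = 1 * B.repr u (yDown i) - 1 * B.repr u (yUp i) := rfl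
  rw [LinearIsometryEquiv.apply_symm_apply, hw, one_mul, one_mul]

theorem exists_repr_eq_transport {f : H} (hf : InLapDomain (B.repr f)) :
    ∃ g, ∀ i, B.repr g i = transport (B.repr f) i := by
  obtain ⟨v, hv⟩ := exists_invSqrtLap_eq hf
  refine ⟨B.repr.symm (transportInvSqrtLap v), fun i => ?_⟩
  rw [LinearIsometryEquiv.apply_symm_apply, transportInvSqrtLap_apply, hv]

/-- The operator `A` acts on the coefficients in the basis `B` as `Δ`, on its natural domain. -/
def IsLaplacian (B : HilbertBasis (Modes L) ℂ H) (A : H →ₗ.[ℂ] H) : Prop :=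
  ∀ f g : H, (f, g) ∈ A.graph ↔ ∀ i, B.repr g i = -(lap i * B.repr f i)

theorem lap_ne_zero (i : Modes L) : (lap i : ℂ) ≠ 0 :=
  Complex.ofReal_ne_zero.2 (lap_pos i).ne'

theorem norm_lap (i : Modes L) : ‖(lap i : ℂ)‖ = lap i := by
  rw [Complex.norm_real, Real.norm_of_nonneg (lap_pos i).le]

theorem IsLaplacian.exists_mem_graph (hA : IsLaplacian B A) (f : H) :
    ∃ ψ, (ψ, f) ∈ A.graph := by
  obtain ⟨ψ, hψ⟩ := exists_repr_eq B (x := fun i => -((lap i : ℂ)⁻¹ * B.repr f i)) (g := f)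
    fun i => by
      rw [norm_neg, norm_mul, norm_inv, norm_lap]
      exact mul_le_of_le_one_left (norm_nonneg _) (inv_le_one_of_one_le₀ (one_le_lap i))
  refine ⟨ψ, (hA ψ f).2 fun i => ?_⟩
  rw [hψ, mul_neg, neg_neg, mul_inv_cancel_left₀ (lap_ne_zero i)]

theorem IsLaplacian.exists_mem_graph_of_inLapDomain (hA : IsLaplacian B A) {f : H}
    (hf : InLapDomain (B.repr f)) : ∃ g, (f, g) ∈ A.graph := by
  refine ⟨B.repr.symm (-SqSum.mk _ hf), (hA _ _).2 fun i => ?_⟩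
  rw [LinearIsometryEquiv.apply_symm_apply]
  rfl

theorem IsLaplacian.repr_add (hA : IsLaplacian B A) {f ψ : H} (h : (ψ, f) ∈ A.graph)
    (i : Modes L) : B.repr (f + ψ) i = oneAddInvLap i * B.repr f i := by
  have hψ : B.repr ψ i = -((lap i : ℂ)⁻¹ * B.repr f i) := by
    rw [(hA ψ f).1 h i, mul_neg, neg_neg, inv_mul_cancel_left₀ (lap_ne_zero i)]
  rw [repr_add_apply, hψ, oneAddInvLap]
  push_cast
  ring

theorem IsLaplacian.represents_sub_smul (hA : IsLaplacian B A) {α : ℝ} {c : ℂ}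
    (hΛ : ∀ f g, (f, g) ∈ Λ.graph → ∀ i, c * B.repr g i = α * transport (B.repr f) i)
    (hdom : ∀ f, InLapDomain (B.repr f) → ∃ g, (f, g) ∈ Λ.graph) :
    Represents B α (A - c • Λ) := by
  intro f g
  rw [mem_graph_sub_smul_iff]
  have repr_sub_smul {g₁ g₂ : H} (h₁ : (f, g₁) ∈ A.graph) (h₂ : (f, g₂) ∈ Λ.graph) (i : Modes L) :
      B.repr (g₁ - c • g₂) i = -(lap i * B.repr f i) - α * transport (B.repr f) i := by
    rw [repr_sub_apply, repr_smul_apply, (hA f g₁).1 h₁, hΛ f g₂ h₂]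
  constructor
  · rintro ⟨g₁, g₂, h₁, h₂, rfl⟩
    refine ⟨(SqSum.summable_sq_norm (B.repr g₁)).congr fun i => ?_, repr_sub_smul h₁ h₂⟩
    rw [(hA f g₁).1 h₁, norm_neg]
  · rintro ⟨hf, hg⟩
    obtain ⟨g₁, h₁⟩ := hA.exists_mem_graph_of_inLapDomain hf
    obtain ⟨g₂, h₂⟩ := hdom f hf
    exact ⟨g₁, g₂, h₁, h₂, repr_ext B fun i => (hg i).trans (repr_sub_smul h₁ h₂ i).symm⟩

end Realization

/-! ### Character systems -/

section CharacterSystem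

section Normalization

variable {S : Type*} [MeasurableSpace S] {μ : Measure S}

/-- The normalization making the characters of a character system orthonormal. -/
def charNorm (μ : Measure S) : ℂ := (√(μ.real Set.univ) : ℝ)

theorem charNorm_ne_zero [IsFiniteMeasure μ] [NeZero μ] : charNorm μ ≠ 0 :=
  Complex.ofReal_ne_zero.2 (Real.sqrt_pos.2 measureReal_univ_pos).ne'

theorem star_charNorm : star (charNorm μ) = charNorm μ := Complex.conj_ofReal _

theorem charNorm_sq : charNorm μ ^ 2 = μ.real Set.univ := by
  rw [charNorm, ← Complex.ofReal_pow, Real.sq_sqrt measureReal_nonneg]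

end Normalization

variable {G S : Type*} [AddCommGroup G] [TopologicalSpace S] [MeasurableSpace S]

/-- A group of continuous characters separating the points of `S`, all of mean zero with respect
to `μ` except the trivial one: the setting in which Fourier series exist. -/
structure IsCharacterSystem (χ : G → C(S, ℂ)) (μ : Measure S) : Prop where
  map_zero : χ 0 = 1
  map_add : ∀ j k, χ (j + k) = χ j * χ k
  map_neg : ∀ k, χ (-k) = star (χ k)
  exists_ne : ∀ x y, x ≠ y → ∃ k, χ k x ≠ χ k y
  integral_eq_zero : ∀ k, k ≠ 0 → ∫ s, χ k s ∂μ = 0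

variable {χ : G → C(S, ℂ)} {μ : Measure S}

theorem IsCharacterSystem.mul_star_eq (hχ : IsCharacterSystem χ μ) (j k : G) (s : S) :
    χ j s * star (χ k s) = χ (j - k) s := by
  rw [sub_eq_add_neg, hχ.map_add, hχ.map_neg]
  rfl

theorem IsCharacterSystem.integral_mul_star (hχ : IsCharacterSystem χ μ) {j k : G} (h : j ≠ k) :
    ∫ s, χ j s * star (χ k s) ∂μ = 0 := by
  simp only [hχ.mul_star_eq]
  exact hχ.integral_eq_zero _ (sub_ne_zero.2 h)

theorem IsCharacterSystem.integral_mul_star_self (hχ : IsCharacterSystem χ μ) (k : G) :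
    ∫ s, χ k s * star (χ k s) ∂μ = μ.real Set.univ := by
  simp only [hχ.mul_star_eq, sub_self, hχ.map_zero, ContinuousMap.one_apply, integral_const,
    Complex.real_smul, mul_one]

variable [CompactSpace S]

/-- The linear span of the characters of a character system, as a star algebra. -/
def IsCharacterSystem.trigPolynomials (hχ : IsCharacterSystem χ μ) : StarSubalgebra ℂ C(S, ℂ) where
  toSubalgebra := (Submodule.span ℂ (Set.range χ)).toSubalgebra
    (hχ.map_zero ▸ Submodule.subset_span (Set.mem_range_self 0)) fun x y hx hy => by
      have hxy := Submodule.mul_mem_mul hx hy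
      rw [Submodule.span_mul_span] at hxy
      refine Submodule.span_mono ?_ hxy
      rintro _ ⟨_, ⟨j, rfl⟩, _, ⟨k, rfl⟩, rfl⟩
      exact ⟨j + k, hχ.map_add j k⟩
  star_mem' {x} (hx : x ∈ Submodule.span ℂ (Set.range χ)) := by
    change star x ∈ Submodule.span ℂ (Set.range χ)
    induction hx using Submodule.span_induction with
    | mem x hx =>
      obtain ⟨k, rfl⟩ := hx
      exact hχ.map_neg k ▸ Submodule.subset_span (Set.mem_range_self _)
    | zero => exact (star_zero C(S, ℂ)).symm ▸ Submodule.zero_mem _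
    | add x y _ _ hx hy => exact (star_add x y).symm ▸ Submodule.add_mem _ hx hy
    | smul a x _ hx => exact (star_smul a x).symm ▸ Submodule.smul_mem _ _ hx

variable [BorelSpace S]

theorem exists_ae_eq_mul {w : S → ℂ} (hw : Continuous w) (f : Lp ℂ 2 μ) :
    ∃ g : Lp ℂ 2 μ, g =ᵐ[μ] fun s => w s * f s := by
  obtain ⟨C, hC⟩ := isCompact_univ.exists_bound_of_continuousOn hw.continuousOn
  have hmem : MemLp (fun s => w s * f s) 2 μ :=
    (Lp.memLp f).of_le_mul (hw.aestronglyMeasurable.mul (Lp.aestronglyMeasurable f)) <|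
      ae_of_all _ fun s => (norm_mul_le _ _).trans <|
        mul_le_mul_of_nonneg_right (hC s (Set.mem_univ s)) (norm_nonneg _)
  exact ⟨hmem.toLp, hmem.coeFn_toLp⟩

variable [IsFiniteMeasure μ]

theorem inner_toLp (c : C(S, ℂ)) (f : Lp ℂ 2 μ) :
    inner ℂ (ContinuousMap.toLp 2 μ ℂ c) f = ∫ s, f s * star (c s) ∂μ := by
  rw [L2.inner_def]
  refine integral_congr_ae ?_
  filter_upwards [ContinuousMap.coeFn_toLp (p := 2) (𝕜 := ℂ) μ c] with s hs
  rw [hs, RCLike.inner_apply]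
  rfl

theorem integral_toLp_mul (c d : C(S, ℂ)) :
    ∫ s, (ContinuousMap.toLp 2 μ ℂ c : Lp ℂ 2 μ) s * d s ∂μ = ∫ s, c s * d s ∂μ := by
  refine integral_congr_ae ?_
  filter_upwards [ContinuousMap.coeFn_toLp (p := 2) (𝕜 := ℂ) μ c] with s hs
  rw [hs]

theorem inner_toLp_toLp (c d : C(S, ℂ)) :
    inner ℂ (ContinuousMap.toLp 2 μ ℂ c) (ContinuousMap.toLp 2 μ ℂ d) =
      ∫ s, d s * star (c s) ∂μ :=
  (inner_toLp c _).trans (integral_toLp_mul d (star c))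

theorem IsCharacterSystem.eq_zero_of_inner_eq_zero [T2Space S] [μ.WeaklyRegular]
    (hχ : IsCharacterSystem χ μ) {g : Lp ℂ 2 μ}
    (h : ∀ k, inner ℂ (ContinuousMap.toLp 2 μ ℂ (χ k)) g = 0) : g = 0 := by
  refine eq_zero_of_test hχ.trigPolynomials (fun x y hxy => ?_) g fun c hc => ?_
  · obtain ⟨k, hk⟩ := hχ.exists_ne x y hxy
    exact ⟨_, ⟨χ k, Submodule.subset_span (Set.mem_range_self k), rfl⟩, hk⟩
  have hspan : Submodule.span ℂ (Set.range χ) ≤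
      (ℂ ∙ g)ᗮ.comap (ContinuousMap.toLp 2 μ ℂ : C(S, ℂ) →L[ℂ] Lp ℂ 2 μ).toLinearMap := by
    refine Submodule.span_le.2 ?_
    rintro _ ⟨k, rfl⟩
    exact Submodule.mem_orthogonal_singleton_iff_inner_left.2 (h k)
  have hc_star : star c ∈ hχ.trigPolynomials := star_mem hc
  have hstar := Submodule.mem_orthogonal_singleton_iff_inner_left.1 (hspan hc_star)
  have hinner := inner_toLp (star c) g
  simp only [ContinuousMap.star_apply, star_star] at hinner
  exact hinner.symm.trans hstar

variable [NeZero μ]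

theorem IsCharacterSystem.orthonormal (hχ : IsCharacterSystem χ μ) :
    Orthonormal ℂ fun k => (charNorm μ)⁻¹ • (ContinuousMap.toLp 2 μ ℂ (χ k) : Lp ℂ 2 μ) := by
  classical
  refine orthonormal_iff_ite.2 fun j k => ?_
  rw [inner_smul_left, inner_smul_right, inner_toLp_toLp, starRingEnd_apply, star_inv₀,
    star_charNorm]
  split_ifs with h
  · have hne := charNorm_ne_zero (μ := μ)
    rw [h, hχ.integral_mul_star_self, ← charNorm_sq]
    field_simp
  · rw [hχ.integral_mul_star (Ne.symm h), mul_zero, mul_zero]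

variable [T2Space S] [μ.WeaklyRegular]

/-- The orthonormal basis of `L²(μ)` given by the normalized characters. -/
def IsCharacterSystem.basis (hχ : IsCharacterSystem χ μ) : HilbertBasis G ℂ (Lp ℂ 2 μ) :=
  HilbertBasis.mkOfOrthogonalEqBot hχ.orthonormal <| (Submodule.eq_bot_iff _).2 fun g hg =>
    hχ.eq_zero_of_inner_eq_zero fun k => by
      have horth := hg _ (Submodule.subset_span (Set.mem_range_self k))
      rw [inner_smul_left] at horth
      refine (mul_eq_zero.1 horth).resolve_left ?_
      exact (map_ne_zero _).2 (inv_ne_zero charNorm_ne_zero)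

theorem IsCharacterSystem.basis_apply (hχ : IsCharacterSystem χ μ) (k : G) :
    hχ.basis k = (charNorm μ)⁻¹ • (ContinuousMap.toLp 2 μ ℂ (χ k) : Lp ℂ 2 μ) := by
  rw [basis, HilbertBasis.coe_mkOfOrthogonalEqBot]

theorem IsCharacterSystem.repr_basis (hχ : IsCharacterSystem χ μ) (f : Lp ℂ 2 μ) (k : G) :
    hχ.basis.repr f k = (charNorm μ)⁻¹ * ∫ s, f s * χ (-k) s ∂μ := by
  rw [HilbertBasis.repr_apply_apply, hχ.basis_apply, inner_smul_left, inner_toLp, hχ.map_neg,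
    starRingEnd_apply, star_inv₀, star_charNorm]
  rfl

theorem IsCharacterSystem.repr_basis_eq_zero_iff (hχ : IsCharacterSystem χ μ) (f : Lp ℂ 2 μ)
    (k : G) : hχ.basis.repr f k = 0 ↔ ∫ s, f s * χ (-k) s ∂μ = 0 := by
  rw [hχ.repr_basis, mul_eq_zero, or_iff_right (inv_ne_zero charNorm_ne_zero)]

section Sine

variable {a : G} {w : S → ℂ} {f g : Lp ℂ 2 μ}

theorem IsCharacterSystem.repr_eq_of_ae_eq_sin_mul (hχ : IsCharacterSystem χ μ)
    (hw : ∀ s, w s = (2 * Complex.I)⁻¹ * (χ a s - χ (-a) s))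
    (h : g =ᵐ[μ] fun s => w s * f s) (k : G) :
    hχ.basis.repr g k =
      (2 * Complex.I)⁻¹ * (hχ.basis.repr f (k - a) - hχ.basis.repr f (k + a)) := by
  have hint (j : G) : Integrable (fun s => f s * χ j s) μ :=
    integrable_mul_continuous (integrable_L2 f) (χ j).continuous
  have hmul (s : S) : w s * f s * χ (-k) s =
      (2 * Complex.I)⁻¹ * (f s * χ (-(k - a)) s - f s * χ (-(k + a)) s) := by
    rw [hw, neg_sub', neg_add, sub_neg_eq_add, hχ.map_add, hχ.map_add, ContinuousMap.mul_apply,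
      ContinuousMap.mul_apply]
    ring
  have hcoeff : ∫ s, g s * χ (-k) s ∂μ = (2 * Complex.I)⁻¹ *
      (∫ s, f s * χ (-(k - a)) s ∂μ - ∫ s, f s * χ (-(k + a)) s ∂μ) := by
    rw [← integral_sub (hint _) (hint _), ← integral_const_mul]
    exact integral_congr_ae (h.mono fun s hs => (congrArg (· * χ (-k) s) hs).trans (hmul s))
  rw [hχ.repr_basis, hχ.repr_basis, hχ.repr_basis, hcoeff]
  ring

end Sine

theorem IsCharacterSystem.weak_deriv_iff (hχ : IsCharacterSystem χ μ) {Test : C(S, ℂ) → Prop}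
    {d : (S → ℂ) → S → ℂ} {m : G → ℂ} (hm : ∀ k, m (-k) = -m k) (htest : ∀ k, Test (χ k))
    (hd : ∀ k s, d (χ k) s = m k * χ k s) (hcont : ∀ φ : C(S, ℂ), Test φ → Continuous (d φ))
    (hparts : ∀ φ : C(S, ℂ), Test φ → ∀ k, ∫ s, χ k s * d φ s ∂μ = -m k * ∫ s, χ k s * φ s ∂μ)
    (f g : Lp ℂ 2 μ) :
    (∀ φ : C(S, ℂ), Test φ → ∫ s, f s * d φ s ∂μ = -∫ s, g s * φ s ∂μ) ↔
      ∀ k, hχ.basis.repr g k = m k * hχ.basis.repr f k := by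
  refine ⟨fun h k => ?_, fun h φ hφ => ?_⟩
  · have hk := h _ (htest (-k))
    simp only [hd, hm, mul_left_comm _ (-m k)] at hk
    rw [integral_const_mul] at hk
    rw [hχ.repr_basis, hχ.repr_basis]
    linear_combination (charNorm μ)⁻¹ * hk
  · obtain ⟨Td, hTd⟩ := exists_pairing (μ := μ) ⟨d φ, hcont φ hφ⟩
    obtain ⟨Tφ, hTφ⟩ := exists_pairing (μ := μ) φ
    have hbasis (k : G) : Td (hχ.basis k) = -m k * Tφ (hχ.basis k) := by
      rw [hχ.basis_apply, map_smul, map_smul, hTd, hTφ, integral_toLp_mul, integral_toLp_mul,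
        smul_eq_mul, smul_eq_mul, mul_left_comm, ← hparts φ hφ k]
      rfl
    have hsum := ((hχ.basis.hasSum_repr g).mapL Tφ).neg
    have heq : Td f = -Tφ g := by
      refine ((hχ.basis.hasSum_repr f).mapL Td).unique (hsum.congr_fun fun k => ?_)
      rw [map_smul, map_smul, hbasis, h k, smul_eq_mul, smul_eq_mul]
      ring
    rwa [hTd, hTφ] at heq

end CharacterSystem

/-! ### The circle -/

section Circle

theorem hasDerivAt_fourier_circ (n : ℤ) (x : ℝ) :
    HasDerivAt (fun t : ℝ => (fourier n (t : Circ) : ℂ)) (Complex.I * n * fourier n (x : Circ))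
      x := by
  convert hasDerivAt_fourier (2 * Real.pi) n x using 1
  have : (Real.pi : ℂ) ≠ 0 := Complex.ofReal_ne_zero.2 Real.pi_ne_zero
  push_cast
  field_simp

theorem dCirc_coe (φ : Circ → ℂ) (x : ℝ) :
    dCirc φ (x : Circ) = deriv (fun t : ℝ => φ (t : Circ)) x := by
  simpa [dCirc] using deriv_comp_const_add (f := fun t : ℝ => φ (t : Circ)) x 0

theorem dCirc_fourier (n : ℤ) (y : Circ) :
    dCirc (fourier n : C(Circ, ℂ)) y = Complex.I * n * fourier n y := by
  induction y using QuotientAddGroup.induction_on with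
  | H x => exact (dCirc_coe _ x).trans (hasDerivAt_fourier_circ n x).deriv

theorem dCirc_const_mul (c : ℂ) (φ : Circ → ℂ) (y : Circ) :
    dCirc (fun y => c * φ y) y = c * dCirc φ y :=
  deriv_const_mul_field c

theorem integral_fourier_mul_dCirc {φ : C(Circ, ℂ)} (hφ : TestCirc φ) (n : ℤ) :
    ∫ y : Circ, fourier n y * dCirc φ y = -(Complex.I * n) * ∫ y : Circ, fourier n y * φ y := by
  rw [← AddCircle.intervalIntegral_preimage (2 * Real.pi) 0,
    ← AddCircle.intervalIntegral_preimage (2 * Real.pi) 0]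
  simp only [dCirc_coe, zero_add]
  have hd : Differentiable ℝ fun t : ℝ => φ (t : Circ) := hφ.differentiable (by simp)
  have hderiv : Continuous (deriv fun t : ℝ => φ (t : Circ)) := hφ.continuous_deriv (by simp)
  have hfourier : Continuous fun t : ℝ => (fourier n (t : Circ) : ℂ) :=
    (fourier n).continuous.comp (AddCircle.continuous_mk' _)
  rw [intervalIntegral.integral_mul_deriv_eq_deriv_mul
    (fun x _ => hasDerivAt_fourier_circ n x) (fun x _ => (hd x).hasDerivAt)
    ((continuous_const.mul hfourier).intervalIntegrable _ _) (hderiv.intervalIntegrable _ _)]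
  have hperiod : ((2 * Real.pi : ℝ) : Circ) = ((0 : ℝ) : Circ) := AddCircle.coe_period _
  rw [hperiod, sub_self, zero_sub, ← intervalIntegral.integral_const_mul,
    ← intervalIntegral.integral_neg]
  refine intervalIntegral.integral_congr fun x _ => ?_
  ring

theorem integral_fourier_eq_zero {n : ℤ} (hn : n ≠ 0) : ∫ y : Circ, (fourier n y : ℂ) = 0 := by
  have hparts := integral_fourier_mul_dCirc (testCirc_fourier 0) n
  simp only [dCirc_fourier, fourier_zero, Int.cast_zero, mul_zero, mul_one,
    integral_zero] at hparts
  refine (mul_eq_zero.1 hparts.symm).resolve_left (neg_ne_zero.2 ?_)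
  exact mul_ne_zero Complex.I_ne_zero (Int.cast_ne_zero.2 hn)

theorem sinC_eq (y : Circ) :
    (sinC y : ℂ) = (2 * Complex.I)⁻¹ * (fourier 1 y - fourier (-1) y) := by
  induction y using QuotientAddGroup.induction_on with
  | H x =>
    have hsin : sinC (x : Circ) = Real.sin x := rfl
    have hexp (n : ℤ) : (fourier n (x : Circ) : ℂ) = Complex.exp (n * x * Complex.I) := by
      have : (Real.pi : ℂ) ≠ 0 := Complex.ofReal_ne_zero.2 Real.pi_ne_zero
      rw [fourier_coe_apply]
      congr 1
      push_cast
      field_simp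
    change (sinC (x : Circ) : ℂ) = (2 * Complex.I)⁻¹ *
      (fourier 1 (x : Circ) - fourier (-1) (x : Circ))
    rw [hsin, hexp, hexp, Complex.ofReal_sin, Complex.sin]
    push_cast
    rw [one_mul, neg_one_mul, mul_inv, Complex.inv_I]
    ring

theorem isCharacterSystem_fourier :
    IsCharacterSystem (fun k : ℤ => (fourier k : C(Circ, ℂ))) volume where
  map_zero := ContinuousMap.ext fun _ => fourier_zero
  map_add _ _ := ContinuousMap.ext fun _ => fourier_add
  map_neg _ := ContinuousMap.ext fun _ => fourier_neg
  exists_ne _ _ hxy := ⟨1, fun h => hxy (fourier_one_injective h)⟩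
  integral_eq_zero _ := integral_fourier_eq_zero

/-- The Fourier basis of `L²(𝕋)`. -/
def fourierBasisCirc : HilbertBasis ℤ ℂ L2Circ := isCharacterSystem_fourier.basis

theorem hasWeakD_iff (f g : L2Circ) : HasWeakD f g ↔
    ∀ k, fourierBasisCirc.repr g k = Complex.I * k * fourierBasisCirc.repr f k :=
  isCharacterSystem_fourier.weak_deriv_iff (m := fun k : ℤ => Complex.I * k)
    (fun k => by rw [Int.cast_neg, mul_neg]) testCirc_fourier dCirc_fourier
    (fun _ => continuous_dCirc) (fun _ => integral_fourier_mul_dCirc) f g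

variable {l : ℤ} (hl : l ≠ 0)

/-- The Fourier basis of `L²(𝕋)`, whose `k`-th element stands for the mode `e^{i(l x + k y)}`. -/
def circBasis : HilbertBasis (Modes {⟨l, hl⟩}) ℂ L2Circ :=
  pullbackBasis fourierBasisCirc LinearIsometry.id (σ := fun i => i.2)
    (v := fun i => fourierBasisCirc i.2) (fun _ => rfl)
    (fun _ _ h => Prod.ext (Subsingleton.elim _ _) h)
    fun _ k hk => absurd ⟨(⟨⟨l, hl⟩, rfl⟩, k), rfl⟩ hk

theorem repr_circBasis (f : L2Circ) (i : Modes {⟨l, hl⟩}) :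
    (circBasis hl).repr f i = fourierBasisCirc.repr f i.2 :=
  repr_pullbackBasis ..

theorem xFreq_modes_singleton (i : Modes {⟨l, hl⟩}) : i.xFreq = l :=
  congrArg Subtype.val i.1.2

theorem ofReal_lap_singleton (i : Modes {⟨l, hl⟩}) : (lap i : ℂ) = (i.2 : ℂ) ^ 2 + (l : ℂ) ^ 2 := by
  rw [ofReal_lap, xFreq_modes_singleton]

theorem abs_le_sq_add_sq (k l : ℤ) : |k| ≤ k ^ 2 + l ^ 2 :=
  calc |k| = k.natAbs := Int.abs_eq_natAbs k
    _ ≤ k ^ 2 := Int.natAbs_le_self_sq k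
    _ ≤ k ^ 2 + l ^ 2 := le_add_of_nonneg_right (sq_nonneg l)

theorem norm_intCast_le_norm_sq_add_sq {m k l : ℤ} (h : |m| ≤ k ^ 2 + l ^ 2) :
    ‖(m : ℂ)‖ ≤ ‖(k : ℂ) ^ 2 + (l : ℂ) ^ 2‖ := by
  rw [← Int.cast_pow, ← Int.cast_pow, ← Int.cast_add, Complex.norm_intCast, Complex.norm_intCast]
  exact_mod_cast h.trans (le_abs_self _)

theorem isLaplacian_opAMode : IsLaplacian (circBasis hl) (opAMode l) := by
  intro f g
  rw [graph_opAMode]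
  simp only [repr_circBasis, ofReal_lap_singleton]
  constructor
  · rintro ⟨f₁, f₂, h₁, h₂, rfl : g = f₂ - (l : ℂ) ^ 2 • f⟩ i
    rw [repr_sub_apply, repr_smul_apply, (hasWeakD_iff _ _).1 h₂, (hasWeakD_iff f f₁).1 h₁]
    linear_combination (i.2 : ℂ) ^ 2 * fourierBasisCirc.repr f i.2 * Complex.I_sq
  · intro h
    have hg (k : ℤ) := h (⟨⟨l, hl⟩, rfl⟩, k)
    obtain ⟨f₁, hf₁⟩ := exists_repr_eq fourierBasisCirc
      (x := fun k => Complex.I * k * fourierBasisCirc.repr f k) (g := g) fun k => by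
        rw [hg, norm_neg, norm_mul, norm_mul, norm_mul, Complex.norm_I, one_mul]
        exact mul_le_mul_of_nonneg_right (norm_intCast_le_norm_sq_add_sq (abs_le_sq_add_sq k l))
          (norm_nonneg _)
    refine ⟨f₁, g + (l : ℂ) ^ 2 • f, (hasWeakD_iff f f₁).2 hf₁, (hasWeakD_iff _ _).2 fun k => ?_,
      (add_sub_cancel_right g _).symm⟩
    rw [repr_add_apply, repr_smul_apply, hf₁, hg]
    linear_combination -(k : ℂ) ^ 2 * fourierBasisCirc.repr f k * Complex.I_sq

theorem repr_eq_of_ae_eq_sinC_mul {f g : L2Circ} (h : g =ᵐ[volume] fun y => (sinC y : ℂ) * f y)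
    (i : Modes {⟨l, hl⟩}) : (circBasis hl).repr g i =
      (2 * Complex.I)⁻¹ * ((circBasis hl).repr f (yDown i) - (circBasis hl).repr f (yUp i)) := by
  rw [repr_circBasis, repr_circBasis, repr_circBasis]
  exact isCharacterSystem_fourier.repr_eq_of_ae_eq_sin_mul sinC_eq h i.2

theorem graph_opΛMode (hl : l ≠ 0) : (opΛMode l).graph = graphΛMode l := by
  refine Submodule.toLinearPMap_graph_eq _ ?_
  rintro ⟨_, g⟩ ⟨ψ, hψ, hg⟩ rfl
  refine repr_ext (circBasis hl) fun i => ?_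
  rw [repr_eq_of_ae_eq_sinC_mul hl hg, (isLaplacian_opAMode hl).repr_add hψ,
    (isLaplacian_opAMode hl).repr_add hψ, map_zero]
  simp

theorem represents_opLMode (α : ℝ) : Represents (circBasis hl) α (opLMode α l) := by
  refine (isLaplacian_opAMode hl).represents_sub_smul ?_ ?_ <;> rw [graph_opΛMode hl]
  · rintro f g ⟨ψ, hψ, hg⟩ i
    rw [repr_eq_of_ae_eq_sinC_mul hl hg, (isLaplacian_opAMode hl).repr_add hψ,
      (isLaplacian_opAMode hl).repr_add hψ, transport, xFreq_modes_singleton]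
    have := Complex.I_ne_zero
    change _ = (α : ℂ) * (l / 2 * (_ - _))
    field_simp
    rfl
  · intro f _
    obtain ⟨ψ, hψ⟩ := (isLaplacian_opAMode hl).exists_mem_graph f
    obtain ⟨g, hg⟩ := exists_ae_eq_mul (Complex.continuous_ofReal.comp continuous_sinC) (f + ψ)
    exact ⟨g, ψ, hψ, hg⟩

theorem isNondegenerateSpace_spaceYMode :
    IsNondegenerateSpace (circBasis hl) (spaceYMode l) := by
  intro f
  have hmean : fourierBasisCirc.repr f 0 = 0 ↔ ∫ y : Circ, f y = 0 := by
    rw [fourierBasisCirc, isCharacterSystem_fourier.repr_basis_eq_zero_iff]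
    simp only [neg_zero, fourier_zero, mul_one]
  change (|l| = 1 → ∫ y : Circ, f y = 0) ↔ _
  simp only [IsDegenerate, xFreq_modes_singleton, repr_circBasis, ← hmean]
  exact ⟨fun h i hi => hi.2.symm ▸ h hi.1, fun h hl₁ => h (⟨⟨l, hl⟩, rfl⟩, 0) ⟨hl₁, rfl⟩⟩

end Circle

/-! ### The torus -/

/-- The exponential `e^{i(l x + k y)}` for `p = (l, k)`. -/
def torusExp (p : ℤ × ℤ) : C(Torus, ℂ) :=
  (fourier p.1).comp ⟨Prod.fst, continuous_fst⟩ * (fourier p.2).comp ⟨Prod.snd, continuous_snd⟩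

theorem torusExp_apply (p : ℤ × ℤ) (q : Torus) :
    torusExp p q = fourier p.1 q.1 * fourier p.2 q.2 := rfl

theorem integral_torusExp_eq_zero {p : ℤ × ℤ} (hp : p ≠ 0) : ∫ q : Torus, torusExp p q = 0 := by
  have hprod := integral_prod_mul (μ := (volume : Measure Circ)) (ν := (volume : Measure Circ))
    (fun x => (fourier p.1 x : ℂ)) fun y => (fourier p.2 y : ℂ)
  simp only [torusExp_apply]
  rw [Measure.volume_eq_prod, hprod, mul_eq_zero]
  by_cases h : p.1 = 0
  · exact Or.inr (integral_fourier_eq_zero fun h' => hp (Prod.ext h h'))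
  · exact Or.inl (integral_fourier_eq_zero h)

theorem exists_torusExp_ne {q r : Torus} (h : q ≠ r) : ∃ p, torusExp p q ≠ torusExp p r := by
  by_cases hx : q.1 = r.1
  · refine ⟨(0, 1), fun hp => h (Prod.ext hx (fourier_one_injective ?_))⟩
    simpa only [torusExp_apply, fourier_zero, one_mul] using hp
  · refine ⟨(1, 0), fun hp => hx (fourier_one_injective ?_)⟩
    simpa only [torusExp_apply, fourier_zero, mul_one] using hp

theorem isCharacterSystem_torusExp : IsCharacterSystem torusExp volume where
  map_zero := ContinuousMap.ext fun q => by
    rw [torusExp_apply, Prod.fst_zero, Prod.snd_zero, fourier_zero, fourier_zero, mul_one,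
      ContinuousMap.one_apply]
  map_add j k := ContinuousMap.ext fun q => by
    rw [ContinuousMap.mul_apply, torusExp_apply, torusExp_apply, torusExp_apply, Prod.fst_add,
      Prod.snd_add, fourier_add, fourier_add, mul_mul_mul_comm]
  map_neg k := ContinuousMap.ext fun q => by
    rw [ContinuousMap.star_apply, torusExp_apply, torusExp_apply, star_mul', Prod.fst_neg,
      Prod.snd_neg, fourier_neg, fourier_neg]
    rfl
  exists_ne _ _ := exists_torusExp_ne
  integral_eq_zero _ := integral_torusExp_eq_zero

/-- The Fourier basis of `L²(𝕋²)`. -/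
def fourierBasisTorus : HilbertBasis (ℤ × ℤ) ℂ L2Torus := isCharacterSystem_torusExp.basis

theorem testTorus_torusExp (p : ℤ × ℤ) : TestTorus (torusExp p) :=
  ((testCirc_fourier p.1).comp contDiff_fst).mul ((testCirc_fourier p.2).comp contDiff_snd)

theorem dX_torusExp (p : ℤ × ℤ) (q : Torus) :
    dX (torusExp p) q = Complex.I * p.1 * torusExp p q := by
  have hslice : dX (torusExp p) q = dCirc (fun x => fourier p.2 q.2 * fourier p.1 x) q.1 := by
    simp only [mul_comm (fourier p.2 q.2)]
    rfl
  rw [hslice, dCirc_const_mul, dCirc_fourier, torusExp_apply]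
  ring

theorem dY_torusExp (p : ℤ × ℤ) (q : Torus) :
    dY (torusExp p) q = Complex.I * p.2 * torusExp p q := by
  have hslice : dY (torusExp p) q = dCirc (fun y => fourier p.1 q.1 * fourier p.2 y) q.2 := rfl
  rw [hslice, dCirc_const_mul, dCirc_fourier, torusExp_apply]
  ring

theorem integral_torus_eq {f : Torus → ℂ} (hf : Continuous f) :
    ∫ q, f q = ∫ y : Circ, ∫ x : Circ, f (x, y) := by
  rw [Measure.volume_eq_prod]
  exact integral_prod_symm f
    (hf.integrable_of_hasCompactSupport (HasCompactSupport.of_compactSpace f))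

theorem testCirc_slice {φ : C(Torus, ℂ)} (hφ : TestTorus φ) (y : Circ) :
    TestCirc (φ.comp ⟨fun x => (x, y), by fun_prop⟩) := by
  obtain ⟨t, rfl⟩ := QuotientAddGroup.mk_surjective y
  exact ContDiff.comp (f := fun s : ℝ => (s, t)) hφ (contDiff_id.prodMk contDiff_const)

theorem integral_torusExp_mul_dX {φ : C(Torus, ℂ)} (hφ : TestTorus φ) (p : ℤ × ℤ) :
    ∫ q : Torus, torusExp p q * dX φ q = -(Complex.I * p.1) * ∫ q : Torus, torusExp p q * φ q := by
  rw [integral_torus_eq ((torusExp p).continuous.fun_mul (continuous_dX hφ)),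
    integral_torus_eq ((torusExp p).continuous.fun_mul φ.continuous), ← integral_const_mul]
  refine integral_congr_ae (ae_of_all _ fun y => ?_)
  have hslice := integral_fourier_mul_dCirc (testCirc_slice hφ y) p.1
  have hcomm (u : Circ → ℂ) : ∫ x, torusExp p (x, y) * u x =
      fourier p.2 y * ∫ x : Circ, fourier p.1 x * u x := by
    rw [← integral_const_mul]
    exact integral_congr_ae (ae_of_all _ fun x => by simp only [torusExp_apply]; ring)
  change ∫ x, torusExp p (x, y) * dCirc (fun x => φ (x, y)) x =
    -(Complex.I * p.1) * ∫ x, torusExp p (x, y) * φ (x, y)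
  rw [hcomm, hcomm, mul_left_comm]
  exact congrArg _ hslice

theorem integral_torus_swap (f : Torus → ℂ) : ∫ q : Torus, f q.swap = ∫ q, f q := by
  rw [Measure.volume_eq_prod]
  exact integral_prod_swap f

theorem integral_torusExp_mul_dY {φ : C(Torus, ℂ)} (hφ : TestTorus φ) (p : ℤ × ℤ) :
    ∫ q : Torus, torusExp p q * dY φ q = -(Complex.I * p.2) * ∫ q : Torus, torusExp p q * φ q := by
  let φ' : C(Torus, ℂ) := φ.comp ⟨Prod.swap, continuous_swap⟩
  have hφ' : TestTorus φ' :=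
    ContDiff.comp (f := fun t : ℝ × ℝ => (t.2, t.1)) hφ (contDiff_snd.prodMk contDiff_fst)
  have hexp (q : Torus) : torusExp p.swap q = torusExp p q.swap := mul_comm _ _
  have hparts := integral_torusExp_mul_dX hφ' p.swap
  simp only [hexp] at hparts
  rwa [← integral_torus_swap, ← integral_torus_swap fun q => torusExp p q * φ q]

theorem hasWeakDX_iff (f g : L2Torus) : HasWeakDX f g ↔
    ∀ p, fourierBasisTorus.repr g p = Complex.I * p.1 * fourierBasisTorus.repr f p :=
  isCharacterSystem_torusExp.weak_deriv_iff (m := fun p : ℤ × ℤ => Complex.I * p.1)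
    (fun p => by rw [Prod.fst_neg, Int.cast_neg, mul_neg]) testTorus_torusExp dX_torusExp
    (fun _ => continuous_dX) (fun _ => integral_torusExp_mul_dX) f g

theorem hasWeakDY_iff (f g : L2Torus) : HasWeakDY f g ↔
    ∀ p, fourierBasisTorus.repr g p = Complex.I * p.2 * fourierBasisTorus.repr f p :=
  isCharacterSystem_torusExp.weak_deriv_iff (m := fun p : ℤ × ℤ => Complex.I * p.2)
    (fun p => by rw [Prod.snd_neg, Int.cast_neg, mul_neg]) testTorus_torusExp dY_torusExp
    (fun _ => continuous_dY) (fun _ => integral_torusExp_mul_dY) f g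

theorem hasWeakDX_congr {f f' : Torus → ℂ} (h : f =ᵐ[volume] f') (g : L2Torus) :
    HasWeakDX f g ↔ HasWeakDX f' g := by
  refine forall₂_congr fun φ _ => ?_
  rw [integral_congr_ae (h.mono fun q hq => congrArg (· * dX φ q) hq)]

theorem hasWeakDX_sinMul_iff (f g : L2Torus) : HasWeakDX (sinMul f) g ↔
    ∀ p, fourierBasisTorus.repr g p = p.1 / 2 *
      (fourierBasisTorus.repr f (p.1, p.2 - 1) - fourierBasisTorus.repr f (p.1, p.2 + 1)) := by
  obtain ⟨w, hw⟩ : ∃ w : L2Torus, w =ᵐ[volume] sinMul f := exists_ae_eq_mul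
    (Complex.continuous_ofReal.comp (continuous_sinC.comp continuous_snd)) f
  have hsin (q : Torus) : (sinC q.2 : ℂ) =
      (2 * Complex.I)⁻¹ * (torusExp (0, 1) q - torusExp (-(0, 1)) q) := by
    simp only [sinC_eq, torusExp_apply, Prod.neg_mk, neg_zero, fourier_zero, one_mul]
  have hI : Complex.I * (2 * Complex.I)⁻¹ = 1 / 2 := by
    have := Complex.I_ne_zero
    field_simp
  have hcoeff (p : ℤ × ℤ) := isCharacterSystem_torusExp.repr_eq_of_ae_eq_sin_mul hsin hw p
  rw [hasWeakDX_congr hw.symm, hasWeakDX_iff]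
  refine forall_congr' fun p => ?_
  rw [fourierBasisTorus, hcoeff, Prod.sub_def, Prod.add_def, sub_zero, add_zero, ← mul_assoc,
    mul_right_comm Complex.I, hI, one_div_mul_eq_div]

theorem exists_repr_eq_mul_of_repr_eq_lap {f g : L2Torus}
    (hg : ∀ p : ℤ × ℤ, fourierBasisTorus.repr g p =
      -(((p.2 : ℂ) ^ 2 + (p.1 : ℂ) ^ 2) * fourierBasisTorus.repr f p))
    {m : ℤ × ℤ → ℤ} (hm : ∀ p, |m p| ≤ p.2 ^ 2 + p.1 ^ 2) (c : ℂ) :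
    ∃ u, ∀ p, fourierBasisTorus.repr u p = c * (m p * fourierBasisTorus.repr f p) := by
  obtain ⟨u, hu⟩ := exists_repr_eq fourierBasisTorus
    (x := fun p => m p * fourierBasisTorus.repr f p) (g := g) fun p => by
      rw [hg, norm_neg, norm_mul, norm_mul]
      exact mul_le_mul_of_nonneg_right (norm_intCast_le_norm_sq_add_sq (hm p)) (norm_nonneg _)
  exact ⟨c • u, fun p => by rw [repr_smul_apply, hu]⟩

theorem exists_weakDerivs_of_repr_eq_lap {f g : L2Torus}
    (hg : ∀ p : ℤ × ℤ, fourierBasisTorus.repr g p =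
      -(((p.2 : ℂ) ^ 2 + (p.1 : ℂ) ^ 2) * fourierBasisTorus.repr f p)) :
    ∃ fx fy fxx fxy fyy : L2Torus, HasWeakDX f fx ∧ HasWeakDY f fy ∧ HasWeakDX fx fxx ∧
      HasWeakDY fx fxy ∧ HasWeakDY fy fyy ∧ g = fxx + fyy := by
  obtain ⟨fx, hx⟩ := exists_repr_eq_mul_of_repr_eq_lap hg (m := fun p => p.1)
    (fun p => add_comm (p.1 ^ 2) (p.2 ^ 2) ▸ abs_le_sq_add_sq p.1 p.2) Complex.I
  obtain ⟨fy, hy⟩ := exists_repr_eq_mul_of_repr_eq_lap hg (m := fun p => p.2)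
    (fun p => abs_le_sq_add_sq p.2 p.1) Complex.I
  obtain ⟨fxx, hxx⟩ := exists_repr_eq_mul_of_repr_eq_lap hg (m := fun p => p.1 ^ 2)
    (fun p => by rw [abs_sq]; exact le_add_of_nonneg_left (sq_nonneg _)) (-1)
  obtain ⟨fxy, hxy⟩ := exists_repr_eq_mul_of_repr_eq_lap hg (m := fun p => p.1 * p.2)
    (fun p => abs_le.2 ⟨by nlinarith [sq_nonneg (p.1 + p.2)], by nlinarith [sq_nonneg (p.1 - p.2)]⟩)
    (-1)
  refine ⟨fx, fy, fxx, fxy, g - fxx, (hasWeakDX_iff _ _).2 fun p => ?_,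
    (hasWeakDY_iff _ _).2 fun p => ?_, (hasWeakDX_iff _ _).2 fun p => ?_,
    (hasWeakDY_iff _ _).2 fun p => ?_, (hasWeakDY_iff _ _).2 fun p => ?_,
    (add_sub_cancel fxx g).symm⟩
  · rw [hx, mul_assoc]
  · rw [hy, mul_assoc]
  · rw [hxx, hx]
    push_cast
    linear_combination -(p.1 : ℂ) ^ 2 * fourierBasisTorus.repr f p * Complex.I_sq
  · rw [hxy, hx]
    push_cast
    linear_combination -(p.1 : ℂ) * p.2 * fourierBasisTorus.repr f p * Complex.I_sq
  · rw [repr_sub_apply, hxx, hy, hg]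
    push_cast
    linear_combination -(p.2 : ℂ) ^ 2 * fourierBasisTorus.repr f p * Complex.I_sq

/-! ### Functions of zero mean in `x` -/

theorem repr_eq_zero_of_mem_L2Zero {f : L2Torus} (hf : f ∈ L2Zero) (k : ℤ) :
    fourierBasisTorus.repr f (0, k) = 0 := by
  refine (isCharacterSystem_torusExp.repr_basis_eq_zero_iff f _).2 ?_
  have hint := integrable_mul_continuous (integrable_L2 f) (torusExp (-(0, k))).continuous
  refine (integral_prod_symm _ hint).trans (integral_eq_zero_of_ae ?_)
  have hmean : ∀ᵐ y : Circ, ∫ x : Circ, f (x, y) = 0 := hf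
  filter_upwards [hmean] with y hy
  simp only [torusExp_apply, Prod.neg_mk, neg_zero, fourier_zero, one_mul]
  rw [integral_mul_const, hy, zero_mul]
  rfl

theorem fourierBasisTorus_mem_L2Zero {p : ℤ × ℤ} (hp : p.1 ≠ 0) :
    fourierBasisTorus p ∈ L2Zero := by
  rw [fourierBasisTorus, isCharacterSystem_torusExp.basis_apply]
  refine L2Zero.smul_mem _ ?_
  change ∀ᵐ y : Circ, ∫ x : Circ, (ContinuousMap.toLp 2 volume ℂ (torusExp p) : L2Torus) (x, y) = 0
  filter_upwards [ae_slice (ContinuousMap.coeFn_toLp (p := 2) (𝕜 := ℂ) volume (torusExp p))]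
    with y hy
  rw [integral_congr_ae hy]
  simp only [torusExp_apply]
  rw [integral_mul_const, integral_fourier_eq_zero hp, zero_mul]

theorem forall_frequency_iff {P : ℤ × ℤ → Prop} (h₀ : ∀ k, P (0, k)) :
    (∀ p, P p) ↔ ∀ i : Modes Set.univ, P (i.xFreq, i.2) := by
  refine ⟨fun h i => h _, fun h p => ?_⟩
  obtain ⟨l, k⟩ := p
  by_cases hl : l = 0
  · exact hl ▸ h₀ k
  · exact h (⟨⟨l, hl⟩, trivial⟩, k)

theorem repr_coe_zero (f : SpaceX) (k : ℤ) : fourierBasisTorus.repr (f : L2Torus) (0, k) = 0 :=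
  repr_eq_zero_of_mem_L2Zero (show L2Zero from f).2 k

/-- The Fourier basis of `L²₀(𝕋²)`. -/
def spaceBasis : HilbertBasis (Modes Set.univ) ℂ SpaceX :=
  pullbackBasis fourierBasisTorus SpaceX.incl (σ := fun i => (i.xFreq, i.2))
    (v := fun i => (⟨fourierBasisTorus (i.xFreq, i.2),
      fourierBasisTorus_mem_L2Zero (xFreq_ne_zero i)⟩ : L2Zero))
    (fun _ => rfl)
    (fun _ _ h => have hfreq := Prod.mk.inj h
      Prod.ext (Subtype.ext (Subtype.ext hfreq.1)) hfreq.2)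
    fun f => (forall_frequency_iff fun k _ => repr_coe_zero f k).2 fun i hi => absurd ⟨i, rfl⟩ hi

theorem repr_spaceBasis (f : SpaceX) (i : Modes Set.univ) :
    spaceBasis.repr f i = fourierBasisTorus.repr (f : L2Torus) (i.xFreq, i.2) :=
  repr_pullbackBasis ..

theorem isLaplacian_opA : IsLaplacian spaceBasis opA := by
  intro f g
  rw [graph_opA]
  constructor
  · rintro ⟨fx, fy, fxx, fxy, fyy, hfx : HasWeakDX (f : L2Torus) fx,
      hfy : HasWeakDY (f : L2Torus) fy, hfxx, -, hfyy, hg : (g : L2Torus) = fxx + fyy⟩ i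
    rw [repr_spaceBasis, repr_spaceBasis, hg, repr_add_apply, (hasWeakDX_iff _ _).1 hfxx,
      (hasWeakDX_iff _ _).1 hfx, (hasWeakDY_iff _ _).1 hfyy, (hasWeakDY_iff _ _).1 hfy, ofReal_lap]
    linear_combination ((i.xFreq : ℂ) ^ 2 + (i.2 : ℂ) ^ 2) *
      fourierBasisTorus.repr (f : L2Torus) (i.xFreq, i.2) * Complex.I_sq
  · intro h
    refine exists_weakDerivs_of_repr_eq_lap ((forall_frequency_iff fun k => ?_).2 fun i => ?_)
    · rw [repr_coe_zero, repr_coe_zero, mul_zero, neg_zero]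
    · rw [← repr_spaceBasis, ← repr_spaceBasis, h i, ofReal_lap]

theorem hasWeakDX_sinMul_coe_iff (f g : SpaceX) :
    HasWeakDX (sinMul (f : L2Torus)) (g : L2Torus) ↔ ∀ i : Modes Set.univ,
      spaceBasis.repr g i =
        i.xFreq / 2 * (spaceBasis.repr f (yDown i) - spaceBasis.repr f (yUp i)) := by
  rw [hasWeakDX_sinMul_iff, forall_frequency_iff fun k => by
    rw [repr_coe_zero, Int.cast_zero, zero_div, zero_mul]]
  simp only [repr_spaceBasis]
  rfl

theorem hasWeakDX_sinMul_add_iff {f ψ : SpaceX} (hψ : (ψ, f) ∈ opA.graph) (g : SpaceX) :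
    HasWeakDX (sinMul ((f + ψ : SpaceX) : L2Torus)) (g : L2Torus) ↔
      ∀ i, spaceBasis.repr g i = transport (spaceBasis.repr f) i := by
  rw [hasWeakDX_sinMul_coe_iff]
  simp only [isLaplacian_opA.repr_add hψ]
  rfl

theorem graph_opΛ : opΛ.graph = graphΛ := by
  refine Submodule.toLinearPMap_graph_eq _ ?_
  rintro ⟨_, h⟩ ⟨-, ψ, g, hψ, hg, hh : h = -Complex.I • g⟩ rfl
  have hg₀ : g = 0 := repr_ext spaceBasis fun i => by
    rw [(hasWeakDX_sinMul_add_iff hψ g).1 hg, map_zero, transport]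
    simp
  rw [hh, hg₀, smul_zero]

theorem exists_hasWeakDX_sinMul {f : SpaceX} (hf : InLapDomain (spaceBasis.repr f)) :
    ∃ k : SpaceX, HasWeakDX (sinMul (f : L2Torus)) (k : L2Torus) := by
  obtain ⟨g, hg⟩ := isLaplacian_opA.exists_mem_graph_of_inLapDomain hf
  obtain ⟨u, hu⟩ := exists_repr_eq spaceBasis
    (x := fun i => i.xFreq / 2 * spaceBasis.repr f i) (g := g) fun i => by
      have hx := norm_intCast_le_norm_sq_add_sq
        (add_comm (i.xFreq ^ 2) (i.2 ^ 2) ▸ abs_le_sq_add_sq i.xFreq i.2)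
      rw [(isLaplacian_opA f g).1 hg, norm_neg, norm_mul, norm_mul, norm_div, ofReal_lap,
        Complex.norm_ofNat]
      refine mul_le_mul_of_nonneg_right ?_ (norm_nonneg _)
      exact (half_le_self (norm_nonneg _)).trans hx
  obtain ⟨k, hk⟩ := exists_repr_eq_yDown_sub_yUp spaceBasis u
  refine ⟨k, (hasWeakDX_sinMul_coe_iff f k).2 fun i => ?_⟩
  rw [hk, hu, hu]
  exact (mul_sub _ _ _).symm

theorem represents_opL (α : ℝ) : Represents spaceBasis α (opL α) := by
  refine isLaplacian_opA.represents_sub_smul ?_ ?_ <;> rw [graph_opΛ]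
  · rintro f _ ⟨-, ψ, g, hψ, hg, rfl⟩ i
    rw [repr_smul_apply, (hasWeakDX_sinMul_add_iff hψ g).1 hg]
    linear_combination -α * transport (spaceBasis.repr f) i * Complex.I_sq
  · intro f hf
    obtain ⟨ψ, hψ⟩ := isLaplacian_opA.exists_mem_graph f
    obtain ⟨g, hg⟩ := exists_repr_eq_transport hf
    exact ⟨-Complex.I • g, exists_hasWeakDX_sinMul hf, ψ, g, hψ,
      (hasWeakDX_sinMul_add_iff hψ g).2 hg, rfl⟩

theorem isNondegenerateSpace_spaceY : IsNondegenerateSpace spaceBasis spaceY := by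
  intro f
  have hmode (l : ℤ) : fourierBasisTorus.repr (f : L2Torus) (l, 0) = 0 ↔
      ∀ x : Circ, ∫ y : Circ, modeProj l (f : L2Torus) (x, y) = 0 := by
    rw [integral_modeProj_eq_zero_iff, fourierBasisTorus,
      isCharacterSystem_torusExp.repr_basis_eq_zero_iff]
    simp only [torusExp_apply, Prod.neg_mk, neg_zero, fourier_zero, mul_one]
  change (∀ l : ℤ, |l| = 1 → ∀ x : Circ, ∫ y : Circ, modeProj l (f : L2Torus) (x, y) = 0) ↔ _
  simp only [← hmode, repr_spaceBasis]
  refine ⟨fun h i hi => hi.2.symm ▸ h i.xFreq hi.1, fun h l hl => ?_⟩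
  have hl₀ : l ≠ 0 := fun hl₀ => by simp [hl₀] at hl
  exact h (⟨⟨l, hl₀⟩, trivial⟩, 0) ⟨hl, rfl⟩

end Kolmogorov

end

open Kolmogorov in
theorem mainTheorem8_general :
    ((∀ α lam : ℝ,
        Complex.I * (lam : ℂ) ∈ opResolventSet (compression spaceY (opL α)) ∧
        Complex.I * (lam : ℂ) ∈ opResolventSet (opL α)) ∧
      Tendsto (fun α : ℝ => ⨆ lam : ℝ,
          ‖opResolvent (compression spaceY (opL α)) (Complex.I * (lam : ℂ))‖ₑ)
        (comap (fun α : ℝ => |α|) atTop) (𝓝 0) ∧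
      Tendsto (fun α : ℝ => ⨆ lam : ℝ,
          ‖spaceY.starProjection ∘L opResolvent (opL α) (Complex.I * (lam : ℂ))‖ₑ)
        (comap (fun α : ℝ => |α|) atTop) (𝓝 0)) ∧
    ∀ l : ℤ, l ≠ 0 →
      ((∀ α lam : ℝ,
          Complex.I * (lam : ℂ) ∈ opResolventSet (compression (spaceYMode l) (opLMode α l)) ∧
          Complex.I * (lam : ℂ) ∈ opResolventSet (opLMode α l)) ∧
        Tendsto (fun α : ℝ => ⨆ lam : ℝ,
            ‖opResolvent (compression (spaceYMode l) (opLMode α l)) (Complex.I * (lam : ℂ))‖ₑ)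
          (comap (fun α : ℝ => |α|) atTop) (𝓝 0) ∧
        Tendsto (fun α : ℝ => ⨆ lam : ℝ,
            ‖(spaceYMode l).starProjection ∘L opResolvent (opLMode α l) (Complex.I * (lam : ℂ))‖ₑ)
          (comap (fun α : ℝ => |α|) atTop) (𝓝 0)) := by
  refine ⟨⟨fun α lam => ⟨?_, ?_⟩, ?_, ?_⟩, fun l hl => ⟨fun α lam => ⟨?_, ?_⟩, ?_, ?_⟩⟩
  · exact ⟨_, (represents_opL α).isResolvent_compression isNondegenerateSpace_spaceY lam⟩
  · exact ⟨_, (represents_opL α).isResolvent lam⟩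
  · exact tendsto_iSup_opResolvent_compression represents_opL isNondegenerateSpace_spaceY
  · exact tendsto_iSup_starProjection_comp_opResolvent represents_opL isNondegenerateSpace_spaceY
  · exact ⟨_, (represents_opLMode hl α).isResolvent_compression
      (isNondegenerateSpace_spaceYMode hl) lam⟩
  · exact ⟨_, (represents_opLMode hl α).isResolvent lam⟩
  · exact tendsto_iSup_opResolvent_compression (represents_opLMode hl)
      (isNondegenerateSpace_spaceYMode hl)
  · exact tendsto_iSup_starProjection_comp_opResolvent (represents_opLMode hl)
      (isNondegenerateSpace_spaceYMode hl)

open Kolmogorov in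
/-- For large `|α|` the imaginary axis lies in the resolvent sets of `Q L_α` (in `Y`) and of `L_α`
(in `X = L²₀(𝕋²)`), and the suprema over the axis of `‖(iλ - Q L_α)⁻¹‖` and `‖Q (iλ - L_α)⁻¹‖`
tend to `0` as `|α| → ∞`; likewise for `L_{α,l}` in `L²(𝕋)`, for every `l ≠ 0`. -/
theorem mainTheorem8 :
    ((∀ᶠ α : ℝ in comap (fun α : ℝ => |α|) atTop, ∀ lam : ℝ,
        Complex.I * (lam : ℂ) ∈ opResolventSet (compression spaceY (opL α)) ∧
        Complex.I * (lam : ℂ) ∈ opResolventSet (opL α)) ∧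
      Tendsto (fun α : ℝ => ⨆ lam : ℝ,
          ‖opResolvent (compression spaceY (opL α)) (Complex.I * (lam : ℂ))‖ₑ)
        (comap (fun α : ℝ => |α|) atTop) (𝓝 0) ∧
      Tendsto (fun α : ℝ => ⨆ lam : ℝ,
          ‖spaceY.starProjection ∘L opResolvent (opL α) (Complex.I * (lam : ℂ))‖ₑ)
        (comap (fun α : ℝ => |α|) atTop) (𝓝 0)) ∧
    ∀ l : ℤ, l ≠ 0 →
      ((∀ᶠ α : ℝ in comap (fun α : ℝ => |α|) atTop, ∀ lam : ℝ,
          Complex.I * (lam : ℂ) ∈ opResolventSet (compression (spaceYMode l) (opLMode α l)) ∧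
          Complex.I * (lam : ℂ) ∈ opResolventSet (opLMode α l)) ∧
        Tendsto (fun α : ℝ => ⨆ lam : ℝ,
            ‖opResolvent (compression (spaceYMode l) (opLMode α l)) (Complex.I * (lam : ℂ))‖ₑ)
          (comap (fun α : ℝ => |α|) atTop) (𝓝 0) ∧
        Tendsto (fun α : ℝ => ⨆ lam : ℝ,
            ‖(spaceYMode l).starProjection ∘L opResolvent (opLMode α l) (Complex.I * (lam : ℂ))‖ₑ)
          (comap (fun α : ℝ => |α|) atTop) (𝓝 0)) :=
  let ⟨⟨h, hlim⟩, hmode⟩ := mainTheorem8_general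
  ⟨⟨.of_forall h, hlim⟩, fun l hl => ⟨.of_forall (hmode l hl).1, (hmode l hl).2⟩⟩
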